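/- **Setting.** Let $N\ge 3$, $m\ge 1$, $0<x<1$, and let $r\in\mathbb C$, $r\neq 1$, be such that $[rn]\ne 0$ for all integers $n\ge1$, where $x^a=e^{a\log x}$ and $[a]=\frac{x^a-x^{-a}}{x-x^{-1}}$. Put $r^*=r-1$; fix square roots $\rho=\sqrt{r^*/r}$ and $\sqrt{rr^*}$ (any determinations), and let $\sqrt{r/r^*}=\rho^{-1}$. Let $s\in\mathbb C$. Colours $1,\dots,N$ are read cyclically. For $\operatorname{Re}R>0$ let $$[u]_R=x^{\frac{u^2}{R}-u}\frac{\Theta_{x^{2R}}(x^{2u})}{(x^{2R};x^{2R})_\infty^3},\quad \Theta_q(z)=(z;q)_\infty(qz^{-1};q)_\infty(q;q)_\infty,\quad (z;q)_\infty=\prod_{j\ge0}(1-q^jz).$$ Let $\epsilon_1,\dots,\epsilon_N$ be the standard basis of $\mathbb R^N$, $\bar\epsilon_i=\epsilon_i-\frac1N\sum_j\epsilon_j$, $P=\sum_i\mathbb Z\bar\epsilon_i$, $\alpha_j=\bar\epsilon_j-\bar\epsilon_{j+1}$. The oscillators $\beta^j_n$ ($1\le j\le N$, $n\in\mathbb Z\setminus\{0\}$)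 satisfy $$[\beta^i_n,\beta^j_{n'}]=\delta_{n+n',0}\cdot\begin{cases} n\frac{[r^*n]}{[rn]}\frac{[(s-1)n]}{[sn]}& i=j\\ -n\frac{[r^*n]}{[rn]}\frac{[n]}{[sn]}x^{sn\,\mathrm{sgn}(i-j)}& i\ne j,\end{cases}$$ and act on the Fock spaces $\mathcal F_{l,k}=\mathbb C[\beta^j_{-n}]\,|l,k\rangle$ ($l,k\in P$), with $\beta^j_n|l,k\rangle=0$ for $n>0$. The zero modes act by $P_\lambda=(\lambda,\rho^{-1}l-\rho k)$ on $\mathcal F_{l,k}$, and $e^{i\rho Q_\lambda}$, $e^{-i\rho^{-1}Q_\lambda}$ map $|l,k\rangle$ to $|l,k-\lambda\rangle$, $|l-\lambda,k\rangle$ and commute with the oscillators. **The automorphism.** $\eta$ maps $\beta^j_n\mapsto x^{-\frac{2s}Nn}\beta^{j+1}_n$ ($j<N$), $\beta^N_n\mapsto x^{\frac{2s}N(N-1)n}\beta^1_n$, $\epsilon_i\mapsto\epsilon_{i+1}$. It is implemented on $\bigoplus_{l,k}\mathcal F_{l,k}$ and its completion by $\beta^{j_1}_{-n_1}\cdots|l,k\rangle\mapsto\eta(\beta^{j_1}_{-n_1})\cdots|\eta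 l,\eta k\rangle$, and it acts on operators by conjugation. **Screening currents.** Let $B^j_n=(\beta^j_n-\beta^{j+1}_n)x^{-\frac{2s}Njn}$ ($j<N$), $B^N_n=x^{-2sn}\beta^N_n-\beta^1_n$. With $V=F$, $c=\rho$, $f_n=1$, or $V=E$, $c=-\rho^{-1}$, $f_n=-[rn]/[r^*n]$, put $$V_j(z)=e^{icQ_{\alpha_j}}\,(x^{(\frac{2s}N-1)j}z)^{cP_{\alpha_j}+c^2}:\exp\Big(\sum_{n\ne0}\tfrac1n f_nB^j_nz^{-n}\Big):\quad(j<N),$$ $$V_N(z)=e^{icQ_{\alpha_N}}\,(x^{2s-N}z)^{cP_{\bar\epsilon_N}+\frac{c^2}2}z^{-cP_{\bar\epsilon_1}+\frac{c^2}2}:\exp\Big(\sum_{n\ne0}\tfrac1n f_nB^N_nz^{-n}\Big):.$$ **Regimes.** Regime (+): $\operatorname{Re}r>0$ with $R=r$ (for $F$), $\operatorname{Re}r^*<0$ with $R=-r^*$ (for $E$); here $A=\frac sN$, $B=\frac sN-1$, $\sigma=1$. Regime (−): $\operatorname{Re}r<0$ with $R=-r$ (for $F$), $\operatorname{Re}r^*>0$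 with $R=r^*$ (for $E$); here $A=\frac sN-1$, $B=\frac sN$, $\sigma=-1$. Define $\tau$ by $R\tau=-\pi i/\log x$. **Theta function.** Let $\vartheta(u^{(1)}|\cdots|u^{(N)})$ be any function with values in functions of the zero modes (a scalar on each $\mathcal F_{l,k}$), independent of $s$, entire in $u\in\mathbb C^N$, such that for all $t$ and all $k\in\mathbb C$ $$\vartheta(\cdots|u^{(t)}+R|\cdots)=\vartheta(u),\qquad \vartheta(\cdots|u^{(t)}+R\tau|\cdots)=e^{-2\pi i\tau+\frac{2\pi i}R(u^{(t-1)}-2u^{(t)}+u^{(t+1)}+\sqrt{rr^*}P_{\alpha_t})}\vartheta(u),$$ $$\vartheta(u^{(1)}+k|\cdots|u^{(N)}+k)=\vartheta(u),\qquad \eta(\vartheta(u^{(1)}|\cdots|u^{(N)}))=\vartheta(u^{(N)}|u^{(1)}|\cdots|u^{(N-1)}).$$ **Integrals.** With $z^{(t)}_j=x^{2u^{(t)}_j}$, let $\mathcal G_m$ (for $V=F$), resp. $\mathcal G^*_m$ (for $V=E$), be $$\prod_{t=1}^N\prod_{j=1}^m\oint\frac{dz^{(t)}_j}{2\pi i z^{(t)}_j}\;V_1(z^{(1)}_1)\cdots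 V_1(z^{(1)}_m)\cdots V_N(z^{(N)}_1)\cdots V_N(z^{(N)}_m)\;\frac{\prod_{t}\prod_{i<j}[u^{(t)}_i-u^{(t)}_j]_R[u^{(t)}_j-u^{(t)}_i-\sigma]_R}{\prod_{t=1}^{N-1}\prod_{i,j}[u^{(t)}_i-u^{(t+1)}_j-B]_R\prod_{i,j}[u^{(1)}_i-u^{(N)}_j+A]_R}\;\vartheta\Big(\sum_ju^{(1)}_j\Big|\cdots\Big|\sum_ju^{(N)}_j\Big),$$ understood through matrix elements in the basis of monomials in the $\beta^j_{-n}$: the ordered product is the sum over intermediate states for $|z^{(1)}_1|\gg\cdots\gg|z^{(1)}_m|\gg|z^{(2)}_1|\gg\cdots\gg|z^{(N)}_m|$, and the integrand, as a function of the $u^{(t)}_j$, is continued analytically to the contour. * In regime (+) with $0<\operatorname{Re}s<N$ the contour is the torus $|z^{(t)}_j|=1$ (with $\operatorname{Re}u_j^{(t)}=0$, $\arg z_j^{(t)}\in[0,2\pi]$), which satisfies $|x^{2A}z^{(t+1)}_j|<|z^{(t)}_i|<|x^{2B}z^{(t+1)}_j|$ for all $t$ (cyclically). * In regime (+), for generic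 $s\in\mathbb C$, the operator is the analytic continuation in $s$ of these matrix elements, along any connected open set meeting the strip. * In regime (−), let $\mathcal G(s,\delta)$ be the integral over the same torus with the integrand multiplied by $$\prod_{t=1}^N\prod_{i,j}\frac{(x^{2A}z^{(t+1)}_j/z^{(t)}_i;x^{2R})_\infty\,(x^{-2B}z^{(t)}_i/z^{(t+1)}_j;x^{2R})_\infty}{(x^{2A+2\delta}z^{(t+1)}_j/z^{(t)}_i;x^{2R})_\infty\,(x^{-2B+2\delta}z^{(t)}_i/z^{(t+1)}_j;x^{2R})_\infty},$$ for $0<\operatorname{Re}s<N$, $\operatorname{Re}(A+\delta)>0>\operatorname{Re}(B-\delta)$; the operator at $s$ is the value at $(s,0)$ of the analytic continuation of $\mathcal G(s,\delta)$ in $(s,\delta)$. (That is, the contour separates the poles $z^{(t)}_i=x^{2A+2Rn}z^{(t+1)}_j$ from the poles $z^{(t)}_i=x^{2B-2Rn}z^{(t+1)}_j$, $n\ge0$.) **Theorem.** In both regimes the matrix elements of the integrals over the torus (with $\delta=0$ in regime (+), and for all $(s,\delta)$ with $0<\operatorname{Re}s<N$, $\operatorname{Re}(A+\delta)>0>\operatorname{Re}(B-\delta)$)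 are well defined. If $\operatorname{Re}r\neq0$, then $\eta(\mathcal G_m)=\mathcal G_m$; if $\operatorname{Re}r^*\ne0$, then $\eta(\mathcal G_m^*)=\mathcal G_m^*$; both for $0<\operatorname{Re}s<N$ and for every $s$ to which the operators are continued analytically. -/

import Mathlib

open scoped Topology BigOperators

noncomputable section

namespace NonlocalIM

/-! ### Scalars and theta functions -/

/-- `x ^ a` for a positive real base `x` and a complex exponent `a`. -/
def xpow (x : ℝ) (a : ℂ) : ℂ := Complex.exp (a * (Real.log x : ℂ))

/-- `[a] = (x ^ a - x ^ (-a)) / (x - x⁻¹)`. -/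
def bracket (x : ℝ) (a : ℂ) : ℂ := (xpow x a - xpow x (-a)) / ((x : ℂ) - (x : ℂ)⁻¹)

/-- `(z; q)_∞ = ∏_{j ≥ 0} (1 - q ^ j z)`. -/
def qPoch (z q : ℂ) : ℂ := ∏' j : ℕ, (1 - q ^ j * z)

/-- `Θ_q(z) = (z; q)_∞ (q z⁻¹; q)_∞ (q; q)_∞`. -/
def bigTheta (q z : ℂ) : ℂ := qPoch z q * qPoch (q * z⁻¹) q * qPoch q q

/-- The Jacobi theta function `[u]_R`. -/
def theta (x : ℝ) (R u : ℂ) : ℂ :=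
  xpow x (u ^ 2 / R - u) * bigTheta (xpow x (2 * R)) (xpow x (2 * u))
    / qPoch (xpow x (2 * R)) (xpow x (2 * R)) ^ 3

/-! ### Weights

Colours `1, …, N` are the elements `0, …, N - 1` of `Fin N`; `finRotate N` is the cyclic
successor `t ↦ t + 1`. -/

/-- `ε̄_i = ε_i - (1/N) ∑_j ε_j`. -/
def ebarVec (N : ℕ) (i : Fin N) : Fin N → ℝ := fun k => (Pi.single i 1 : Fin N → ℝ) k - 1 / (N : ℝ)

/-- The weight lattice `P = ∑ ℤ ε̄_i`. -/
def weightLattice (N : ℕ) : AddSubgroup (Fin N → ℝ) :=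
  AddSubgroup.closure (Set.range (ebarVec N))

def ebar {N : ℕ} (i : Fin N) : weightLattice N :=
  ⟨ebarVec N i, AddSubgroup.subset_closure ⟨i, rfl⟩⟩

/-- `α_j = ε̄_j - ε̄_{j+1}`, cyclically. -/
def alpha {N : ℕ} (j : Fin N) : weightLattice N := ebar j - ebar (finRotate N j)

/-- The linear map of `ℝ^N` with `ε_i ↦ ε_{i+1}`. -/
def rotVec (N : ℕ) : (Fin N → ℝ) ≃+ (Fin N → ℝ) :=
  (LinearEquiv.funCongrLeft ℝ ℝ (finRotate N).symm).toAddEquiv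

theorem rotVec_ebarVec (N : ℕ) (i : Fin N) :
    rotVec N (ebarVec N i) = ebarVec N (finRotate N i) := by
  funext k
  change ebarVec N i ((finRotate N).symm k) = _
  simp only [ebarVec, Pi.single_apply, Equiv.symm_apply_eq]

theorem map_rotVec_weightLattice (N : ℕ) :
    (weightLattice N).map (rotVec N : (Fin N → ℝ) →+ (Fin N → ℝ)) = weightLattice N := by
  unfold weightLattice
  rw [AddMonoidHom.map_closure]
  congr 1
  ext f
  constructor
  · rintro ⟨_, ⟨i, rfl⟩, rfl⟩
    exact ⟨finRotate N i, (rotVec_ebarVec N i).symm⟩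
  · rintro ⟨i, rfl⟩
    refine ⟨ebarVec N ((finRotate N).symm i), ⟨_, rfl⟩, ?_⟩
    have h := rotVec_ebarVec N ((finRotate N).symm i)
    rw [Equiv.apply_symm_apply] at h
    exact h

/-- The action of `η` on `P`. -/
def etaWeight (N : ℕ) : weightLattice N ≃+ weightLattice N :=
  ((rotVec N).addSubgroupMap (weightLattice N)).trans
    (AddEquiv.addSubgroupCongr (map_rotVec_weightLattice N))

/-! ### Fock spaces -/

/-- Labels `(l, k)` of the Fock spaces `F_{l,k}`. -/
abbrev Sector (N : ℕ) : Type := weightLattice N × weightLattice N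

/-- Index `(j, n)` of a creation operator `β_{-n}^j`, `n > 0`. -/
abbrev OscIndex (N : ℕ) : Type := Fin N × ℕ+

/-- `ℂ[β_{-n}^j]`; the variable `(j, n)` is `β_{-n}^j`. -/
abbrev Osc (N : ℕ) : Type := MvPolynomial (OscIndex N) ℂ

/-- `⊕_{l,k} F_{l,k}`; `Finsupp.single (l, k) p` is `p |l, k⟩`. -/
abbrev Fock (N : ℕ) : Type := Sector N →₀ Osc N

/-- The completed Fock space: arbitrary families of coefficients with respect to the basis
`∏ (β_{-n}^j) ^ (ν (j, n)) |l, k⟩`. -/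
abbrev FockHat (N : ℕ) : Type := Sector N → (OscIndex N →₀ ℕ) → ℂ

/-- Operators given by arbitrary matrix elements. -/
abbrev Op (N : ℕ) : Type := Fock N →ₗ[ℂ] FockHat N

/-- The inclusion of the Fock space in its completion. -/
def incl (N : ℕ) : Fock N →ₗ[ℂ] FockHat N where
  toFun ψ := fun v ν => MvPolynomial.coeff ν (ψ v)
  map_add' ψ φ := by funext v ν; simp
  map_smul' c ψ := by funext v ν; simp

/-- The basis vector `∏ (β_{-n}^j) ^ (μ (j, n)) |l, k⟩`, `v = (l, k)`. -/
def ket {N : ℕ} (v : Sector N) (μ : OscIndex N →₀ ℕ) : Fock N :=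
  Finsupp.single v (MvPolynomial.monomial μ 1)

/-- The operator `p |v⟩ ↦ f(v) T(p) |σ v⟩`. -/
def sectorOp {N : ℕ} (σ : Sector N → Sector N) (f : Sector N → ℂ) (T : Module.End ℂ (Osc N)) :
    Module.End ℂ (Fock N) :=
  Finsupp.lsum ℂ fun v => Finsupp.lsingle (σ v) ∘ₗ (f v • T)

/-- A function of the zero modes, i.e. the operator acting as the scalar `f (l, k)` on `F_{l,k}`. -/
def zeroModeOp {N : ℕ} (f : Sector N → ℂ) : Module.End ℂ (Fock N) := sectorOp id f 1

/-- The eigenvalue of `P_w` on `F_{l,k}`, where `ρ = √((r-1)/r)` and `ρ⁻¹ = √(r/(r-1))`. -/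
def momentum {N : ℕ} (ρ : ℂ) (w : weightLattice N) (v : Sector N) : ℂ :=
  ρ⁻¹ * (((w : Fin N → ℝ) ⬝ᵥ (v.1 : Fin N → ℝ) : ℝ) : ℂ)
    - ρ * (((w : Fin N → ℝ) ⬝ᵥ (v.2 : Fin N → ℝ) : ℝ) : ℂ)

/-- The scalar `c` in `[β_m^i, β_n^j] = c δ_{m+n,0}`. -/
def oscComm {N : ℕ} (x : ℝ) (r s : ℂ) (i j : Fin N) (m : ℤ) : ℂ :=
  if i = j then
    m * (bracket x ((r - 1) * m) / bracket x (r * m))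
      * (bracket x ((s - 1) * m) / bracket x (s * m))
  else
    -m * (bracket x ((r - 1) * m) / bracket x (r * m)) * (bracket x m / bracket x (s * m))
      * xpow x (s * m * (if j < i then 1 else -1))

/-- The oscillator `β_m^j`, `m ≠ 0`: for `m < 0` multiplication by the corresponding variable, for
`m > 0` the derivation that kills the vacuum and has the prescribed commutators with the
`β_{-m}^i`. -/
def beta {N : ℕ} (x : ℝ) (r s : ℂ) (j : Fin N) (m : ℤ) : Module.End ℂ (Osc N) :=
  if 0 < m then
    ∑ i : Fin N, oscComm x r s j i m •
      (MvPolynomial.pderiv ((i, m.natAbs.toPNat') : OscIndex N) :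
        Derivation ℂ (Osc N) (Osc N)).toLinearMap
  else if m < 0 then LinearMap.mulLeft ℂ (MvPolynomial.X ((j, m.natAbs.toPNat') : OscIndex N))
  else 0

/-! ### The Dynkin-diagram automorphism -/

/-- The scalar in `η(β_m^j) = etaCoef j m • β_m^{j+1}`. -/
def etaCoef {N : ℕ} (x : ℝ) (s : ℂ) (j : Fin N) (m : ℤ) : ℂ :=
  if (j : ℕ) + 1 < N then xpow x (-(2 * s / N) * m) else xpow x ((2 * s / N) * ((N : ℂ) - 1) * m)

theorem etaCoef_ne_zero {N : ℕ} (x : ℝ) (s : ℂ) (j : Fin N) (m : ℤ) : etaCoef x s j m ≠ 0 := by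
  unfold etaCoef xpow
  split_ifs <;> exact Complex.exp_ne_zero _

/-- `η` on polynomials in the creation operators. -/
def etaOsc (N : ℕ) (x : ℝ) (s : ℂ) : Osc N ≃ₐ[ℂ] Osc N :=
  AlgEquiv.ofAlgHom
    (MvPolynomial.aeval fun p : OscIndex N =>
      MvPolynomial.C (etaCoef x s p.1 (-(p.2 : ℤ))) * MvPolynomial.X (finRotate N p.1, p.2))
    (MvPolynomial.aeval fun p : OscIndex N =>
      MvPolynomial.C (etaCoef x s ((finRotate N).symm p.1) (-(p.2 : ℤ)))⁻¹ *
        MvPolynomial.X ((finRotate N).symm p.1, p.2))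
    (by
      refine MvPolynomial.algHom_ext fun p => ?_
      simp only [AlgHom.comp_apply, MvPolynomial.aeval_X, map_mul, MvPolynomial.algHom_C,
        MvPolynomial.algebraMap_eq, Equiv.apply_symm_apply, AlgHom.id_apply]
      rw [← mul_assoc, ← MvPolynomial.C_mul, inv_mul_cancel₀ (etaCoef_ne_zero _ _ _ _),
        MvPolynomial.C_1, one_mul])
    (by
      refine MvPolynomial.algHom_ext fun p => ?_
      simp only [AlgHom.comp_apply, MvPolynomial.aeval_X, map_mul, MvPolynomial.algHom_C,
        MvPolynomial.algebraMap_eq, Equiv.symm_apply_apply, AlgHom.id_apply]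
      rw [← mul_assoc, ← MvPolynomial.C_mul, mul_inv_cancel₀ (etaCoef_ne_zero _ _ _ _),
        MvPolynomial.C_1, one_mul])

def etaSector (N : ℕ) : Sector N ≃ Sector N :=
  (etaWeight N).toEquiv.prodCongr (etaWeight N).toEquiv

/-- The implementation of `η` on `⊕ F_{l,k}`:
`β_{-n_1}^{j_1} ⋯ |l, k⟩ ↦ η(β_{-n_1}^{j_1}) ⋯ |η l, η k⟩`. -/
def etaFock (N : ℕ) (x : ℝ) (s : ℂ) : Fock N ≃ₗ[ℂ] Fock N :=
  (Finsupp.domLCongr (etaSector N)).trans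
    (Finsupp.mapRange.linearEquiv (etaOsc N x s).toLinearEquiv)

/-- The induced permutation of exponents of monomials. -/
def etaExp (N : ℕ) : (OscIndex N →₀ ℕ) ≃+ (OscIndex N →₀ ℕ) :=
  Finsupp.domCongr ((finRotate N).prodCongr (Equiv.refl ℕ+))

/-- The extension of `etaFock` to the completed Fock space. -/
def etaHat (N : ℕ) (x : ℝ) (s : ℂ) : FockHat N →ₗ[ℂ] FockHat N where
  toFun f := fun v ν =>
    (((etaExp N).symm ν).prod fun p e => etaCoef x s p.1 (-(p.2 : ℤ)) ^ e)
      * f ((etaSector N).symm v) ((etaExp N).symm ν)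
  map_add' f g := by funext v ν; simp [mul_add]
  map_smul' c f := by funext v ν; simp [mul_left_comm]

/-- `η(A) = η A η⁻¹` for an operator `A`. -/
def etaOp {N : ℕ} (x : ℝ) (s : ℂ) (A : Op N) : Op N :=
  etaHat N x s ∘ₗ A ∘ₗ (etaFock N x s).symm.toLinearMap

theorem etaOsc_monomial (N : ℕ) (x : ℝ) (s : ℂ) (μ : OscIndex N →₀ ℕ) (c : ℂ) :
    etaOsc N x s (MvPolynomial.monomial μ c) = MvPolynomial.monomial (etaExp N μ)
      ((μ.prod fun p e => etaCoef x s p.1 (-(p.2 : ℤ)) ^ e) * c) := by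
  have h : etaOsc N x s (MvPolynomial.monomial μ c) = MvPolynomial.aeval (fun p : OscIndex N =>
      MvPolynomial.C (etaCoef x s p.1 (-(p.2 : ℤ))) *
        (MvPolynomial.X (finRotate N p.1, p.2) : Osc N)) (MvPolynomial.monomial μ c) := rfl
  rw [h, MvPolynomial.aeval_monomial, MvPolynomial.monomial_eq, mul_comm _ c, map_mul, mul_assoc]
  congr 1
  have h2 : (etaExp N μ).prod (fun n e => (MvPolynomial.X n : Osc N) ^ e)
      = μ.prod fun p e => (MvPolynomial.X (finRotate N p.1, p.2) : Osc N) ^ e := by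
    unfold etaExp
    rw [Finsupp.domCongr_apply, Finsupp.prod_equivMapDomain]
    rfl
  rw [h2]
  simp only [mul_pow, Finsupp.prod_mul]
  congr 1
  simp only [Finsupp.prod, map_prod, map_pow]

theorem etaHat_incl (N : ℕ) (x : ℝ) (s : ℂ) (ψ : Fock N) :
    etaHat N x s (incl N ψ) = incl N (etaFock N x s ψ) := by
  have key : etaHat N x s ∘ₗ incl N = incl N ∘ₗ (etaFock N x s).toLinearMap := by
    refine Finsupp.lhom_ext' fun v => ?_
    refine (MvPolynomial.basisMonomials (OscIndex N) ℂ).ext fun μ => ?_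
    funext v' ν
    have e : etaFock N x s (Finsupp.single v (MvPolynomial.monomial μ 1)) =
        Finsupp.single (etaSector N v) (etaOsc N x s (MvPolynomial.monomial μ 1)) := by
      simp [etaFock]
    simp only [LinearMap.comp_apply, MvPolynomial.coe_basisMonomials, Finsupp.lsingle_apply,
      LinearEquiv.coe_coe, e, etaOsc_monomial]
    simp only [etaHat, incl, LinearMap.coe_mk, AddHom.coe_mk, Finsupp.single_apply,
      Equiv.eq_symm_apply]
    by_cases hv : etaSector N v = v'
    · by_cases hν : etaExp N μ = ν
      · subst hν
        simp [hv, MvPolynomial.coeff_monomial]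
      · have hν' : ¬ μ = (etaExp N).symm ν := fun h => hν (by rw [h, AddEquiv.apply_symm_apply])
        simp [hv, MvPolynomial.coeff_monomial, hν, hν']
    · simp [hv]
  exact LinearMap.congr_fun key ψ

/-! ### Screening currents -/

/-- The two families of screening currents `F_j(z)` and `E_j(z)`. -/
inductive Screening
  | F
  | E

/-- The coefficient in the zero-mode exponents: `√((r-1)/r)` for `F`, `-√(r/(r-1))` for `E`. -/
def Screening.zeroCoef (κ : Screening) (ρ : ℂ) : ℂ :=
  match κ with
  | .F => ρ
  | .E => -ρ⁻¹

/-- `B_m^j`. -/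
def rootOsc {N : ℕ} (x : ℝ) (r s : ℂ) (j : Fin N) (m : ℤ) : Module.End ℂ (Osc N) :=
  if (j : ℕ) + 1 < N then
    xpow x (-(2 * s / N) * ((j : ℂ) + 1) * m) • (beta x r s j m - beta x r s (finRotate N j) m)
  else xpow x (-(2 * s * m)) • beta x r s j m - beta x r s (finRotate N j) m

/-- The oscillators in the exponents: `B_m^j` for `F`, `-([rm]/[(r-1)m]) B_m^j` for `E`. -/
def Screening.osc {N : ℕ} (κ : Screening) (x : ℝ) (r s : ℂ) (j : Fin N) (m : ℤ) :
    Module.End ℂ (Osc N) :=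
  match κ with
  | .F => rootOsc x r s j m
  | .E => (-(bracket x (r * m) / bracket x ((r - 1) * m))) • rootOsc x r s j m

/-- The coefficient of `t ^ n` in `exp (∑_{k ≥ 1} A_k t ^ k)`. -/
def expCoeff {V : Type*} [AddCommGroup V] [Module ℂ V] (A : ℕ → Module.End ℂ V) (n : ℕ) :
    Module.End ℂ V :=
  ∑ k ∈ Finset.range (n + 1), ((k.factorial : ℂ)⁻¹) •
    PowerSeries.coeff n ((PowerSeries.mk fun i => if i = 0 then 0 else A i) ^ k)

/-- The coefficient of `z ^ n` in the creation part `exp (∑_{m < 0} (1/m) B_m z ^ (-m))`. -/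
def Screening.creation {N : ℕ} (κ : Screening) (x : ℝ) (r s : ℂ) (j : Fin N) (n : ℕ) :
    Module.End ℂ (Osc N) :=
  expCoeff (fun i => (-(i : ℂ)⁻¹) • κ.osc x r s j (-(i : ℤ))) n

/-- The coefficient of `z ^ (-n)` in the annihilation part `exp (∑_{m > 0} (1/m) B_m z ^ (-m))`. -/
def Screening.annihilation {N : ℕ} (κ : Screening) (x : ℝ) (r s : ℂ) (j : Fin N) (n : ℕ) :
    Module.End ℂ (Osc N) :=
  expCoeff (fun i => ((i : ℂ)⁻¹) • κ.osc x r s j (i : ℤ)) n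

/-- The eigenvalue on `F_{l,k}`, `v = (l, k)`, of the factor of the current containing the `P`'s;
here `z = x ^ (2 u)`, `c = zeroCoef`, so that `c ^ 2` is `(r-1)/r` for `F` and `r/(r-1)` for `E`. -/
def Screening.zeroFactor {N : ℕ} (κ : Screening) (x : ℝ) (s ρ : ℂ) (j : Fin N) (u : ℂ)
    (v : Sector N) : ℂ :=
  let c := κ.zeroCoef ρ
  if (j : ℕ) + 1 < N then
    xpow x (((2 * s / N - 1) * ((j : ℂ) + 1) + 2 * u) * (c * momentum ρ (alpha j) v + c ^ 2))
  else
    xpow x ((2 * s - N + 2 * u) * (c * momentum ρ (ebar j) v + c ^ 2 / 2))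
      * xpow x (2 * u * (-c * momentum ρ (ebar (finRotate N j)) v + c ^ 2 / 2))

/-- The action of `exp (i c Q_{α_j})` on the labels, where
`|l, k⟩ = exp (i √(r/(r-1)) Q_l - i √((r-1)/r) Q_k) |0, 0⟩`. -/
def Screening.shift {N : ℕ} (κ : Screening) (j : Fin N) (v : Sector N) : Sector N :=
  match κ with
  | .F => (v.1, v.2 - alpha j)
  | .E => (v.1 - alpha j, v.2)

/-- The current at `z = x ^ (2 u)` is the sum over `a, b ∈ ℕ` of these operators: the term with
`z ^ a` from the creation part and `z ^ (-b)` from the annihilation part. -/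
def Screening.term {N : ℕ} (κ : Screening) (x : ℝ) (r s ρ : ℂ) (j : Fin N) (u : ℂ) (a b : ℕ) :
    Module.End ℂ (Fock N) :=
  sectorOp (κ.shift j)
    (fun v => κ.zeroFactor x s ρ j u v * xpow x (2 * u * ((a : ℂ) - (b : ℂ))))
    (κ.creation x r s j a * κ.annihilation x r s j b)

/-! ### The theta function in the integrand -/

/-- `r` for `F` and `-r* = 1 - r` for `E`; the sign of its real part distinguishes regimes. -/
def Screening.level (κ : Screening) (r : ℂ) : ℂ :=
  match κ with
  | .F => r
  | .E => 1 - r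

/-- The parameter `R` of the theta functions `[u]_R`: `r` or `-r` for `F`, `r*` or `-r*` for `E`,
whichever has positive real part. -/
def Screening.nome (κ : Screening) (r : ℂ) : ℂ :=
  if 0 < (κ.level r).re then κ.level r else -κ.level r

/-- `1` in the regimes `Re r > 0` (for `F`) and `Re r* < 0` (for `E`), and `0` otherwise. -/
def Screening.regime (κ : Screening) (r : ℂ) : ℂ := if 0 < (κ.level r).re then 1 else 0

/-- `τ` with `x = exp (-π i / (R τ))`. -/
def tau (x : ℝ) (R : ℂ) : ℂ := -(Real.pi * Complex.I) / (R * (Real.log x : ℂ))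

/-- The conditions on `ϑ(u^(1) | ⋯ | u^(N))`, a function of the zero modes; `ϑ u (l, k)` is its
value on `F_{l,k}`, `ω` is `√(r(r-1))`. -/
structure IsTheta {N : ℕ} (κ : Screening) (x : ℝ) (r ρ ω : ℂ)
    (ϑ : (Fin N → ℂ) → Sector N → ℂ) : Prop where
  holomorphic : ∀ v, Differentiable ℂ fun u => ϑ u v
  periodic : ∀ u v t, ϑ (u + Pi.single t (κ.nome r)) v = ϑ u v
  quasiperiodic : ∀ u v t, ϑ (u + Pi.single t (κ.nome r * tau x (κ.nome r))) v =
    Complex.exp (-2 * Real.pi * Complex.I * tau x (κ.nome r)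
      + 2 * Real.pi * Complex.I / κ.nome r *
        (u ((finRotate N).symm t) - 2 * u t + u (finRotate N t) + ω * momentum ρ (alpha t) v))
      * ϑ u v
  translation : ∀ u v (k : ℂ), ϑ (fun t => u t + k) v = ϑ u v
  /-- `η(ϑ(u^(1) | ⋯ | u^(N))) = ϑ(u^(N) | u^(1) | ⋯ | u^(N-1))`. -/
  eta : ∀ (s : ℂ) u, (etaFock N x s).conj (zeroModeOp (ϑ u)) =
    zeroModeOp (ϑ (u ∘ (finRotate N).symm))

/-! ### Nonlocal integrals of motion

The integration variables are `z_i^(t) = x ^ (2 u_i^(t))`, `u : Fin N → Fin m → ℂ`. In the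
definitions below `δ` is an auxiliary regularization parameter; `δ = 0` is the case of interest. -/

/-- `s/N` or `s/N - 1`: the poles of the integrand inside the contour of `z^(t)` are at
`z_i^(t) = x ^ (2 innerExp + 2 R n) z_j^(t+1)`, `n ≥ 0`. -/
def Screening.innerExp (κ : Screening) (N : ℕ) (r s : ℂ) : ℂ := s / N - (1 - κ.regime r)

/-- `s/N - 1` or `s/N`: the poles outside of the contour of `z^(t)` are at
`z_i^(t) = x ^ (2 outerExp - 2 R n) z_j^(t+1)`, `n ≥ 0`. -/
def Screening.outerExp (κ : Screening) (N : ℕ) (r s : ℂ) : ℂ := s / N - κ.regime r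

section

variable {N m : ℕ}

/-- The numerator of the theta-function factor. -/
def numerator (κ : Screening) (x : ℝ) (r : ℂ) (u : Fin N → Fin m → ℂ) : ℂ :=
  ∏ t, ∏ i, ∏ j ∈ Finset.Ioi i,
    theta x (κ.nome r) (u t i - u t j)
      * theta x (κ.nome r) (u t j - u t i + 1 - 2 * κ.regime r)

/-- The denominator of the theta-function factor, a product over the pairs of neighbouring colours
`t`, `t + 1` and the pair `1`, `N`. -/
def denominator (κ : Screening) (x : ℝ) (r s : ℂ) (u : Fin N → Fin m → ℂ) : ℂ :=
  ∏ t : Fin N, ∏ i, ∏ j,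
    if (t : ℕ) + 1 < N then
      theta x (κ.nome r) (u t i - u (finRotate N t) j - κ.outerExp N r s)
    else theta x (κ.nome r) (u (finRotate N t) i - u t j + κ.innerExp N r s)

/-- `∏ (x^{2A+2δ} z_j^(t+1)/z_i^(t); x^{2R})_∞ (x^{-2B+2δ} z_i^(t)/z_j^(t+1); x^{2R})_∞` over all
neighbouring colours (cyclically), with `A = innerExp`, `B = outerExp`. -/
def poleFactor (κ : Screening) (x : ℝ) (r s δ : ℂ) (u : Fin N → Fin m → ℂ) : ℂ :=
  ∏ t : Fin N, ∏ i, ∏ j,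
    qPoch (xpow x (2 * (κ.innerExp N r s + δ - u t i + u (finRotate N t) j)))
        (xpow x (2 * κ.nome r))
      * qPoch (xpow x (2 * (-κ.outerExp N r s + δ + u t i - u (finRotate N t) j)))
        (xpow x (2 * κ.nome r))

/-- The term of the ordered operator product
`V_1(z_1^(1)) ⋯ V_1(z_m^(1)) V_2(z_1^(2)) ⋯ V_N(z_m^(N)) ϑ(∑ u_j^(1) | ⋯ | ∑ u_j^(N))`, `V = F, E`,
with given modes in each of the currents. -/
def productTerm (κ : Screening) (x : ℝ) (r s ρ : ℂ) (ϑ : (Fin N → ℂ) → Sector N → ℂ)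
    (u : Fin N → Fin m → ℂ) (ab : (Fin N → Fin m → ℕ) × (Fin N → Fin m → ℕ)) :
    Module.End ℂ (Fock N) :=
  (List.ofFn fun t => (List.ofFn fun i =>
    κ.term x r s ρ t (u t i) (ab.1 t i) (ab.2 t i)).prod).prod
  * zeroModeOp (ϑ fun t => ∑ i, u t i)

/-- The matrix element between `ket v μ` and `ket v' ν` of the ordered operator product, as a sum
over intermediate states. It converges for `|z_1^(1)| ≫ ⋯ ≫ |z_m^(1)| ≫ |z_1^(2)| ≫ ⋯`. -/
def productElement (κ : Screening) (x : ℝ) (r s ρ : ℂ) (ϑ : (Fin N → ℂ) → Sector N → ℂ)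
    (v : Sector N) (μ : OscIndex N →₀ ℕ) (v' : Sector N) (ν : OscIndex N →₀ ℕ)
    (u : Fin N → Fin m → ℂ) : ℂ :=
  ∑' ab : (Fin N → Fin m → ℕ) × (Fin N → Fin m → ℕ),
    incl N (productTerm κ x r s ρ ϑ u ab (ket v μ)) v' ν

/-- The domain `|z_1^(1)| ≫ ⋯ ≫ |z_m^(1)| ≫ |z_1^(2)| ≫ ⋯ ≫ |z_m^(N)|` with all ratios of
moduli less than `ε`. -/
def orderedDomain (N m : ℕ) (x ε : ℝ) : Set (Fin N → Fin m → ℂ) :=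
  {u | ∀ t i t' i', (t < t' ∨ (t = t' ∧ i < i')) →
    ‖xpow x (2 * u t' i')‖ < ε * ‖xpow x (2 * u t i)‖}

/-- The integral over the torus `|z_i^(t)| = 1`, `z_i^(t) = x ^ (2 u_i^(t)) = exp (i θ_i^(t))`,
against `∏ dz / (2 π i z) = ∏ dθ / (2 π)`. -/
def torusMean (x : ℝ) (Φ : (Fin N → Fin m → ℂ) → ℂ) : ℂ :=
  (((2 * Real.pi) ^ (N * m) : ℝ) : ℂ)⁻¹ *
    ∫ θ in Set.Icc (0 : Fin N → Fin m → ℝ) (fun _ _ => 2 * Real.pi),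
      Φ fun t i => Complex.I * (θ t i : ℂ) / (2 * (Real.log x : ℂ))

/-- `c` is the matrix element of the (regularized) integral: there is an analytic function `Φ` on
a connected domain `W` containing the torus, which in the domain of convergence of the operator
product coincides with
`(operator product) * (numerator / denominator) * (poleFactor 0 / poleFactor δ)`,
and `c` is its integral over the torus. The last quotient moves the poles from
`z_i^(t) = x^{2A+2Rn} z_j^(t+1)` and `z_i^(t) = x^{2B-2Rn} z_j^(t+1)` to
`z_i^(t) = x^{2A+2δ+2Rn} z_j^(t+1)` and `z_i^(t) = x^{2B-2δ-2Rn} z_j^(t+1)`;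
for `δ = 0` it is `1`. -/
def IsMatrixElement (κ : Screening) (x : ℝ) (r ρ : ℂ) (ϑ : (Fin N → ℂ) → Sector N → ℂ) (m : ℕ)
    (s δ : ℂ) (v : Sector N) (μ : OscIndex N →₀ ℕ) (v' : Sector N) (ν : OscIndex N →₀ ℕ)
    (c : ℂ) : Prop :=
  ∃ (W : Set (Fin N → Fin m → ℂ)) (Φ : (Fin N → Fin m → ℂ) → ℂ),
    IsOpen W ∧ IsPreconnected W ∧ {u | ∀ t i, (u t i).re = 0} ⊆ W ∧ AnalyticOnNhd ℂ Φ W ∧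
    (∀ ε > 0, (W ∩ orderedDomain N m x ε).Nonempty) ∧
    (∀ᶠ ε in 𝓝[>] (0 : ℝ), ∀ u ∈ W ∩ orderedDomain N m x ε,
      denominator κ x r s u * poleFactor κ x r s δ u * Φ u =
        productElement κ x r s ρ ϑ v μ v' ν u * numerator κ x r u * poleFactor κ x r s 0 u) ∧
    c = torusMean x Φ

open Classical in
/-- The operator with the above matrix elements. For `δ = 0` this is the integral defining `G_m`
(for `κ = F`) or `G_m^*` (for `κ = E`), if the torus is an admissible contour. -/
def screeningIntegral (κ : Screening) (x : ℝ) (r ρ : ℂ) (ϑ : (Fin N → ℂ) → Sector N → ℂ) (m : ℕ)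
    (s δ : ℂ) : Op N :=
  Finsupp.lsum ℂ fun v => (MvPolynomial.basisMonomials (OscIndex N) ℂ).constr ℂ
    fun μ => fun v' ν =>
      if h : ∃ c, IsMatrixElement κ x r ρ ϑ m s δ v μ v' ν c then h.choose else 0

end

/-- The pairs `(s, δ)` with `0 < Re s < N` for which the torus `|z_i^(t)| = 1` satisfies the
contour condition
`|x^{2A+2δ} z_j^(t+1)| < |z_i^(t)| < |x^{2B-2δ} z_j^(t+1)|` for all `t` (cyclically). -/
def Screening.contourDomain (κ : Screening) (N : ℕ) (r : ℂ) : Set (ℂ × ℂ) :=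
  {p | 0 < p.1.re ∧ p.1.re < N ∧ 0 < (κ.innerExp N r p.1 + p.2).re ∧
    (κ.outerExp N r p.1 - p.2).re < 0}

/-- `A` is the value at `p₀` of an analytic continuation, matrix element by matrix element in the
basis of monomials in the `β_{-n}^j`, of the family of operators `Γ` defined on `S`. -/
def IsContinuation {X : Type*} [NormedAddCommGroup X] [NormedSpace ℂ X] {N : ℕ}
    (Γ : X → Op N) (S : Set X) (p₀ : X) (A : Op N) : Prop :=
  ∃ (D V : Set X) (g : X → Op N),
    IsOpen D ∧ IsPreconnected D ∧ p₀ ∈ D ∧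
    (∀ v μ v' ν, AnalyticOnNhd ℂ (fun p => g p (ket v μ) v' ν) D) ∧
    IsOpen V ∧ V.Nonempty ∧ V ⊆ D ∩ S ∧ (∀ p ∈ V, g p = Γ p) ∧ g p₀ = A

end NonlocalIM

end

open NonlocalIM

open scoped Topology BigOperators

noncomputable section

namespace NonlocalIM

/-! ### Several complex variables -/

/-! The ordered product of currents and the theta quotient each single out a place where the circle
of colours is cut open. Their product does not, and this becomes visible once the integrand is
written in closed form.

By Wick's theorem (`tsum_ordered_product`) a matrix element of the ordered product is `ϑ` times
powers of the variables, pairwise contractions, and the matrix element of a normally ordered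
product. The last one is a finite sum, because every mode shifts the energy by a fixed amount
(`finite_normalProduct`). The commutators of the root oscillators form a deformed affine Cartan
matrix, so the contractions are quotients of products `(z; q)_∞`, and they are trivial for colours
that are not neighbours on the circle.

For equal colours the numerator thetas cancel the poles of the contraction
(`Screening.contraction_self`). For neighbouring colours one half of the theta denominator cancels
the numerator of the contraction; what is left is the reciprocal of the matching factor of
`poleFactor` and an exponential (`Screening.contraction_adj`). At the seam between the last and the
first colour the currents stand in the opposite order and the theta function has a different
argument. The two halves of the theta function then exchange their roles, and since `c² = 1 - σ/R`
and `A - B = σ`, the exponential is the same up to a constant (`Screening.adjFactor_wrap`,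
`Screening.contraction_wrap`). Hence the continued integrand is `entireIntegrand / poleFactor δ`,
where both functions are built from one expression for each edge of the circle of colours.

The automorphism carries the root oscillators of one colour to those of the next
(`etaConj_rootOsc`), and inside a normally ordered product the order of the colours is irrelevant.
The constants left over from the zero modes do not depend on the Fock space, by a telescoping sum
(`Screening.prod_zeroConst`), and `ϑ` is covariant by assumption. So `η` rotates the variables of
the integrand (`entireIntegrand_rotate`), and the mean over the torus does not notice a permutation
of the variables.

Existence and uniqueness of the matrix elements (`isMatrixElement_iff`) follow from the identity
theorem in several variables: the nonvanishing set of an entire function is connected, dense and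
open. For continued operators, invariance is expressed by identities between matrix elements with
coefficients analytic in `s`; such identities persist on connected domains
(`IsContinuation.etaOp_eq`). -/

/-- The iterated Cauchy integral formula on a polydisc of radius one. -/
theorem torusIntegral_cauchy : ∀ {n : ℕ} (f : (Fin n → ℂ) → ℂ), Differentiable ℂ f →
    ∀ c z : Fin n → ℂ, (∀ i, z i ∈ Metric.ball (c i) 1) →
    ((2 * Real.pi * Complex.I : ℂ)⁻¹) ^ n *
      (∯ w in T(c, fun _ => 1), (∏ i, (w i - z i)⁻¹) * f w) = f z
  | 0, f, _, c, z, _ => by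
    rw [torusIntegral_dim0]
    simp only [pow_zero, Finset.univ_eq_empty, Finset.prod_empty, one_mul]
    congr 1
    exact Subsingleton.elim _ _
  | n + 1, f, hf, c, z, hz => by
    -- Points of the torus are at distance exactly one from the centre in each coordinate, while `z`
    -- lies in the open polydisc. So the kernel is continuous on the torus, hence integrable.
    have hne : ∀ θ : Fin (n + 1) → ℝ, ∀ i, torusMap c (fun _ => 1) θ i - z i ≠ 0 := by
      intro θ i h
      have h1 : ‖torusMap c (fun _ => 1) θ i - c i‖ = 1 := by
        simp [torusMap, Complex.norm_exp]
      have h2 := hz i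
      rw [← sub_eq_zero.mp h, Metric.mem_ball, dist_eq_norm, h1] at h2
      exact lt_irrefl _ h2
    have hcont : Continuous (torusMap c (fun _ => 1)) := by
      unfold torusMap; fun_prop
    have hint : TorusIntegrable (fun w => (∏ i, (w i - z i)⁻¹) * f w) c (fun _ => 1) := by
      refine Continuous.integrableOn_Icc ?_
      refine Continuous.mul (continuous_finsetProd _ fun i _ => ?_) (hf.continuous.comp hcont)
      exact Continuous.inv₀ (by fun_prop) fun θ => hne θ i
    rw [torusIntegral_succ hint]
    -- With the first coordinate frozen, the remaining integral is given by induction; a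
    -- one-variable Cauchy integral is left.
    have inner : ∀ x : ℂ, (∯ y in T(c ∘ Fin.succ, (fun _ => (1 : ℝ)) ∘ Fin.succ),
        (∏ i, ((Fin.cons x y : Fin (n + 1) → ℂ) i - z i)⁻¹) * f (Fin.cons x y))
        = (x - z 0)⁻¹ * ((2 * Real.pi * Complex.I : ℂ) ^ n * f (Fin.cons x (z ∘ Fin.succ))) := by
      intro x
      have hd : Differentiable ℂ fun y : Fin n → ℂ => f (Fin.cons x y) := by
        refine hf.comp ?_
        rw [differentiable_pi]
        intro i
        refine Fin.cases ?_ (fun j => ?_) i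
        · simp
        · simp only [Fin.cons_succ]; fun_prop
      have ih := torusIntegral_cauchy (fun y : Fin n → ℂ => f (Fin.cons x y)) hd
        (c ∘ Fin.succ) (z ∘ Fin.succ) (fun i => hz i.succ)
      rw [← ih, ← mul_assoc ((2 * Real.pi * Complex.I : ℂ) ^ n), ← mul_pow,
        mul_inv_cancel₀ Complex.two_pi_I_ne_zero, one_pow, one_mul, ← torusIntegral_const_mul]
      congr 1
      funext y
      rw [Fin.prod_univ_succ]
      simp [mul_assoc]
    simp_rw [inner]
    have h1 := Complex.two_pi_I_inv_smul_circleIntegral_sub_inv_smul_of_differentiable_on_off_countable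
      (R := 1) (c := c 0) (w := z 0) (f := fun x => f (Fin.cons x (z ∘ Fin.succ)))
      Set.countable_empty (hz 0) ?_ ?_
    · have h2 : f z = f (Fin.cons (z 0) (z ∘ Fin.succ)) := by
        congr 1; exact (Fin.cons_self_tail z).symm
      rw [h2, ← h1]
      have h3 : ∀ x : ℂ, (x - z 0)⁻¹ * ((2 * Real.pi * Complex.I : ℂ) ^ n *
          f (Fin.cons x (z ∘ Fin.succ))) = (2 * Real.pi * Complex.I : ℂ) ^ n •
          ((x - z 0)⁻¹ • f (Fin.cons x (z ∘ Fin.succ))) := by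
        intro x; simp only [smul_eq_mul]; ring
      simp_rw [h3]
      rw [circleIntegral.integral_smul, smul_eq_mul, smul_eq_mul, ← mul_assoc, pow_succ]
      congr 1
      rw [mul_right_comm, ← mul_pow, inv_mul_cancel₀ Complex.two_pi_I_ne_zero, one_pow, one_mul]
    · refine Continuous.continuousOn (hf.continuous.comp (continuous_pi fun i => ?_))
      refine Fin.cases ?_ (fun j => ?_) i
      · simp only [Fin.cons_zero]; fun_prop
      · simp only [Fin.cons_succ]; fun_prop
    · intro x _
      refine (hf.comp ?_).differentiableAt
      rw [differentiable_pi]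
      intro i
      refine Fin.cases ?_ (fun j => ?_) i
      · simp only [Fin.cons_zero]; fun_prop
      · simp only [Fin.cons_succ]; fun_prop

/-- A complex differentiable function on `ℂ^n` is analytic. -/
theorem analyticAt_of_differentiable {n : ℕ} {f : (Fin n → ℂ) → ℂ} (hf : Differentiable ℂ f)
    (c : Fin n → ℂ) : AnalyticAt ℂ f c := by
  -- The Cauchy kernel is viewed as a function `k` of `z` with values in the Banach algebra `C(K,
  -- ℂ)`. It is analytic because inversion is analytic at units, and integration against `f` is a
  -- continuous linear functional `Λ`. The Cauchy formula then exhibits `f` near `c` as a multiple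
  -- of `Λ ∘ k`.
  let K : Set (Fin n → ℝ) := Set.Icc 0 fun _ => 2 * Real.pi
  have : CompactSpace K := isCompact_iff_compactSpace.mp isCompact_Icc
  have hcoe : ∀ i, Continuous fun θ : K => (θ : Fin n → ℝ) i := fun i =>
    (continuous_apply i).comp continuous_subtype_val
  have htorus : Continuous fun θ : K => torusMap c (fun _ => 1) θ := by
    refine continuous_pi fun i => continuous_const.add (continuous_const.mul ?_)
    exact Complex.continuous_exp.comp
      ((Complex.continuous_ofReal.comp (hcoe i)).mul continuous_const)
  let W : Fin n → C(K, ℂ) := fun i =>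
    ⟨fun θ => torusMap c (fun _ => 1) θ i, (continuous_apply i).comp htorus⟩
  let G : C(K, ℂ) := ⟨fun θ => (∏ i, ((1 : ℝ) : ℂ) * Complex.exp ((θ : Fin n → ℝ) i * Complex.I) * Complex.I)
      * f (torusMap c (fun _ => 1) θ), by
    refine Continuous.mul (continuous_finsetProd _ fun i _ => ?_) (hf.continuous.comp htorus)
    exact (continuous_const.mul (Complex.continuous_exp.comp
      ((Complex.continuous_ofReal.comp (hcoe i)).mul continuous_const))).mul continuous_const⟩
  let μ : MeasureTheory.Measure K := MeasureTheory.Measure.comap Subtype.val MeasureTheory.volume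
  have : MeasureTheory.IsFiniteMeasure μ := by
    constructor
    have hK : MeasurableSet K := measurableSet_Icc
    rw [MeasureTheory.Measure.comap_apply _ Subtype.val_injective
      (fun s hs => (MeasurableEmbedding.subtype_coe hK).measurableSet_image.mpr hs) _
      MeasurableSet.univ]
    simpa using (isCompact_Icc (a := (0 : Fin n → ℝ)) (b := fun _ => 2 * Real.pi)).measure_lt_top
  have hintg : ∀ g : C(K, ℂ), MeasureTheory.Integrable (fun θ => g θ) μ := fun g =>
    MeasureTheory.Integrable.of_bound g.continuous.aestronglyMeasurable ‖g‖
      (Filter.Eventually.of_forall fun θ => g.norm_coe_le_norm θ)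
  let Λ₀ : C(K, ℂ) →ₗ[ℂ] ℂ :=
    { toFun := fun g => ∫ θ, (g * G) θ ∂μ
      map_add' := fun g h => by
        rw [← MeasureTheory.integral_add (hintg _) (hintg _)]
        congr 1; funext θ; simp [add_mul]
      map_smul' := fun a g => by
        rw [RingHom.id_apply, ← MeasureTheory.integral_smul]
        congr 1; funext θ; simp }
  let Λ : C(K, ℂ) →L[ℂ] ℂ := Λ₀.mkContinuous (‖G‖ * μ.real Set.univ) fun g => by
    refine (MeasureTheory.norm_integral_le_of_norm_le_const (C := ‖g‖ * ‖G‖)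
      (Filter.Eventually.of_forall fun θ => ?_)).trans (le_of_eq (by ring))
    rw [ContinuousMap.mul_apply, norm_mul]
    exact mul_le_mul (g.norm_coe_le_norm θ) (G.norm_coe_le_norm θ) (norm_nonneg _) (norm_nonneg _)
  let k : (Fin n → ℂ) → C(K, ℂ) := fun z => ∏ i, Ring.inverse (W i - algebraMap ℂ C(K, ℂ) (z i))
  have hunit : ∀ z : Fin n → ℂ, (∀ i, z i ∈ Metric.ball (c i) 1) → ∀ i θ,
      W i θ - z i ≠ 0 := by
    intro z hz i θ h
    have h1 : ‖torusMap c (fun _ => 1) θ i - c i‖ = 1 := by simp [torusMap, Complex.norm_exp]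
    have h2 := hz i
    have h3 : torusMap c (fun _ => 1) θ i = z i := sub_eq_zero.mp h
    rw [← h3, Metric.mem_ball, dist_eq_norm, h1] at h2
    exact lt_irrefl _ h2
  have hU : ∀ z : Fin n → ℂ, (∀ i, z i ∈ Metric.ball (c i) 1) → ∀ i,
      IsUnit (W i - algebraMap ℂ C(K, ℂ) (z i)) := by
    intro z hz i
    rw [ContinuousMap.isUnit_iff_forall_ne_zero]
    exact fun θ => hunit z hz i θ
  have hk : AnalyticAt ℂ k c := by
    refine Finset.analyticAt_fun_prod _ fun i _ => ?_
    have h1 : AnalyticAt ℂ (fun z : Fin n → ℂ => W i - algebraMap ℂ C(K, ℂ) (z i)) c := by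
      refine analyticAt_const.sub ?_
      exact ((Algebra.linearMap ℂ C(K, ℂ)).toContinuousLinearMap.comp
        (ContinuousLinearMap.proj (R := ℂ) (φ := fun _ : Fin n => ℂ) i)).analyticAt c
    obtain ⟨U, hUe⟩ := hU c (fun i => Metric.mem_ball_self one_pos) i
    refine AnalyticAt.fun_comp ?_ h1
    rw [← hUe]
    exact analyticAt_inverse U
  have hmain : ∀ᶠ z in 𝓝 c, ((2 * Real.pi * Complex.I : ℂ)⁻¹) ^ n * Λ (k z) = f z := by
    have hopen : IsOpen {z : Fin n → ℂ | ∀ i, z i ∈ Metric.ball (c i) 1} := by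
      simp only [Set.ofPred_forall]
      exact isOpen_iInter_of_finite fun i => Metric.isOpen_ball.preimage (continuous_apply i)
    filter_upwards [hopen.mem_nhds (fun i => Metric.mem_ball_self one_pos)] with z hz
    rw [← torusIntegral_cauchy f hf c z hz]
    congr 1
    have hkz : ∀ θ : K, k z θ = ∏ i, (torusMap c (fun _ => 1) θ i - z i)⁻¹ := by
      intro θ
      change (∏ i, Ring.inverse (W i - algebraMap ℂ C(K, ℂ) (z i))) θ = _
      rw [ContinuousMap.prod_apply]
      refine Finset.prod_congr rfl fun i _ => ?_
      refine eq_inv_of_mul_eq_one_left ?_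
      have h1 := Ring.inverse_mul_cancel _ (hU z hz i)
      exact congrArg (fun g : C(K, ℂ) => g θ) h1
    change ∫ θ : K, (k z * G) θ ∂μ = _
    unfold torusIntegral
    rw [← MeasureTheory.integral_subtype_comap measurableSet_Icc]
    refine MeasureTheory.integral_congr_ae (Filter.Eventually.of_forall fun θ => ?_)
    simp only [ContinuousMap.mul_apply, hkz, smul_eq_mul]
    simp only [G, ContinuousMap.coe_mk]
    ring
  refine AnalyticAt.congr ?_ hmain
  exact analyticAt_const.mul (AnalyticAt.fun_comp (Λ.analyticAt _) hk)

section

variable {E : Type*} [NormedAddCommGroup E] [NormedSpace ℂ E]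

/-- The set where an entire function, not identically zero, does not vanish is dense. -/
theorem dense_setOf_ne_zero {f : E → ℂ} (hf : AnalyticOnNhd ℂ f Set.univ) (h : ∃ z, f z ≠ 0) :
    Dense {z | f z ≠ 0} := by
  intro z
  rw [mem_closure_iff_frequently]
  by_contra hcon
  rw [Filter.not_frequently] at hcon
  obtain ⟨w, hw⟩ := h
  refine hw ?_
  have := hf.eqOn_of_preconnected_of_eventuallyEq (g := fun _ => 0) analyticOnNhd_const
    isPreconnected_univ (Set.mem_univ z) (hcon.mono fun y hy => by simpa using hy)
  exact this (Set.mem_univ w)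

/-- A finite product of entire functions that do not vanish identically does not vanish
identically. -/
theorem exists_prod_ne_zero {ι : Type*} (s : Finset ι) {f : ι → E → ℂ}
    (hf : ∀ i ∈ s, AnalyticOnNhd ℂ (f i) Set.univ) (h : ∀ i ∈ s, ∃ z, f i z ≠ 0) :
    ∃ z, ∏ i ∈ s, f i z ≠ 0 := by
  classical
  -- Density is the statement that survives the induction: a dense open set meets a dense set in a
  -- dense set, whereas mere existence of a nonzero value does not pass to products.
  have key : Dense {z | ∏ i ∈ s, f i z ≠ 0} := by
    induction s using Finset.induction_on with
    | empty => simp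
    | insert a s ha ih =>
      have h1 := dense_setOf_ne_zero (hf a (Finset.mem_insert_self _ _))
        (h a (Finset.mem_insert_self _ _))
      have h2 := ih (fun i hi => hf i (Finset.mem_insert_of_mem hi))
        (fun i hi => h i (Finset.mem_insert_of_mem hi))
      have hc : Continuous (f a) := continuous_iff_continuousAt.mpr fun z =>
        (hf a (Finset.mem_insert_self _ _) z (Set.mem_univ z)).continuousAt
      refine (h1.inter_of_isOpen_left h2 (isOpen_ne.preimage hc)).mono ?_
      rintro z ⟨h3, h4⟩
      simp only [Set.mem_ofPred_eq, Finset.prod_insert ha]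
      exact mul_ne_zero h3 h4
  exact (key.nonempty)

/-- The complement of the zero set of an entire function is connected. -/
theorem isPreconnected_setOf_ne_zero {f : E → ℂ} (hf : AnalyticOnNhd ℂ f Set.univ) :
    IsPreconnected {z | f z ≠ 0} := by
  refine isPreconnected_of_forall_pair fun a ha b hb => ?_
  -- On the complex line through `a` and `b` the zeros are discrete, hence countable, and the
  -- complement of a countable set in the plane is connected. Its image under `L` joins `a` to `b`
  -- without meeting a zero.
  let L : ℂ → E := fun t => a + t • (b - a)
  have hL : AnalyticOnNhd ℂ L Set.univ := fun t _ =>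
    analyticAt_const.add (analyticAt_id.smul analyticAt_const)
  have hg : AnalyticOnNhd ℂ (f ∘ L) Set.univ := fun t _ =>
    AnalyticAt.comp (hf _ (Set.mem_univ (L t))) (hL t (Set.mem_univ t))
  have hcount : {t | (f ∘ L) t = 0}.Countable := by
    have h0 : (f ∘ L) 0 ≠ 0 := by simpa [L] using ha
    have hc : Continuous (f ∘ L) := continuous_iff_continuousAt.mpr fun z =>
        (hg z (Set.mem_univ z)).continuousAt
    have hcd : (f ∘ L) ⁻¹' {0}ᶜ ∈ Filter.codiscrete ℂ :=
      hg.preimage_zero_mem_codiscrete h0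
    have h2 := hcd
    rw [mem_codiscrete'] at h2
    have h3 : {t | (f ∘ L) t = 0} = ((f ∘ L) ⁻¹' {0}ᶜ)ᶜ := by ext; simp
    rw [h3]
    exact (HereditarilyLindelofSpace.isLindelof _).countable_of_isDiscrete h2.2
  have hconn := hcount.isConnected_compl_of_one_lt_rank
    (by rw [Complex.rank_real_complex]; norm_num)
  refine ⟨L '' {t | (f ∘ L) t = 0}ᶜ, ?_, ⟨0, ?_, by simp [L]⟩, ⟨1, ?_, by simp [L]⟩, ?_⟩
  · rintro _ ⟨t, ht, rfl⟩; exact ht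
  · simpa [L] using ha
  · simpa [L] using hb
  · exact hconn.isPreconnected.image _ (by fun_prop)

end

/-! ### Powers of `x` -/

theorem xpow_add (x : ℝ) (a b : ℂ) : xpow x (a + b) = xpow x a * xpow x b := by
  simp only [xpow, add_mul, Complex.exp_add]

@[simp] theorem xpow_zero (x : ℝ) : xpow x 0 = 1 := by simp [xpow]

theorem xpow_ne_zero (x : ℝ) (a : ℂ) : xpow x a ≠ 0 := Complex.exp_ne_zero _

theorem xpow_neg (x : ℝ) (a : ℂ) : xpow x (-a) = (xpow x a)⁻¹ := by
  simp only [xpow, neg_mul, Complex.exp_neg]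

theorem xpow_sub (x : ℝ) (a b : ℂ) : xpow x (a - b) = xpow x a * (xpow x b)⁻¹ := by
  rw [sub_eq_add_neg, xpow_add, xpow_neg]

theorem xpow_mul_nat (x : ℝ) (a : ℂ) (n : ℕ) : xpow x (a * n) = xpow x a ^ n := by
  simp only [xpow, ← Complex.exp_nat_mul]
  congr 1; ring

theorem xpow_sum {ι : Type*} (x : ℝ) (s : Finset ι) (f : ι → ℂ) :
    xpow x (∑ i ∈ s, f i) = ∏ i ∈ s, xpow x (f i) := by
  simp only [xpow, Finset.sum_mul, Complex.exp_sum]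

theorem norm_xpow (x : ℝ) (a : ℂ) : ‖xpow x a‖ = Real.exp (a.re * Real.log x) := by
  simp [xpow, Complex.norm_exp]

theorem norm_xpow_lt_one {x : ℝ} (hx0 : 0 < x) (hx1 : x < 1) {a : ℂ} :
    ‖xpow x a‖ < 1 ↔ 0 < a.re := by
  rw [norm_xpow, Real.exp_lt_one_iff]
  have := Real.log_neg hx0 hx1
  constructor
  · intro h; nlinarith
  · intro h; nlinarith

theorem differentiable_xpow (x : ℝ) : Differentiable ℂ (xpow x) := by
  unfold xpow; fun_prop

theorem bracket_eq (x : ℝ) (a : ℂ) :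
    bracket x a = (xpow x a - (xpow x a)⁻¹) / ((x : ℂ) - (x : ℂ)⁻¹) := by
  rw [bracket, xpow_neg]

/-! ### The infinite product `(z; q)_∞` -/

section

variable {q : ℂ}

theorem summable_pow_mul (hq : ‖q‖ < 1) (z : ℂ) : Summable fun j : ℕ => ‖-(q ^ j * z)‖ := by
  simp only [norm_neg, norm_mul, norm_pow]
  exact (summable_geometric_of_lt_one (norm_nonneg _) hq).mul_right _

theorem multipliable_qPoch (hq : ‖q‖ < 1) (z : ℂ) : Multipliable fun j : ℕ => 1 - q ^ j * z := by
  simp_rw [sub_eq_add_neg]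
  exact multipliable_one_add_of_summable (summable_pow_mul hq z)

theorem qPoch_eq_mul (hq : ‖q‖ < 1) (z : ℂ) : qPoch z q = (1 - z) * qPoch (q * z) q := by
  have h : ∀ j : ℕ, 1 - q ^ (j + 1) * z = 1 - q ^ j * (q * z) := fun j => by
    rw [pow_succ, mul_assoc]
  have h2 : Multipliable fun j : ℕ => 1 - q ^ (j + 1) * z := by
    simp_rw [h]; exact multipliable_qPoch hq (q * z)
  have h3 := tprod_eq_zero_mul' (f := fun j : ℕ => 1 - q ^ j * z) h2
  have h4 : ∏' j : ℕ, (1 - q ^ (j + 1) * z) = qPoch (q * z) q := tprod_congr h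
  rw [h4, pow_zero, one_mul] at h3
  exact h3

theorem differentiable_qPoch (hq : ‖q‖ < 1) : Differentiable ℂ fun z => qPoch z q := by
  have h : HasProdLocallyUniformlyOn (fun (j : ℕ) (z : ℂ) => 1 - q ^ j * z)
      (fun z => ∏' j : ℕ, (1 - q ^ j * z)) Set.univ := by
    simp_rw [sub_eq_add_neg]
    refine hasProdLocallyUniformlyOn_of_forall_compact isOpen_univ fun K _ hK => ?_
    obtain ⟨M, hM⟩ := hK.isBounded.exists_norm_le
    refine Summable.hasProdUniformlyOn_nat_one_add (u := fun j => ‖q‖ ^ j * M) hK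
      ((summable_geometric_of_lt_one (norm_nonneg _) hq).mul_right _)
      (Filter.Eventually.of_forall fun j z hz => ?_) (fun j => by fun_prop)
    rw [norm_neg, norm_mul, norm_pow]
    exact mul_le_mul_of_nonneg_left (hM z hz) (by positivity)
  have h2 := h.differentiableOn (Filter.Eventually.of_forall fun s => by
    simpa [Finset.prod_fn] using DifferentiableOn.finsetProd (fun _ _ => by fun_prop)) isOpen_univ
  exact differentiableOn_univ.mp h2

/-- The coefficients of `-log (z; q)_∞`. -/
def logCoeff (q z : ℂ) (n : ℕ) : ℂ := z ^ n / (n * (1 - q ^ n))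

theorem one_sub_pow_ne_zero (hq : ‖q‖ < 1) {n : ℕ} (hn : n ≠ 0) : 1 - q ^ n ≠ 0 := by
  intro h
  have h1 : ‖q ^ n‖ = 1 := by rw [← sub_eq_zero.mp h, norm_one]
  rw [norm_pow] at h1
  exact absurd h1 (pow_lt_one₀ (norm_nonneg _) hq hn).ne

theorem summable_norm_logCoeff (hq : ‖q‖ < 1) {z : ℂ} (hz : ‖z‖ < 1) :
    Summable fun n => ‖logCoeff q z n‖ := by
  refine Summable.of_nonneg_of_le (fun _ => norm_nonneg _) (fun n => ?_)
    ((summable_geometric_of_lt_one (norm_nonneg z) hz).mul_right (1 - ‖q‖)⁻¹)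
  have hq' : 0 < 1 - ‖q‖ := by linarith
  rcases Nat.eq_zero_or_pos n with rfl | hn
  -- The coefficient at `n = 0` has denominator zero and therefore equals zero, as the logarithm
  -- requires.
  · simp [logCoeff]; exact hq.le
  · rw [logCoeff, norm_div, norm_pow, div_eq_mul_inv]
    refine mul_le_mul_of_nonneg_left (inv_anti₀ hq' ?_) (by positivity)
    rw [norm_mul, Complex.norm_natCast]
    have h1 : 1 - ‖q‖ ≤ ‖1 - q ^ n‖ := by
      have h2 := norm_sub_norm_le (1 : ℂ) (q ^ n)
      have h3 : ‖q ^ n‖ ≤ ‖q‖ := by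
        rw [norm_pow]; exact pow_le_of_le_one (norm_nonneg _) hq.le hn.ne'
      rw [norm_one] at h2; linarith
    have h4 : (1 : ℝ) ≤ n := by exact_mod_cast hn
    nlinarith [norm_nonneg (1 - q ^ n)]

/-- Expand every `log (1 - q ^ j z)` in powers of `z` and sum the geometric series over `j` first.
This turns exponentials of commutator series into infinite products. -/
theorem qPoch_eq_exp (hq : ‖q‖ < 1) {z : ℂ} (hz : ‖z‖ < 1) :
    qPoch z q = Complex.exp (-∑' n, logCoeff q z n) := by
  have hlt : ∀ j : ℕ, ‖q ^ j * z‖ < 1 := fun j => by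
    rw [norm_mul, norm_pow]
    exact lt_of_le_of_lt (mul_le_of_le_one_left (norm_nonneg _)
      (pow_le_one₀ (norm_nonneg _) hq.le)) hz
  have hsum : Summable fun p : ℕ × ℕ => (q ^ p.1 * z) ^ p.2 / (p.2 : ℂ) := by
    refine Summable.of_norm_bounded (g := fun p : ℕ × ℕ => ‖q‖ ^ p.1 * ‖z‖ ^ p.2)
      ((summable_geometric_of_lt_one (norm_nonneg q) hq).mul_of_nonneg
        (summable_geometric_of_lt_one (norm_nonneg z) hz) (fun _ => by positivity)
        (fun _ => by positivity)) ?_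
    rintro ⟨j, n⟩
    rcases Nat.eq_zero_or_pos n with rfl | hn
    · simp
    · simp only [norm_div, norm_pow, norm_mul, Complex.norm_natCast, mul_pow]
      have h4 : (1 : ℝ) ≤ n := by exact_mod_cast hn
      refine (div_le_self (by positivity) h4).trans ?_
      refine mul_le_mul_of_nonneg_right ?_ (by positivity)
      exact pow_le_of_le_one (by positivity) (pow_le_one₀ (norm_nonneg _) hq.le) hn.ne'
  have hlog : ∀ j : ℕ, ∑' n : ℕ, (q ^ j * z) ^ n / (n : ℂ) = -Complex.log (1 - q ^ j * z) :=
    fun j => (Complex.hasSum_taylorSeries_neg_log (hlt j)).tsum_eq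
  have hgeom : ∀ n : ℕ, ∑' j : ℕ, (q ^ j * z) ^ n / (n : ℂ) = logCoeff q z n := by
    intro n
    rcases Nat.eq_zero_or_pos n with rfl | hn
    · simp [logCoeff]
    · have h1 : ∀ j : ℕ, (q ^ j * z) ^ n / (n : ℂ) = (q ^ n) ^ j * (z ^ n / n) := by
        intro j; rw [mul_pow, ← pow_mul, ← pow_mul, mul_comm j n]; ring
      simp_rw [h1]
      rw [tsum_mul_right, tsum_geometric_of_norm_lt_one
        (by rw [norm_pow]; exact pow_lt_one₀ (norm_nonneg _) hq hn.ne'), logCoeff]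
      have h2 := one_sub_pow_ne_zero hq hn.ne'
      have h3 : (n : ℂ) ≠ 0 := by exact_mod_cast hn.ne'
      field_simp
  have hswap : ∑' n, logCoeff q z n = ∑' j : ℕ, -Complex.log (1 - q ^ j * z) := by
    simp_rw [← hlog, ← hgeom]
    exact (Summable.tsum_comm (f := fun (j n : ℕ) => (q ^ j * z) ^ n / (n : ℂ)) hsum)
  have hs : Summable fun j : ℕ => Complex.log (1 - q ^ j * z) := by
    have := hsum.prod
    simp_rw [hlog] at this
    simpa using this.neg
  rw [hswap, tsum_neg, neg_neg, Complex.cexp_tsum_eq_tprod _ hs]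
  · rfl
  · intro j h
    have := hlt j
    rw [← sub_eq_zero.mp h, norm_one] at this
    exact lt_irrefl _ this

theorem qPoch_ne_zero (hq : ‖q‖ < 1) {z : ℂ} (hz : ‖z‖ < 1) : qPoch z q ≠ 0 := by
  rw [qPoch_eq_exp hq hz]; exact Complex.exp_ne_zero _

end

/-! ### The theta function -/

section

variable {x : ℝ} {R : ℂ}

theorem norm_nome_lt_one (hx0 : 0 < x) (hx1 : x < 1) (hR : 0 < R.re) : ‖xpow x (2 * R)‖ < 1 := by
  rw [norm_xpow_lt_one hx0 hx1]; simpa using hR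

theorem differentiable_theta (hx0 : 0 < x) (hx1 : x < 1) (hR : 0 < R.re) :
    Differentiable ℂ (theta x R) := by
  have hq := norm_nome_lt_one hx0 hx1 hR
  have hX := differentiable_xpow x
  have hP := differentiable_qPoch hq
  unfold theta bigTheta
  have h1 : Differentiable ℂ fun u : ℂ => xpow x (u ^ 2 / R - u) := hX.comp (by fun_prop)
  have h2 : Differentiable ℂ fun u : ℂ => qPoch (xpow x (2 * u)) (xpow x (2 * R)) :=
    hP.comp (hX.comp (by fun_prop))
  have h3 : Differentiable ℂ fun u : ℂ =>
      qPoch (xpow x (2 * R) * (xpow x (2 * u))⁻¹) (xpow x (2 * R)) := by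
    simp_rw [← xpow_neg, ← xpow_add]
    exact hP.comp (hX.comp (by fun_prop))
  fun_prop

/-- At `u = R / 2` both infinite products have an argument of modulus `|x ^ R| < 1`. One point of
nonvanishing is enough to make the zeros of the denominator negligible. -/
theorem theta_half_ne_zero (hx0 : 0 < x) (hx1 : x < 1) (hR : 0 < R.re) :
    theta x R (R / 2) ≠ 0 := by
  have hq := norm_nome_lt_one hx0 hx1 hR
  have hq2 : ‖xpow x (2 * (R / 2))‖ < 1 := by
    rw [norm_xpow_lt_one hx0 hx1]; simpa using hR
  have hq3 : ‖xpow x (2 * R) * (xpow x (2 * (R / 2)))⁻¹‖ < 1 := by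
    rw [← xpow_sub, norm_xpow_lt_one hx0 hx1]
    have : 2 * R - 2 * (R / 2) = R := by ring
    rw [this]; exact hR
  unfold theta bigTheta
  exact div_ne_zero (mul_ne_zero (xpow_ne_zero _ _) (mul_ne_zero (mul_ne_zero
    (qPoch_ne_zero hq hq2) (qPoch_ne_zero hq hq3)) (qPoch_ne_zero hq hq)))
    (pow_ne_zero _ (qPoch_ne_zero hq hq))

end

section

open Finset.HasAntidiagonal (antidiagonal mem_antidiagonal)

/-! ### Exponential sequences -/

section

variable {𝓔 : Type*} [Ring 𝓔] [Algebra ℂ 𝓔]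

/-- `E n` is the coefficient of `t ^ n` in `exp (∑_{k ≥ 1} A_k t ^ k)`, as a recursion. -/
def IsExpSeq (A E : ℕ → 𝓔) : Prop :=
  E 0 = 1 ∧ ∀ n : ℕ, (n : ℂ) • E n =
    ∑ p ∈ antidiagonal n, (p.1 : ℂ) • (A p.1 * E p.2)

/-- The coefficient of `t ^ n` in `exp (∑_{k ≥ 1} A_k t ^ k)`. -/
def expSeq (A : ℕ → 𝓔) (n : ℕ) : 𝓔 :=
  ∑ k ∈ Finset.range (n + 1), ((k.factorial : ℂ)⁻¹) •
    PowerSeries.coeff n ((PowerSeries.mk fun i => if i = 0 then 0 else A i) ^ k)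

/-- The summand with `p.1 = 0` has weight zero, so the recursion involves only earlier terms.
Uniqueness is what transports `η` from the exponents to the exponentials. -/
theorem IsExpSeq.unique {A E E' : ℕ → 𝓔} (h : IsExpSeq A E) (h' : IsExpSeq A E') : E = E' := by
  funext n
  induction n using Nat.strong_induction_on with
  | _ n ih =>
    rcases Nat.eq_zero_or_pos n with rfl | hn
    · rw [h.1, h'.1]
    · have hn' : (n : ℂ) ≠ 0 := by exact_mod_cast hn.ne'
      have key : (n : ℂ) • E n = (n : ℂ) • E' n := by
        rw [h.2, h'.2]
        refine Finset.sum_congr rfl fun p hp => ?_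
        rw [mem_antidiagonal] at hp
        rcases Nat.eq_zero_or_pos p.1 with h0 | h0
        · simp [h0]
        · rw [ih p.2 (by omega)]
      exact (smul_right_injective _ hn') key

theorem IsExpSeq.map {𝓔' : Type*} [Ring 𝓔'] [Algebra ℂ 𝓔'] (φ : 𝓔 →ₐ[ℂ] 𝓔') {A E : ℕ → 𝓔}
    (h : IsExpSeq A E) : IsExpSeq (fun n => φ (A n)) (fun n => φ (E n)) := by
  refine ⟨by simp only [h.1, map_one], fun n => ?_⟩
  rw [← map_smul, h.2, map_sum]
  simp

theorem coeff_pow_eq_zero {Λ : PowerSeries 𝓔} (h0 : PowerSeries.coeff 0 Λ = 0) (k : ℕ) :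
    ∀ n < k, PowerSeries.coeff n (Λ ^ k) = 0 := by
  induction k with
  | zero => intro n hn; omega
  | succ k ih =>
    intro n hn
    rw [pow_succ, PowerSeries.coeff_mul]
    refine Finset.sum_eq_zero fun p hp => ?_
    rw [mem_antidiagonal] at hp
    rcases Nat.eq_zero_or_pos p.2 with h2 | h2
    · rw [h2, h0, mul_zero]
    · rw [ih p.1 (by omega), zero_mul]

/-- The Euler operator `t d/dt`. -/
def euler (f : PowerSeries 𝓔) : PowerSeries 𝓔 := PowerSeries.mk fun n => (n : ℂ) • PowerSeries.coeff n f

theorem euler_mul (f g : PowerSeries 𝓔) : euler (f * g) = euler f * g + f * euler g := by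
  ext n
  simp only [euler, PowerSeries.coeff_mk, map_add, PowerSeries.coeff_mul, Finset.smul_sum,
    ← Finset.sum_add_distrib]
  refine Finset.sum_congr rfl fun p hp => ?_
  rw [mem_antidiagonal] at hp
  rw [smul_mul_assoc, mul_smul_comm, ← add_smul, ← Nat.cast_add, hp]

/-- The usual power rule, valid in a noncommutative ring as soon as the series commutes with its own
derivative. -/
theorem euler_pow {Λ : PowerSeries 𝓔} (hc : Commute Λ (euler Λ)) (k : ℕ) :
    euler (Λ ^ (k + 1)) = (k + 1) • (euler Λ * Λ ^ k) := by
  induction k with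
  | zero => simp
  | succ k ih =>
    rw [pow_succ' Λ (k + 1), euler_mul, ih, mul_smul_comm, ← mul_assoc, hc.eq, mul_assoc,
      ← pow_succ', add_nsmul _ (k + 1) 1, one_nsmul, add_comm]

theorem expSeq_eq_sum (A : ℕ → 𝓔) (n M : ℕ) (hM : n < M) : expSeq A n =
    ∑ k ∈ Finset.range M, ((k.factorial : ℂ)⁻¹) •
    PowerSeries.coeff n ((PowerSeries.mk fun i => if i = 0 then 0 else A i) ^ k) := by
  refine Finset.sum_subset (Finset.range_mono hM) fun k _ hk => ?_
  rw [Finset.mem_range, not_lt] at hk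
  rw [coeff_pow_eq_zero (by simp) k n hk, smul_zero]

/-- The recursion is the differential equation `t d/dt exp Λ = (t d/dt Λ) exp Λ`, compared
coefficientwise. -/
theorem isExpSeq_expSeq {A : ℕ → 𝓔} (hA : ∀ i j, Commute (A i) (A j)) :
    IsExpSeq A (expSeq A) := by
  set Λ : PowerSeries 𝓔 := PowerSeries.mk fun i => if i = 0 then 0 else A i with hΛ
  have hc : Commute Λ (euler Λ) := by
    ext n
    simp only [PowerSeries.coeff_mul, euler, PowerSeries.coeff_mk, hΛ]
    rw [← Finset.Nat.sum_antidiagonal_swap]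
    refine Finset.sum_congr rfl fun p _ => ?_
    simp only [Prod.fst_swap, Prod.snd_swap]
    split_ifs <;> simp [(hA p.1 p.2).eq]
  refine ⟨by simp [expSeq], fun n => ?_⟩
  -- One superfluous power is included: after `k = 0` is split off, the shifted sum has the length
  -- `n + 1` needed for the inner exponentials.
  rw [expSeq_eq_sum A n (n + 2) (by omega), Finset.sum_range_succ', smul_add]
  have h0 : (n : ℂ) • (((Nat.factorial 0 : ℕ) : ℂ)⁻¹ • PowerSeries.coeff n (Λ ^ 0)) = 0 := by
    rw [pow_zero, PowerSeries.coeff_one]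
    split_ifs with h <;> simp [h]
  rw [h0, add_zero, Finset.smul_sum]
  have h1 : ∀ k, (n : ℂ) • ((((k + 1).factorial : ℕ) : ℂ)⁻¹ • PowerSeries.coeff n (Λ ^ (k + 1))) =
      ∑ p ∈ antidiagonal n, (p.1 : ℂ) • (A p.1 * ((k.factorial : ℂ)⁻¹ •
        PowerSeries.coeff p.2 (Λ ^ k))) := by
    intro k
    have h2 : (n : ℂ) • PowerSeries.coeff n (Λ ^ (k + 1))
        = PowerSeries.coeff n (euler (Λ ^ (k + 1))) := by simp [euler]
    rw [smul_comm, h2, euler_pow hc, map_nsmul, PowerSeries.coeff_mul, Finset.smul_sum,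
      Finset.smul_sum]
    refine Finset.sum_congr rfl fun p _ => ?_
    have h3 : PowerSeries.coeff p.1 (euler Λ) = (p.1 : ℂ) • A p.1 := by
      simp only [euler, hΛ, PowerSeries.coeff_mk]
      split_ifs with h <;> simp [h]
    rw [h3, ← Nat.cast_smul_eq_nsmul ℂ, smul_smul, smul_mul_assoc, mul_smul_comm, smul_smul,
      smul_smul]
    congr 1
    rw [Nat.factorial_succ]
    have h4 : ((k + 1 : ℕ) : ℂ) ≠ 0 := by exact_mod_cast (Nat.succ_ne_zero k)
    have h5 : (k.factorial : ℂ) ≠ 0 := by exact_mod_cast k.factorial_ne_zero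
    rw [Nat.cast_mul]
    field_simp
  rw [Finset.sum_congr rfl fun k _ => h1 k, Finset.sum_comm]
  refine Finset.sum_congr rfl fun p hp => ?_
  rw [mem_antidiagonal] at hp
  rw [expSeq_eq_sum A p.2 (n + 1) (by omega), Finset.mul_sum, Finset.smul_sum]

/-- Extension of a sequence by zero to negative indices. -/
def extZ (C : ℕ → 𝓔) (n : ℤ) : 𝓔 := if 0 ≤ n then C n.toNat else 0

@[simp] theorem extZ_natCast (C : ℕ → 𝓔) (n : ℕ) : extZ C n = C n := by simp [extZ]

theorem extZ_of_neg (C : ℕ → 𝓔) {n : ℤ} (hn : n < 0) : extZ C n = 0 := by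
  simp [extZ, not_le.mpr hn]

theorem extZ_natCast_sub (C : ℕ → 𝓔) {n k : ℕ} (h : k ≤ n) : extZ C (n - k) = C (n - k) := by
  rw [← Nat.cast_sub h, extZ_natCast]

/-- Extension by zero allows one fixed range of summation for all indices, so that the recursion can
be applied to shifted indices without truncated subtraction. -/
theorem IsExpSeq.extZ_eq {A E : ℕ → 𝓔} (h : IsExpSeq A E) (n : ℤ) (M : ℕ) (hM : n < M) :
    (n : ℂ) • extZ E n = ∑ i ∈ Finset.range M, (i : ℂ) • (A i * extZ E (n - i)) := by
  rcases lt_or_ge n 0 with hn | hn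
  · rw [extZ_of_neg _ hn, smul_zero]
    refine (Finset.sum_eq_zero fun i _ => ?_).symm
    rw [extZ_of_neg _ (by omega), mul_zero, smul_zero]
  · obtain ⟨n, rfl⟩ := Int.eq_ofNat_of_zero_le hn
    have h1 := h.2 n
    rw [extZ_natCast, Int.cast_natCast, h1, Finset.Nat.sum_antidiagonal_eq_sum_range_succ_mk]
    symm
    rw [← Finset.sum_subset (Finset.range_mono (show n + 1 ≤ M by omega))]
    · refine Finset.sum_congr rfl fun i hi => ?_
      rw [Finset.mem_range] at hi
      rw [extZ_natCast_sub _ (by omega)]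
    · intro i _ hi
      rw [Finset.mem_range, not_lt] at hi
      rw [extZ_of_neg _ (by omega), mul_zero, smul_zero]

/-- Commutation of an annihilation operator with the exponential of creation operators. -/
theorem IsExpSeq.comm_extZ {c C : ℕ → 𝓔} (hC : IsExpSeq c C) {b : 𝓔} {l : ℂ} {i : ℕ}
    (hi : i ≠ 0) (hbc : ∀ k, k ≠ 0 → b * c k = c k * b + if i = k then l • 1 else 0) (a : ℤ) :
    b * extZ C a = extZ C a * b + l • extZ C (a - i) := by
  rcases lt_or_ge a 0 with ha | ha
  · rw [extZ_of_neg _ ha, extZ_of_neg _ (by omega)]; simp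
  obtain ⟨a, rfl⟩ := Int.eq_ofNat_of_zero_le ha
  induction a using Nat.strong_induction_on with
  | _ a ih =>
    rcases Nat.eq_zero_or_pos a with rfl | hpos
    · rw [extZ_of_neg C (n := ((0 : ℕ) : ℤ) - i) (by omega)]
      have h1 : extZ C ((0 : ℕ) : ℤ) = 1 := by rw [extZ_natCast, hC.1]
      rw [h1]; simp
    · have ha' : ((a : ℤ) : ℂ) ≠ 0 := by exact_mod_cast hpos.ne'
      refine (smul_right_injective _ ha') ?_
      -- In each term of the recursion `b` is moved first past `c k`, then past the shorter
      -- exponential by induction. The two kinds of corrections sum up with weights `a - i` and `i`,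
      -- together the factor `a` that is cancelled.
      have e1 : ∀ k ∈ Finset.range (a + i + 1), (k : ℂ) • (b * (c k * extZ C ((a : ℤ) - k))) =
          (k : ℂ) • (c k * extZ C ((a : ℤ) - k)) * b
          + l • ((k : ℂ) • (c k * extZ C ((a : ℤ) - i - k)))
          + if i = k then ((i : ℂ) * l) • extZ C ((a : ℤ) - i) else 0 := by
        intro k _
        rcases Nat.eq_zero_or_pos k with rfl | hk
        · simp [hi]
        · rcases lt_or_ge (a : ℤ) k with h | h
          · rw [extZ_of_neg C (n := (a : ℤ) - k) (by omega),
              extZ_of_neg C (n := (a : ℤ) - i - k) (by omega)]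
            split_ifs with hik
            · rw [extZ_of_neg C (n := (a : ℤ) - i) (by omega)]; simp
            · simp
          · have h2 := ih (a - k) (by omega) (by omega)
            rw [Nat.cast_sub (by omega)] at h2
            rw [← mul_assoc, hbc k hk.ne', add_mul, mul_assoc, h2,
              show (a : ℤ) - k - i = (a : ℤ) - i - k by ring]
            split_ifs with hik
            · subst hik
              simp only [mul_add, smul_add, mul_smul_comm, smul_mul_assoc, one_mul, mul_assoc,
                smul_smul]
              rw [mul_comm l]
            · simp only [mul_add, smul_add, mul_smul_comm, smul_mul_assoc, mul_assoc, zero_mul,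
                add_zero, smul_smul]
              rw [mul_comm l]
      have e2 := hC.extZ_eq a (a + i + 1) (by push_cast; omega)
      have e3 := hC.extZ_eq ((a : ℤ) - i) (a + i + 1) (by push_cast; omega)
      calc ((a : ℤ) : ℂ) • (b * extZ C a)
          = ∑ k ∈ Finset.range (a + i + 1), (k : ℂ) • (b * (c k * extZ C ((a : ℤ) - k))) := by
            rw [← mul_smul_comm, e2, Finset.mul_sum]
            simp only [mul_smul_comm]
        _ = ((a : ℤ) : ℂ) • (extZ C a * b) + l • ((((a : ℤ) - i : ℤ) : ℂ) • extZ C ((a : ℤ) - i))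
              + ((i : ℂ) * l) • extZ C ((a : ℤ) - i) := by
            rw [Finset.sum_congr rfl e1, Finset.sum_add_distrib, Finset.sum_add_distrib,
              ← Finset.sum_mul, ← e2, ← Finset.smul_sum, ← e3, Finset.sum_ite_eq, if_pos
              (Finset.mem_range.mpr (by omega)), smul_mul_assoc]
        _ = ((a : ℤ) : ℂ) • (extZ C a * b + l • extZ C ((a : ℤ) - i)) := by
            rw [smul_add, smul_smul, smul_smul, add_assoc, ← add_smul]
            congr 2
            push_cast; ring

/-- A shift of the summation index that keeps the range, since the terms at both ends vanish. -/
theorem sum_range_shift {F : Type*} [AddCommMonoid F] (M i : ℕ) (f g : ℕ → F)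
    (hf : ∀ k, M ≤ k + i → f k = 0) (hg : ∀ k < i, g k = 0) (hfg : ∀ k, g (k + i) = f k) :
    ∑ k ∈ Finset.range M, f k = ∑ k ∈ Finset.range M, g k := by
  rcases le_or_gt i M with h | h
  · obtain ⟨L, rfl⟩ := Nat.exists_eq_add_of_le h
    rw [Finset.sum_range_add g, Finset.sum_eq_zero (s := Finset.range i) fun k hk =>
      hg k (Finset.mem_range.mp hk), zero_add]
    rw [← Finset.sum_subset (Finset.range_mono (show L ≤ i + L by omega))]
    · exact Finset.sum_congr rfl fun k _ => by rw [← hfg, add_comm]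
    · intro k _ hk
      rw [Finset.mem_range, not_lt] at hk
      exact hf k (by omega)
  · rw [Finset.sum_eq_zero fun k _ => hf k (by omega),
      Finset.sum_eq_zero fun k hk => hg k ((Finset.mem_range.mp hk).trans h)]

/-- Normal ordering of the exponentials of annihilation and creation operators. -/
theorem IsExpSeq.normalOrder {c C b A : ℕ → 𝓔} {l h : ℕ → ℂ} (hC : IsExpSeq c C)
    (hA : IsExpSeq b A) (hh : IsExpSeq l h)
    (hbc : ∀ i k, i ≠ 0 → k ≠ 0 → b i * c k = c k * b i + if i = k then l i • 1 else 0)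
    (a : ℤ) (n M : ℕ) (hM : n < M) :
    A n * extZ C a = ∑ k ∈ Finset.range M, h k • (extZ C (a - k) * extZ A ((n : ℤ) - k)) := by
  induction n using Nat.strong_induction_on with
  | _ n ih =>
    rcases Nat.eq_zero_or_pos n with rfl | hpos
    · rw [Finset.sum_eq_single_of_mem 0 (Finset.mem_range.mpr hM)]
      · have h1 : extZ A ((0 : ℕ) : ℤ) = 1 := by rw [extZ_natCast, hA.1]
        simp only [Nat.cast_zero, sub_zero] at h1 ⊢
        rw [h1, hh.1, hA.1, one_mul, mul_one, one_smul]
      · intro k _ hk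
        rw [extZ_of_neg A (by omega), mul_zero, smul_zero]
    · have hn' : (n : ℂ) ≠ 0 := by exact_mod_cast hpos.ne'
      refine (smul_right_injective _ hn') ?_
      set F : ℕ → 𝓔 := fun k => extZ C (a - k) * extZ A ((n : ℤ) - k) with hF
      have hF0 : ∀ k, M ≤ k → F k = 0 := fun k hk => by
        simp only [hF]; rw [extZ_of_neg A (by omega), mul_zero]
      -- The induction hypothesis reorders the shorter exponential, then `b i` is moved past the
      -- creation part. The commutator term carries a shift of `k` by `i`, which is absorbed into
      -- the index of `h`.
      have e1 : ∀ i ∈ Finset.range M, (i : ℂ) • (b i * extZ A ((n : ℤ) - i)) * extZ C a =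
          ∑ k ∈ Finset.range M, (h k • (extZ C (a - k) *
            ((i : ℂ) • (b i * extZ A ((n : ℤ) - k - i))))
            + ((i : ℂ) * l i * extZ h ((k : ℤ) - i)) • F k) := by
        intro i _
        rcases Nat.eq_zero_or_pos i with rfl | hi
        · simp
        rw [Finset.sum_add_distrib,
          ← sum_range_shift M i (fun k => ((i : ℂ) * l i * h k) • F (k + i))
            (fun k => ((i : ℂ) * l i * extZ h ((k : ℤ) - i)) • F k)
            (fun k hk => by simp only [hF0 _ hk, smul_zero])
            (fun k hk => by simp only [extZ_of_neg h (show (k : ℤ) - i < 0 by omega), mul_zero,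
                zero_smul])
            (fun k => by
              simp only [Nat.cast_add, add_sub_cancel_right, extZ_natCast])]
        rw [← Finset.sum_add_distrib]
        rcases lt_or_ge n i with hin | hin
        · rw [extZ_of_neg A (n := (n : ℤ) - i) (by omega)]
          simp only [mul_zero, smul_zero, zero_mul]
          refine (Finset.sum_eq_zero fun k _ => ?_).symm
          simp only [hF]
          rw [extZ_of_neg A (n := (n : ℤ) - k - i) (by omega),
            extZ_of_neg A (n := (n : ℤ) - (k + i : ℕ)) (by push_cast; omega)]
          simp
        · have h1 := ih (n - i) (by omega) (by omega)
          rw [extZ_natCast_sub A hin, smul_mul_assoc, mul_assoc, h1, Finset.mul_sum,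
            Finset.smul_sum]
          refine Finset.sum_congr rfl fun k _ => ?_
          rw [mul_smul_comm, ← mul_assoc, hC.comm_extZ hi.ne' (fun k' hk' => hbc i k' hi.ne' hk')]
          simp only [hF, Nat.cast_add, Nat.cast_sub hin]
          rw [show (n : ℤ) - i - k = (n : ℤ) - k - i by ring,
            show (n : ℤ) - (k + i) = (n : ℤ) - k - i by ring, show a - (k + i) = a - k - i by ring]
          simp only [add_mul, smul_add, mul_smul_comm, smul_mul_assoc, smul_smul, mul_assoc]
          congr 2 <;> ring
      calc (n : ℂ) • (A n * extZ C a)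
          = ∑ i ∈ Finset.range M, (i : ℂ) • (b i * extZ A ((n : ℤ) - i)) * extZ C a := by
            have := hA.extZ_eq n M (by omega)
            rw [extZ_natCast, Int.cast_natCast] at this
            rw [← smul_mul_assoc, this, Finset.sum_mul]
        _ = ∑ k ∈ Finset.range M, (n : ℂ) • (h k • F k) := by
            rw [Finset.sum_congr rfl e1, Finset.sum_comm]
            -- For fixed `k` the sums over `i` are the recursions for `A` at `n - k` and for `h` at
            -- `k`; their weights add up to `n`.
            refine Finset.sum_congr rfl fun k hk => ?_
            rw [Finset.mem_range] at hk
            have h2 := hA.extZ_eq ((n : ℤ) - k) M (by omega)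
            have h3 := hh.extZ_eq k M (by omega)
            simp only [smul_eq_mul, ← mul_assoc, extZ_natCast, Int.cast_natCast] at h3
            rw [Finset.sum_add_distrib, ← Finset.smul_sum, ← Finset.mul_sum, ← h2,
              ← Finset.sum_smul, ← h3, mul_smul_comm, smul_smul, ← add_smul, smul_smul]
            congr 1
            push_cast; ring
        _ = _ := Finset.smul_sum.symm

end

end

section

open Finset.HasAntidiagonal (antidiagonal mem_antidiagonal)

/-! ### Absolutely convergent evaluation of formal power series -/

section

variable {A : Type*} [AddCommMonoid A] [Finset.HasAntidiagonal A] {w : A → ℂ} {f g : A → ℂ}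

/-- The weight is a power in one variable or a monomial in several, so the same Cauchy product
serves ordinary and multivariate series. -/
theorem conv_mul_weight (hw : ∀ a b, w (a + b) = w a * w b) (n : A) :
    (∑ p ∈ antidiagonal n, f p.1 * g p.2) * w n =
      ∑ p ∈ antidiagonal n, (f p.1 * w p.1) * (g p.2 * w p.2) := by
  rw [Finset.sum_mul]
  refine Finset.sum_congr rfl fun p hp => ?_
  rw [← mem_antidiagonal.mp hp, hw]; ring

theorem summable_conv (hw : ∀ a b, w (a + b) = w a * w b)
    (hf : Summable fun a => ‖f a * w a‖) (hg : Summable fun a => ‖g a * w a‖) :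
    Summable fun n => ‖(∑ p ∈ antidiagonal n, f p.1 * g p.2) * w n‖ := by
  have h := summable_sum_mul_antidiagonal_of_summable_mul
    (f := fun a => ‖f a * w a‖) (g := fun a => ‖g a * w a‖) (hf.mul_of_nonneg hg (fun _ => norm_nonneg _) (fun _ => norm_nonneg _))
  refine Summable.of_nonneg_of_le (fun _ => norm_nonneg _) (fun n => ?_) h
  rw [conv_mul_weight hw]
  exact (norm_sum_le _ _).trans (Finset.sum_le_sum fun p _ => (norm_mul _ _).le)

theorem tsum_conv (hw : ∀ a b, w (a + b) = w a * w b)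
    (hf : Summable fun a => ‖f a * w a‖) (hg : Summable fun a => ‖g a * w a‖) :
    ∑' n, (∑ p ∈ antidiagonal n, f p.1 * g p.2) * w n =
      (∑' a, f a * w a) * ∑' a, g a * w a := by
  have h := Summable.tsum_mul_tsum_eq_tsum_sum_antidiagonal (f := fun a => f a * w a)
    (g := fun a => g a * w a) hf.of_norm hg.of_norm
    (summable_mul_of_summable_norm (f := fun a => f a * w a) (g := fun a => g a * w a) hf hg)
  rw [h]
  exact tsum_congr fun n => conv_mul_weight hw n

theorem tsum_norm_conv_le (hw : ∀ a b, w (a + b) = w a * w b)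
    (hf : Summable fun a => ‖f a * w a‖) (hg : Summable fun a => ‖g a * w a‖) :
    ∑' n, ‖(∑ p ∈ antidiagonal n, f p.1 * g p.2) * w n‖ ≤
      (∑' a, ‖f a * w a‖) * ∑' a, ‖g a * w a‖ := by
  have h0 := hf.mul_of_nonneg hg (fun _ => norm_nonneg _) (fun _ => norm_nonneg _)
  have h1 := Summable.tsum_mul_tsum_eq_tsum_sum_antidiagonal (f := fun a => ‖f a * w a‖)
    (g := fun a => ‖g a * w a‖) hf hg h0
  rw [h1]
  refine Summable.tsum_le_tsum (fun n => ?_) (summable_conv hw hf hg)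
    (summable_sum_mul_antidiagonal_of_summable_mul (f := fun a => ‖f a * w a‖)
      (g := fun a => ‖g a * w a‖) h0)
  rw [conv_mul_weight hw]
  exact (norm_sum_le _ _).trans (Finset.sum_le_sum fun p _ => (norm_mul _ _).le)

end

section

variable {l : ℕ → ℂ} {y : ℂ}

/-- The three claims are proved together because the induction uses all of them; the norm bound
later makes the sum over `k` with weights `1 / k!` converge. -/
theorem summable_coeff_pow (hs : Summable fun i => ‖l i * y ^ i‖) (k : ℕ) :
    Summable (fun n => ‖PowerSeries.coeff n (PowerSeries.mk l ^ k) * y ^ n‖) ∧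
    ∑' n, PowerSeries.coeff n (PowerSeries.mk l ^ k) * y ^ n = (∑' i, l i * y ^ i) ^ k ∧
    ∑' n, ‖PowerSeries.coeff n (PowerSeries.mk l ^ k) * y ^ n‖ ≤ (∑' i, ‖l i * y ^ i‖) ^ k := by
  have hw : ∀ a b : ℕ, y ^ (a + b) = y ^ a * y ^ b := fun a b => pow_add y a b
  induction k with
  | zero =>
    have h : ∀ n, n ≠ 0 → PowerSeries.coeff n (PowerSeries.mk l ^ 0) * y ^ n = 0 := by
      intro n hn; simp [PowerSeries.coeff_one, hn]
    have h' : ∀ n, n ≠ 0 → ‖PowerSeries.coeff n (PowerSeries.mk l ^ 0) * y ^ n‖ = 0 := by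
      intro n hn; rw [h n hn, norm_zero]
    refine ⟨(hasSum_single 0 h').summable, ?_, ?_⟩
    · rw [(hasSum_single 0 h).tsum_eq]; simp
    · rw [(hasSum_single 0 h').tsum_eq]; simp
  | succ k ih =>
    have hs' : Summable fun i => ‖PowerSeries.coeff i (PowerSeries.mk l) * y ^ i‖ := by
      simpa using hs
    simp only [pow_succ (PowerSeries.mk l), PowerSeries.coeff_mul]
    refine ⟨summable_conv (w := fun n => y ^ n)
      (f := fun n => PowerSeries.coeff n (PowerSeries.mk l ^ k))
      (g := fun n => PowerSeries.coeff n (PowerSeries.mk l)) hw ih.1 hs', ?_, ?_⟩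
    · refine (tsum_conv (w := fun n => y ^ n)
        (f := fun n => PowerSeries.coeff n (PowerSeries.mk l ^ k))
        (g := fun n => PowerSeries.coeff n (PowerSeries.mk l)) hw ih.1 hs').trans ?_
      rw [ih.2.1, pow_succ]
      simp
    · refine (tsum_norm_conv_le (w := fun n => y ^ n)
        (f := fun n => PowerSeries.coeff n (PowerSeries.mk l ^ k))
        (g := fun n => PowerSeries.coeff n (PowerSeries.mk l)) hw ih.1 hs').trans ?_
      rw [pow_succ]
      refine mul_le_mul ih.2.2 (by simp) (tsum_nonneg fun _ => norm_nonneg _) ?_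
      exact pow_nonneg (tsum_nonneg fun _ => norm_nonneg _) _

theorem hasSum_expSeq (h0 : l 0 = 0) (hs : Summable fun i => ‖l i * y ^ i‖) :
    Summable (fun n => ‖expSeq l n * y ^ n‖) ∧
      ∑' n, expSeq l n * y ^ n = Complex.exp (∑' i, l i * y ^ i) := by
  have hl : (PowerSeries.mk fun i => if i = 0 then 0 else l i) = PowerSeries.mk l := by
    ext i
    simp only [PowerSeries.coeff_mk]
    split_ifs with h
    · rw [h, h0]
    · rfl
  -- The exponential is an absolutely convergent double series, dominated by the exponential series
  -- of the sum of norms. Summing over `k` first gives the coefficients, summing over `n` first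
  -- gives the value.
  set G : ℕ × ℕ → ℂ := fun p => ((p.1.factorial : ℂ)⁻¹) *
    (PowerSeries.coeff p.2 (PowerSeries.mk l ^ p.1) * y ^ p.2) with hG
  have hGn : Summable fun p => ‖G p‖ := by
    rw [summable_prod_of_nonneg fun _ => norm_nonneg _]
    constructor
    · intro k
      simp only [hG, norm_mul ((_ : ℂ)⁻¹)]
      exact (summable_coeff_pow hs k).1.mul_left _
    · refine Summable.of_nonneg_of_le (fun _ => tsum_nonneg fun _ => norm_nonneg _) (fun k => ?_)
        (Real.summable_pow_div_factorial (∑' i, ‖l i * y ^ i‖))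
      simp only [hG, norm_mul ((_ : ℂ)⁻¹)]
      rw [tsum_mul_left, norm_inv, Complex.norm_natCast, div_eq_inv_mul]
      exact mul_le_mul_of_nonneg_left (summable_coeff_pow hs k).2.2 (by positivity)
  have hfin : ∀ n, HasSum (fun k => G (k, n)) (expSeq l n * y ^ n) := by
    intro n
    have : expSeq l n * y ^ n = ∑ k ∈ Finset.range (n + 1), G (k, n) := by
      simp only [expSeq, hl, Finset.sum_mul, hG, smul_eq_mul, mul_assoc]
    rw [this]
    refine hasSum_sum_of_ne_finset_zero fun k hk => ?_
    rw [Finset.mem_range, not_lt] at hk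
    simp only [hG]
    rw [coeff_pow_eq_zero (by simp [h0]) k n hk, zero_mul, mul_zero]
  have hswap : Summable fun p : ℕ × ℕ => ‖G p.swap‖ := (Equiv.prodComm ℕ ℕ).summable_iff.mpr hGn
  have hsum : Summable (fun n => ‖expSeq l n * y ^ n‖) := by
    refine Summable.of_nonneg_of_le (fun _ => norm_nonneg _) (fun n => ?_) hswap.prod
    rw [← (hfin n).tsum_eq]
    exact norm_tsum_le_tsum_norm (hswap.prod_factor n)
  refine ⟨hsum, ?_⟩
  calc ∑' n, expSeq l n * y ^ n = ∑' n, ∑' k, G (k, n) := tsum_congr fun n => (hfin n).tsum_eq.symm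
    _ = ∑' k, ∑' n, G (k, n) := (Summable.tsum_comm (f := fun k n => G (k, n)) hGn.of_norm)
    _ = ∑' k : ℕ, (k.factorial : ℂ)⁻¹ • (∑' i, l i * y ^ i) ^ k := by
      refine tsum_congr fun k => ?_
      simp only [hG]
      rw [tsum_mul_left, (summable_coeff_pow hs k).2.1, smul_eq_mul]
    _ = Complex.exp (∑' i, l i * y ^ i) := by
      rw [Complex.exp_eq_exp_ℂ, NormedSpace.exp_eq_tsum ℂ]

end

/-! ### Products over the pairs of a list -/

/-- The product of `f p q` over the pairs `p, q` of entries of the list, `p` before `q`. -/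
def pairProd {ι M : Type*} [CommMonoid M] (f : ι → ι → M) : List ι → M
  | [] => 1
  | p :: l => (l.map (f p)).prod * pairProd f l

/-! ### Generating functions of modes -/

section

variable {σ : Type*} [DecidableEq σ] {𝓔 : Type*} [Ring 𝓔] [Algebra ℂ 𝓔]

/-- The series `∑ f k X_j ^ k`. -/
def gen (j : σ) (f : ℕ → 𝓔) : MvPowerSeries σ 𝓔 :=
  fun n => if n = Finsupp.single j (n j) then f (n j) else 0

theorem coeff_gen (j : σ) (f : ℕ → 𝓔) (n : σ →₀ ℕ) : MvPowerSeries.coeff n (gen j f) =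
    if n = Finsupp.single j (n j) then f (n j) else 0 := rfl

/-- If the second factor does not contain the variable `X_j`, only one splitting of the exponent
contributes. -/
theorem coeff_gen_mul (j : σ) (f : ℕ → 𝓔) (F : MvPowerSeries σ 𝓔)
    (hF : ∀ n, n j ≠ 0 → MvPowerSeries.coeff n F = 0) (n : σ →₀ ℕ) :
    MvPowerSeries.coeff n (gen j f * F) = f (n j) * MvPowerSeries.coeff (n.erase j) F := by
  rw [MvPowerSeries.coeff_mul, Finset.sum_eq_single (Finsupp.single j (n j), n.erase j)]
  · rw [coeff_gen]; simp
  · rintro ⟨a, b⟩ hab hne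
    rw [mem_antidiagonal] at hab
    simp only at hab ⊢
    by_cases hb : b j = 0
    · rw [coeff_gen]
      split_ifs with ha
      · exfalso; apply hne
        have h1 : a j = n j := by rw [← hab, Finsupp.add_apply, hb, add_zero]
        have h2 : a = Finsupp.single j (n j) := by rw [← h1]; exact ha
        have h3 : b = n.erase j := by
          ext i
          by_cases hi : i = j
          · rw [hi, hb, Finsupp.erase_same]
          · rw [Finsupp.erase_ne hi, ← hab, Finsupp.add_apply, h2,
              Finsupp.single_eq_of_ne hi, zero_add]
        rw [h2, h3]
      · rw [zero_mul]
    · rw [hF b hb, mul_zero]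
  · intro h
    exact absurd (mem_antidiagonal.mpr (Finsupp.single_add_erase j n)) h

-- Each variable occurs in one factor only, so a coefficient is a single ordered product of modes.
-- In this way sums over the modes of noncommuting currents become formal power series.
open Classical in
theorem coeff_list_prod_gen (l : List (σ × (ℕ → 𝓔))) (hl : (l.map Prod.fst).Nodup)
    (n : σ →₀ ℕ) : MvPowerSeries.coeff n (l.map fun p => gen p.1 p.2).prod =
      if ∀ j, j ∉ l.map Prod.fst → n j = 0 then (l.map fun p => p.2 (n p.1)).prod else 0 := by
  induction l generalizing n with
  | nil =>
    simp only [List.map_nil, List.prod_nil, List.not_mem_nil, not_false_eq_true, forall_true_left]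
    rw [MvPowerSeries.coeff_one]
    congr 1
    rw [eq_iff_iff, Finsupp.ext_iff]
    rfl
  | cons p l ih =>
    rw [List.map_cons, List.nodup_cons] at hl
    rw [List.map_cons, List.prod_cons, coeff_gen_mul]
    · rw [ih hl.2]
      have h1 : (l.map fun q => q.2 ((n.erase p.1) q.1)).prod = (l.map fun q => q.2 (n q.1)).prod := by
        congr 1
        refine List.map_congr_left fun q hq => ?_
        rw [Finsupp.erase_ne]
        intro h
        exact hl.1 (h ▸ List.mem_map_of_mem hq)
      have h2 : (∀ j, j ∉ l.map Prod.fst → (n.erase p.1) j = 0) ↔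
          ∀ j, j ∉ (p :: l).map Prod.fst → n j = 0 := by
        constructor
        · intro h j hj
          rw [List.map_cons, List.mem_cons, not_or] at hj
          have := h j hj.2
          rwa [Finsupp.erase_ne hj.1] at this
        · intro h j hj
          by_cases hjp : j = p.1
          · rw [hjp, Finsupp.erase_same]
          · rw [Finsupp.erase_ne hjp]
            refine h j ?_
            rw [List.map_cons, List.mem_cons, not_or]
            exact ⟨hjp, hj⟩
      rw [h1, if_congr h2 rfl rfl]
      split_ifs
      · rw [List.map_cons, List.prod_cons]
      · rw [mul_zero]
    · intro n' hn'
      rw [ih hl.2, if_neg]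
      intro h
      exact hn' (h _ hl.1)

/-- The series `∑ h k X_i ^ k X_j ^ k`. -/
def pairGen (i j : σ) (h : ℕ → ℂ) : MvPowerSeries σ ℂ :=
  fun n => if n = Finsupp.single i (n i) + Finsupp.single j (n i) then h (n i) else 0

theorem coeff_pairGen (i j : σ) (h : ℕ → ℂ) (n : σ →₀ ℕ) :
    MvPowerSeries.coeff n (pairGen i j h) =
      if n = Finsupp.single i (n i) + Finsupp.single j (n i) then h (n i) else 0 := rfl

/-- Only exponents that are multiples of `e_i + e_j` occur in the first factor, and such a multiple
must be at most `n`. -/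
theorem coeff_pairGen_mul {i j : σ} (hij : i ≠ j) (h : ℕ → ℂ) (F : MvPowerSeries σ 𝓔)
    (n : σ →₀ ℕ) :
    MvPowerSeries.coeff n (MvPowerSeries.map (algebraMap ℂ 𝓔) (pairGen i j h) * F) =
      ∑ k ∈ Finset.range (min (n i) (n j) + 1), h k •
        MvPowerSeries.coeff (n - (Finsupp.single i k + Finsupp.single j k)) F := by
  rw [MvPowerSeries.coeff_mul]
  set D : ℕ → σ →₀ ℕ := fun k => Finsupp.single i k + Finsupp.single j k with hD
  have hDi : ∀ k, D k i = k := fun k => by simp [hD, Finsupp.single_eq_of_ne hij]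
  have hDj : ∀ k, D k j = k := fun k => by simp [hD, Finsupp.single_eq_of_ne hij.symm]
  have hDle : ∀ k, k ≤ min (n i) (n j) → D k ≤ n := by
    intro k hk s
    rcases eq_or_ne s i with rfl | hsi
    · rw [hDi]; exact hk.trans (min_le_left _ _)
    · rcases eq_or_ne s j with rfl | hsj
      · rw [hDj]; exact hk.trans (min_le_right _ _)
      · simp [hD, Finsupp.single_eq_of_ne hsi, Finsupp.single_eq_of_ne hsj]
  symm
  refine Finset.sum_of_injOn (fun k => (D k, n - D k)) ?_ ?_ ?_ ?_
  · intro a _ b _ hab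
    have := congrArg (fun p : (σ →₀ ℕ) × (σ →₀ ℕ) => p.1 i) hab
    simpa [hDi] using this
  · intro k hk
    rw [Finset.mem_coe, Finset.mem_range] at hk
    rw [Finset.mem_coe, mem_antidiagonal]
    exact add_tsub_cancel_of_le (hDle k (by omega))
  · rintro ⟨a, b⟩ hab hne
    rw [mem_antidiagonal] at hab
    simp only at hab
    rw [MvPowerSeries.coeff_map, coeff_pairGen]
    split_ifs with ha
    · exfalso; apply hne
      have ha' : a = D (a i) := ha
      refine ⟨a i, ?_, ?_⟩
      · rw [Finset.mem_coe, Finset.mem_range, Nat.lt_succ_iff, le_min_iff]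
        constructor
        · rw [← hab]; simp
        · have : a j = a i := by conv_lhs => rw [ha', hDj]
          rw [← this, ← hab]; simp
      · simp only
        rw [← ha', ← hab, add_tsub_cancel_left]
    · rw [map_zero, zero_mul]
  · intro k _
    rw [MvPowerSeries.coeff_map, coeff_pairGen, hDi, if_pos rfl, ← Algebra.smul_def]

-- The generating function form of the normal ordering rule: the sum over `k` becomes multiplication
-- by a series with scalar, hence central, coefficients.
open Classical in
theorem gen_mul_gen {i j : σ} (hij : i ≠ j) (A C : ℕ → 𝓔) (h : ℕ → ℂ)
    (hAC : ∀ n a, A n * C a = ∑ k ∈ Finset.range (min n a + 1), h k • (C (a - k) * A (n - k))) :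
    gen i A * gen j C = MvPowerSeries.map (algebraMap ℂ 𝓔) (pairGen i j h) * (gen j C * gen i A) := by
  ext n
  rw [coeff_pairGen_mul hij]
  have h1 : MvPowerSeries.coeff n (gen i A * gen j C) =
      if ∀ s, s ∉ [i, j] → n s = 0 then A (n i) * C (n j) else 0 := by
    have h := coeff_list_prod_gen [(i, A), (j, C)] (by simpa using hij) n
    simp only [List.map_cons, List.map_nil, List.prod_cons, List.prod_nil, mul_one] at h
    exact h
  have h2 : ∀ n, MvPowerSeries.coeff n (gen j C * gen i A) =
      if ∀ s, s ∉ [j, i] → n s = 0 then C (n j) * A (n i) else 0 := by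
    intro n
    have h := coeff_list_prod_gen [(j, C), (i, A)] (by simpa using hij.symm) n
    simp only [List.map_cons, List.map_nil, List.prod_cons, List.prod_nil, mul_one] at h
    exact h
  rw [h1]
  simp_rw [h2]
  have hsub : ∀ k s, s ∉ [j, i] → (n - (Finsupp.single i k + Finsupp.single j k) : σ →₀ ℕ) s = n s := by
    intro k s hs
    simp only [List.mem_cons, List.not_mem_nil, or_false, not_or] at hs
    simp [Finsupp.single_eq_of_ne hs.1, Finsupp.single_eq_of_ne hs.2]
  have hmem : ∀ s, s ∉ [i, j] ↔ s ∉ [j, i] := by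
    intro s; simp only [List.mem_cons, List.not_mem_nil, or_false]; tauto
  by_cases hn : ∀ s, s ∉ [j, i] → n s = 0
  · rw [if_pos fun s hs => hn s ((hmem s).mp hs), hAC]
    refine Finset.sum_congr rfl fun k _ => ?_
    rw [if_pos fun s hs => (hsub k s hs).trans (hn s hs)]
    simp [Finsupp.single_eq_of_ne hij, Finsupp.single_eq_of_ne hij.symm]
  · rw [if_neg fun h => hn fun s hs => h s ((hmem s).mpr hs)]
    refine (Finset.sum_eq_zero fun k _ => ?_).symm
    rw [if_neg, smul_zero]
    intro h
    exact hn fun s hs => (hsub k s hs).symm.trans (h s hs)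

theorem commute_map_algebraMap (f : MvPowerSeries σ ℂ) (F : MvPowerSeries σ 𝓔) :
    Commute (MvPowerSeries.map (algebraMap ℂ 𝓔) f) F := by
  ext n
  rw [MvPowerSeries.coeff_mul, MvPowerSeries.coeff_mul]
  refine Finset.sum_nbij' Prod.swap Prod.swap ?_ ?_ ?_ ?_ ?_
  · intro p hp; rw [mem_antidiagonal] at hp ⊢; rw [← hp, add_comm]; rfl
  · intro p hp; rw [mem_antidiagonal] at hp ⊢; rw [← hp, add_comm]; rfl
  · intro p _; rfl
  · intro p _; rfl
  · intro p _
    rw [MvPowerSeries.coeff_map]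
    exact Algebra.commutes _ _

end

end

/-! ### Wick's theorem for formal series and its evaluation at a point -/

section

open Finset.HasAntidiagonal (antidiagonal mem_antidiagonal)

/-- Wick's theorem in abstract form: annihilation parts travel to the right past the creation parts
of all later factors, and each such pair leaves a central factor behind. -/
theorem list_normalOrder {ι R M : Type*} [Ring R] [CommMonoid M] (φ : M →* R)
    (hφ : ∀ m y, Commute (φ m) y) (C A : ι → R) (H : ι → ι → M) (l : List ι)
    (hl : l.Pairwise fun p q => A p * C q = φ (H p q) * (C q * A p)) :
    (l.map fun p => C p * A p).prod =
      φ (pairProd H l) * ((l.map C).prod * (l.map A).prod) := by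
  induction l with
  | nil => simp [pairProd]
  | cons p l ih =>
    rw [List.pairwise_cons] at hl
    have aux : ∀ l' : List ι, (∀ q ∈ l', A p * C q = φ (H p q) * (C q * A p)) →
        A p * (l'.map C).prod = φ (l'.map (H p)).prod * ((l'.map C).prod * A p) := by
      intro l'
      induction l' with
      | nil => intro _; simp
      | cons q l' ih' =>
        intro h
        rw [List.map_cons, List.prod_cons, List.map_cons, List.prod_cons, ← mul_assoc,
          h q List.mem_cons_self, map_mul, mul_assoc, mul_assoc,
          ih' fun q' hq' => h q' (List.mem_cons_of_mem _ hq'), mul_assoc, mul_assoc]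
        congr 1
        rw [← mul_assoc (C q), (hφ _ (C q)).symm.eq, mul_assoc]
    simp only [List.map_cons, List.prod_cons, pairProd, map_mul]
    rw [ih hl.2, mul_assoc (C p), ← mul_assoc (A p), (hφ _ (A p)).symm.eq, mul_assoc (φ _) (A p),
      ← mul_assoc (A p), aux l hl.1, ← mul_assoc (C p), (hφ _ (C p)).symm.eq, mul_assoc (φ _) (C p),
      mul_assoc (φ _) ((l.map C).prod * A p), ← mul_assoc (C p), (hφ _ (C p)).symm.eq]
    simp only [← mul_assoc]
    rw [← map_mul, ← map_mul, mul_comm (pairProd H l)]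

section

variable {σ : Type*} [DecidableEq σ] [Fintype σ] {𝓔 : Type*} [Ring 𝓔] [Algebra ℂ 𝓔]

/-- The monomial `∏ ζ_j ^ n_j`. -/
def monomialAt (ζ : σ → ℂ) (n : σ →₀ ℕ) : ℂ := ∏ j, ζ j ^ n j

theorem monomialAt_add (ζ : σ → ℂ) (a b : σ →₀ ℕ) :
    monomialAt ζ (a + b) = monomialAt ζ a * monomialAt ζ b := by
  simp only [monomialAt, Finsupp.add_apply, pow_add, Finset.prod_mul_distrib]

/-- Absolute convergence of a formal power series to the value `c` at a point. -/
def ConvergesTo (f : MvPowerSeries σ ℂ) (ζ : σ → ℂ) (c : ℂ) : Prop :=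
  (Summable fun n => ‖MvPowerSeries.coeff n f * monomialAt ζ n‖) ∧
    ∑' n, MvPowerSeries.coeff n f * monomialAt ζ n = c

theorem ConvergesTo.mul {f g : MvPowerSeries σ ℂ} {ζ : σ → ℂ} {c d : ℂ}
    (hf : ConvergesTo f ζ c) (hg : ConvergesTo g ζ d) : ConvergesTo (f * g) ζ (c * d) := by
  unfold ConvergesTo
  simp only [MvPowerSeries.coeff_mul]
  refine ⟨summable_conv (w := monomialAt ζ) (f := fun n => MvPowerSeries.coeff n f)
      (g := fun n => MvPowerSeries.coeff n g) (monomialAt_add ζ) hf.1 hg.1,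
    (tsum_conv (w := monomialAt ζ) (f := fun n => MvPowerSeries.coeff n f)
      (g := fun n => MvPowerSeries.coeff n g) (monomialAt_add ζ) hf.1 hg.1).trans ?_⟩
  rw [hf.2, hg.2]

theorem ConvergesTo.one (ζ : σ → ℂ) : ConvergesTo 1 ζ 1 := by
  have h : ∀ n : σ →₀ ℕ, n ≠ 0 →
      MvPowerSeries.coeff n (1 : MvPowerSeries σ ℂ) * monomialAt ζ n = 0 := by
    intro n hn
    rw [MvPowerSeries.coeff_one, if_neg hn, zero_mul]
  have h' : ∀ n : σ →₀ ℕ, n ≠ 0 →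
      ‖MvPowerSeries.coeff n (1 : MvPowerSeries σ ℂ) * monomialAt ζ n‖ = 0 := by
    intro n hn; rw [h n hn, norm_zero]
  refine ⟨(hasSum_single 0 h').summable, ?_⟩
  rw [(hasSum_single 0 h).tsum_eq]
  simp [monomialAt]

theorem ConvergesTo.list_prod {ι : Type*} {f : ι → MvPowerSeries σ ℂ} {ζ : σ → ℂ} {c : ι → ℂ}
    {l : List ι} (h : ∀ p ∈ l, ConvergesTo (f p) ζ (c p)) :
    ConvergesTo (l.map f).prod ζ (l.map c).prod := by
  induction l with
  | nil => exact ConvergesTo.one ζ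
  | cons p l ih =>
    simp only [List.map_cons, List.prod_cons]
    exact (h p List.mem_cons_self).mul (ih fun q hq => h q (List.mem_cons_of_mem _ hq))

theorem ConvergesTo.pairProd {ι : Type*} {f : ι → ι → MvPowerSeries σ ℂ} {ζ : σ → ℂ}
    {c : ι → ι → ℂ} {l : List ι} (h : l.Pairwise fun p q => ConvergesTo (f p q) ζ (c p q)) :
    ConvergesTo (pairProd f l) ζ (pairProd c l) := by
  induction l with
  | nil => exact ConvergesTo.one ζ
  | cons p l ih =>
    rw [List.pairwise_cons] at h
    exact (ConvergesTo.list_prod h.1).mul (ih h.2)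

theorem convergesTo_pairGen {i j : σ} (hij : i ≠ j) {h : ℕ → ℂ} {ζ : σ → ℂ}
    (hs : Summable fun k => ‖h k * (ζ i * ζ j) ^ k‖) :
    ConvergesTo (pairGen i j h) ζ (∑' k, h k * (ζ i * ζ j) ^ k) := by
  set D : ℕ → σ →₀ ℕ := fun k => Finsupp.single i k + Finsupp.single j k with hD
  have hDi : ∀ k, D k i = k := fun k => by simp [hD, Finsupp.single_eq_of_ne hij]
  have hinj : Function.Injective D := fun a b hab => by
    have := congrArg (fun p : σ →₀ ℕ => p i) hab
    simpa [hDi] using this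
  have hval : ∀ k, MvPowerSeries.coeff (D k) (pairGen i j h) * monomialAt ζ (D k) =
      h k * (ζ i * ζ j) ^ k := by
    intro k
    rw [coeff_pairGen, hDi, if_pos rfl, hD, monomialAt_add, mul_pow]
    simp only [monomialAt, Finsupp.single_apply, pow_ite, pow_zero, Finset.prod_ite_eq,
      Finset.mem_univ, if_true]
  have h0 : ∀ n ∉ Set.range D, MvPowerSeries.coeff n (pairGen i j h) * monomialAt ζ n = 0 := by
    intro n hn
    rw [coeff_pairGen, if_neg, zero_mul]
    intro hn'
    exact hn ⟨n i, hn'.symm⟩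
  refine ⟨?_, ?_⟩
  · rw [← hinj.summable_iff]
    · refine hs.congr fun k => ?_
      rw [Function.comp_apply, hval]
    · intro n hn; rw [h0 n hn, norm_zero]
  · rw [← hinj.tsum_eq (f := fun n => MvPowerSeries.coeff n (pairGen i j h) * monomialAt ζ n)]
    · exact tsum_congr hval
    · intro n hn
      by_contra hn'
      exact hn (h0 n hn')

/-- The series of the values of a linear functional on the coefficients. -/
def mapCoeff (L : 𝓔 →ₗ[ℂ] ℂ) (F : MvPowerSeries σ 𝓔) : MvPowerSeries σ ℂ :=
  fun n => L (MvPowerSeries.coeff n F)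

theorem coeff_mapCoeff (L : 𝓔 →ₗ[ℂ] ℂ) (F : MvPowerSeries σ 𝓔) (n : σ →₀ ℕ) :
    MvPowerSeries.coeff n (mapCoeff L F) = L (MvPowerSeries.coeff n F) := rfl

theorem mapCoeff_mul (L : 𝓔 →ₗ[ℂ] ℂ) (f : MvPowerSeries σ ℂ) (F : MvPowerSeries σ 𝓔) :
    mapCoeff L (MvPowerSeries.map (algebraMap ℂ 𝓔) f * F) = f * mapCoeff L F := by
  ext n
  rw [coeff_mapCoeff, MvPowerSeries.coeff_mul, MvPowerSeries.coeff_mul, map_sum]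
  refine Finset.sum_congr rfl fun p _ => ?_
  rw [MvPowerSeries.coeff_map, ← Algebra.smul_def, map_smul, coeff_mapCoeff, smul_eq_mul]

end

/-- The sum over intermediate states of the matrix elements of an ordered product of vertex
operators, given by modes `C p a * A p b` with normal ordering rule
`A p n * C q a = ∑ h p q k • (C q (a - k) * A p (n - k))`. -/
theorem tsum_ordered_product {ι : Type*} [Fintype ι] [DecidableEq ι] {𝓔 : Type*} [Ring 𝓔]
    [Algebra ℂ 𝓔] (l : List ι) (hl : l.Nodup) (hmem : ∀ p, p ∈ l) (C A : ι → ℕ → 𝓔)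
    (h : ι → ι → ℕ → ℂ)
    (hAC : l.Pairwise fun p q => ∀ n a, A p n * C q a =
      ∑ k ∈ Finset.range (min n a + 1), h p q k • (C q (a - k) * A p (n - k)))
    (L : 𝓔 →ₗ[ℂ] ℂ)
    (hL : {ab : (ι → ℕ) × (ι → ℕ) | L ((l.map fun p => C p (ab.1 p)).prod *
      (l.map fun p => A p (ab.2 p)).prod) ≠ 0}.Finite)
    (z w : ι → ℂ) (hs : l.Pairwise fun p q => Summable fun k => ‖h p q k * (w p * z q) ^ k‖) :
    ∑' ab : (ι → ℕ) × (ι → ℕ), L (l.map fun p => C p (ab.1 p) * A p (ab.2 p)).prod *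
        ((∏ p, z p ^ ab.1 p) * ∏ p, w p ^ ab.2 p) =
      pairProd (fun p q => ∑' k, h p q k * (w p * z q) ^ k) l *
        ∑' ab : (ι → ℕ) × (ι → ℕ), L ((l.map fun p => C p (ab.1 p)).prod *
          (l.map fun p => A p (ab.2 p)).prod) * ((∏ p, z p ^ ab.1 p) * ∏ p, w p ^ ab.2 p) := by
  classical
  -- Every current gets two formal variables, the left copy for its creation modes and the right
  -- copy for its annihilation modes; they are finally evaluated at `z` and `w`.
  set ζ : ι ⊕ ι → ℂ := Sum.elim z w with hζ
  set CC : ι → MvPowerSeries (ι ⊕ ι) 𝓔 := fun p => gen (Sum.inl p) (C p) with hCC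
  set AA : ι → MvPowerSeries (ι ⊕ ι) 𝓔 := fun p => gen (Sum.inr p) (A p) with hAA
  set HH : ι → ι → MvPowerSeries (ι ⊕ ι) ℂ := fun p q => pairGen (Sum.inr p) (Sum.inl q) (h p q)
    with hHH
  have hno := list_normalOrder
    ((MvPowerSeries.map (algebraMap ℂ 𝓔) : MvPowerSeries (ι ⊕ ι) ℂ →+* _) :
      MvPowerSeries (ι ⊕ ι) ℂ →* MvPowerSeries (ι ⊕ ι) 𝓔)
    (fun f F => commute_map_algebraMap f F) CC AA HH l
    (hAC.imp fun hpq => gen_mul_gen (by simp) _ _ _ hpq)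
  let e : (ι → ℕ) × (ι → ℕ) ≃ ((ι ⊕ ι) →₀ ℕ) :=
    (Equiv.sumArrowEquivProdArrow ι ι ℕ).symm.trans Finsupp.equivFunOnFinite.symm
  have he1 : ∀ ab p, e ab (Sum.inl p) = ab.1 p := fun ab p => rfl
  have he2 : ∀ ab p, e ab (Sum.inr p) = ab.2 p := fun ab p => rfl
  have hemon : ∀ ab, monomialAt ζ (e ab) = (∏ p, z p ^ ab.1 p) * ∏ p, w p ^ ab.2 p := by
    intro ab
    rw [monomialAt, Fintype.prod_sum_type]
    simp only [he1, he2, hζ, Sum.elim_inl, Sum.elim_inr]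
  have hleft : ∀ n, MvPowerSeries.coeff n (l.map fun p => CC p * AA p).prod =
      (l.map fun p => C p (n (Sum.inl p)) * A p (n (Sum.inr p))).prod := by
    intro n
    have h1 := coeff_list_prod_gen
      (l.flatMap fun p => [((Sum.inl p : ι ⊕ ι), C p), (Sum.inr p, A p)]) ?_ n
    · rw [if_pos] at h1
      · rw [List.map_flatMap, List.map_flatMap, List.flatMap_def, List.flatMap_def,
          List.prod_flatten, List.prod_flatten, List.map_map, List.map_map] at h1
        simpa [Function.comp_def] using h1
      · intro j hj
        exfalso
        apply hj
        rcases j with p | p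
        · simp [hmem]
        · simp [hmem]
    · rw [List.map_flatMap]
      simp only [List.map_cons, List.map_nil]
      rw [List.nodup_flatMap]
      refine ⟨fun p _ => by simp, hl.imp fun {p q} hpq => ?_⟩
      simp [hpq, Ne.symm hpq]
  have hright : ∀ n, MvPowerSeries.coeff n ((l.map CC).prod * (l.map AA).prod) =
      (l.map fun p => C p (n (Sum.inl p))).prod * (l.map fun p => A p (n (Sum.inr p))).prod := by
    intro n
    have h1 := coeff_list_prod_gen
      ((l.map fun p => ((Sum.inl p : ι ⊕ ι), C p)) ++ l.map fun p => (Sum.inr p, A p)) ?_ n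
    · rw [if_pos] at h1
      · simpa [Function.comp_def] using h1
      · intro j hj
        exfalso
        apply hj
        rcases j with p | p
        · simp [hmem]
        · simp [hmem]
    · rw [List.map_append, List.map_map, List.map_map, List.nodup_append]
      refine ⟨hl.map Sum.inl_injective, hl.map Sum.inr_injective, ?_⟩
      intro a ha b hb
      rw [List.mem_map] at ha hb
      obtain ⟨p, -, rfl⟩ := ha
      obtain ⟨q, -, rfl⟩ := hb
      simp
  -- Finitely many coefficients are nonzero by `hL`, so the normally ordered series converges at
  -- every point.
  have hconvN : ConvergesTo (mapCoeff L ((l.map CC).prod * (l.map AA).prod)) ζ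
      (∑' n, MvPowerSeries.coeff n (mapCoeff L ((l.map CC).prod * (l.map AA).prod))
        * monomialAt ζ n) := by
    refine ⟨?_, rfl⟩
    refine summable_of_hasFiniteSupport ?_
    refine (hL.image e).subset fun n hn => ?_
    refine ⟨e.symm n, ?_, e.apply_symm_apply n⟩
    intro h0
    apply hn
    beta_reduce
    rw [coeff_mapCoeff, hright]
    simp only [← he1, ← he2, e.apply_symm_apply] at h0
    rw [h0]; simp
  -- All contractions converge absolutely; hence so does the product of the two series, and it may
  -- be summed over all modes at once.
  have hconvH : ConvergesTo (pairProd HH l) ζ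
      (pairProd (fun p q => ∑' k, h p q k * (w p * z q) ^ k) l) := by
    refine ConvergesTo.pairProd (hs.imp fun {p q} hpq => ?_)
    exact convergesTo_pairGen (i := Sum.inr p) (j := Sum.inl q) (by simp) hpq
  have hprod := (hconvH.mul hconvN).2
  rw [← mapCoeff_mul] at hprod
  have hno' : (MvPowerSeries.map (algebraMap ℂ 𝓔)) (pairProd HH l) *
      ((l.map CC).prod * (l.map AA).prod) = (l.map fun p => CC p * AA p).prod := hno.symm
  rw [hno', ← e.tsum_eq, ← e.tsum_eq] at hprod
  simp only [coeff_mapCoeff, hleft, hright, hemon, he1, he2] at hprod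
  exact hprod

end

/-! ### The oscillators -/

section

variable {N : ℕ} (x : ℝ) (r s : ℂ)

theorem toPNat'_inj {n k : ℕ} (hn : n ≠ 0) (hk : k ≠ 0) : n.toPNat' = k.toPNat' ↔ n = k := by
  rw [← PNat.coe_inj, Nat.toPNat'_coe, Nat.toPNat'_coe, if_pos (Nat.pos_of_ne_zero hn),
    if_pos (Nat.pos_of_ne_zero hk)]

theorem beta_neg_apply (j : Fin N) {n : ℕ} (hn : n ≠ 0) (p : Osc N) :
    beta x r s j (-(n : ℤ)) p = MvPolynomial.X (j, n.toPNat') * p := by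
  have h1 : ¬ (0 : ℤ) < -(n : ℤ) := by omega
  have h2 : -(n : ℤ) < 0 := by omega
  simp only [beta, if_neg h1, if_pos h2, Int.natAbs_neg, Int.natAbs_natCast]
  rfl

theorem beta_pos_apply (j : Fin N) {n : ℕ} (hn : n ≠ 0) (p : Osc N) :
    beta x r s j (n : ℤ) p = ∑ i, oscComm x r s j i n •
      MvPolynomial.pderiv ((i, n.toPNat') : OscIndex N) p := by
  have h1 : (0 : ℤ) < (n : ℤ) := by omega
  simp only [beta, if_pos h1, Int.natAbs_natCast, LinearMap.sum_apply, LinearMap.smul_apply]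
  rfl

theorem pderiv_comm (a b : OscIndex N) (p : Osc N) :
    MvPolynomial.pderiv a (MvPolynomial.pderiv b p) =
      MvPolynomial.pderiv b (MvPolynomial.pderiv a p) := by
  have h : ⁅(MvPolynomial.pderiv a : Derivation ℂ (Osc N) (Osc N)),
      (MvPolynomial.pderiv b : Derivation ℂ (Osc N) (Osc N))⁆ = 0 := by
    refine MvPolynomial.derivation_ext fun i => ?_
    rw [Derivation.commutator_apply, MvPolynomial.pderiv_X, MvPolynomial.pderiv_X]
    simp only [Pi.single_apply]
    split_ifs <;> simp
  have h2 := congrArg (fun D : Derivation ℂ (Osc N) (Osc N) => D p) h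
  rw [Derivation.commutator_apply] at h2
  exact sub_eq_zero.mp h2

theorem commute_beta_pos (i j : Fin N) {n k : ℕ} (hn : n ≠ 0) (hk : k ≠ 0) :
    Commute (beta x r s i (n : ℤ)) (beta x r s j (k : ℤ)) := by
  refine LinearMap.ext fun p => ?_
  simp only [Module.End.mul_apply, beta_pos_apply x r s _ hn, beta_pos_apply x r s _ hk, map_sum,
    map_smul, Finset.smul_sum]
  rw [Finset.sum_comm]
  refine Finset.sum_congr rfl fun a _ => Finset.sum_congr rfl fun b _ => ?_
  rw [Derivation.map_smul, Derivation.map_smul, pderiv_comm, smul_comm]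

theorem commute_beta_neg (i j : Fin N) {n k : ℕ} (hn : n ≠ 0) (hk : k ≠ 0) :
    Commute (beta x r s i (-(n : ℤ))) (beta x r s j (-(k : ℤ))) := by
  refine LinearMap.ext fun p => ?_
  simp only [Module.End.mul_apply, beta_neg_apply x r s _ hn, beta_neg_apply x r s _ hk]
  ring

/-- The canonical commutation relations. -/
theorem beta_mul_beta (i j : Fin N) {n k : ℕ} (hn : n ≠ 0) (hk : k ≠ 0) :
    beta x r s i (n : ℤ) * beta x r s j (-(k : ℤ)) = beta x r s j (-(k : ℤ)) * beta x r s i (n : ℤ) +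
      if n = k then oscComm x r s i j n • 1 else 0 := by
  refine LinearMap.ext fun p => ?_
  simp only [LinearMap.add_apply, Module.End.mul_apply, beta_pos_apply x r s _ hn,
    beta_neg_apply x r s _ hk, Derivation.leibniz, smul_eq_mul, smul_add, Finset.sum_add_distrib,
    Finset.mul_sum, mul_smul_comm, MvPolynomial.pderiv_X, Pi.single_apply, Prod.mk.injEq]
  congr 1
  by_cases hnk : n = k
  · subst hnk
    simp [MvPolynomial.smul_eq_C_mul]
  · rw [if_neg hnk]
    refine Finset.sum_eq_zero fun a _ => ?_
    rw [if_neg]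
    · simp
    · rintro ⟨-, h⟩
      exact hnk ((toPNat'_inj hn hk).mp h.symm)

/-- The coefficient of `B_m^j` with respect to `β_m^j`. -/
def rootCoefLeft (x : ℝ) (s : ℂ) (j : Fin N) (m : ℤ) : ℂ :=
  if (j : ℕ) + 1 < N then xpow x (-(2 * s / N) * ((j : ℂ) + 1) * m) else xpow x (-(2 * s * m))

/-- The coefficient of `B_m^j` with respect to `β_m^{j+1}`. -/
def rootCoefRight (x : ℝ) (s : ℂ) (j : Fin N) (m : ℤ) : ℂ :=
  if (j : ℕ) + 1 < N then -xpow x (-(2 * s / N) * ((j : ℂ) + 1) * m) else -1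

theorem rootOsc_eq (j : Fin N) (m : ℤ) : rootOsc x r s j m =
    rootCoefLeft x s j m • beta x r s j m +
      rootCoefRight x s j m • beta x r s (finRotate N j) m := by
  unfold rootOsc rootCoefLeft rootCoefRight
  split_ifs <;> module

/-- The scalar in the commutator of `B_n^i` and `B_{-n}^j`. -/
def rootComm (x : ℝ) (r s : ℂ) (i j : Fin N) (n : ℕ) : ℂ :=
  rootCoefLeft x s i n * rootCoefLeft x s j (-n) * oscComm x r s i j n
  + rootCoefLeft x s i n * rootCoefRight x s j (-n) * oscComm x r s i (finRotate N j) n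
  + rootCoefRight x s i n * rootCoefLeft x s j (-n) * oscComm x r s (finRotate N i) j n
  + rootCoefRight x s i n * rootCoefRight x s j (-n)
    * oscComm x r s (finRotate N i) (finRotate N j) n

theorem rootOsc_mul_rootOsc (i j : Fin N) {n k : ℕ} (hn : n ≠ 0) (hk : k ≠ 0) :
    rootOsc x r s i (n : ℤ) * rootOsc x r s j (-(k : ℤ)) =
      rootOsc x r s j (-(k : ℤ)) * rootOsc x r s i (n : ℤ) +
      if n = k then rootComm x r s i j n • 1 else 0 := by
  simp only [rootOsc_eq, add_mul, mul_add, smul_mul_assoc, mul_smul_comm,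
    beta_mul_beta x r s _ _ hn hk]
  by_cases hnk : n = k
  · subst hnk
    simp only [if_true, rootComm]
    module
  · simp only [if_neg hnk]
    module

theorem commute_rootOsc_pos (i j : Fin N) {n k : ℕ} (hn : n ≠ 0) (hk : k ≠ 0) :
    Commute (rootOsc x r s i (n : ℤ)) (rootOsc x r s j (k : ℤ)) := by
  have h := fun a b => commute_beta_pos x r s (N := N) a b hn hk
  simp only [rootOsc_eq]
  exact (((h _ _).smul_left _).add_left ((h _ _).smul_left _)).smul_right _ |>.add_right
    ((((h _ _).smul_left _).add_left ((h _ _).smul_left _)).smul_right _)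

theorem commute_rootOsc_neg (i j : Fin N) {n k : ℕ} (hn : n ≠ 0) (hk : k ≠ 0) :
    Commute (rootOsc x r s i (-(n : ℤ))) (rootOsc x r s j (-(k : ℤ))) := by
  have h := fun a b => commute_beta_neg x r s (N := N) a b hn hk
  simp only [rootOsc_eq]
  exact (((h _ _).smul_left _).add_left ((h _ _).smul_left _)).smul_right _ |>.add_right
    ((((h _ _).smul_left _).add_left ((h _ _).smul_left _)).smul_right _)

/-! ### The exponents of the screening currents -/

/-- The scalar `f_m` in front of `B_m^j`. -/
def Screening.oscCoef (κ : Screening) (x : ℝ) (r : ℂ) (m : ℤ) : ℂ :=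
  match κ with
  | .F => 1
  | .E => -(bracket x (r * m) / bracket x ((r - 1) * m))

variable (κ : Screening)

theorem Screening.osc_eq (j : Fin N) (m : ℤ) :
    κ.osc x r s j m = κ.oscCoef x r m • rootOsc x r s j m := by
  cases κ
  · exact (one_smul _ _).symm
  · rfl

/-- The coefficients of the creation exponent. -/
def Screening.creExp (j : Fin N) (i : ℕ) : Module.End ℂ (Osc N) :=
  (-(i : ℂ)⁻¹) • κ.osc x r s j (-(i : ℤ))

/-- The coefficients of the annihilation exponent. -/
def Screening.annExp (j : Fin N) (i : ℕ) : Module.End ℂ (Osc N) :=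
  ((i : ℂ)⁻¹) • κ.osc x r s j (i : ℤ)

/-- The coefficients of the logarithm of the contraction of two currents. -/
def Screening.contr (i j : Fin N) (n : ℕ) : ℂ :=
  (n : ℂ)⁻¹ * (-(n : ℂ)⁻¹) * (κ.oscCoef x r n * κ.oscCoef x r (-n)) * rootComm x r s i j n

theorem Screening.annExp_mul_creExp (i j : Fin N) {n k : ℕ} (hn : n ≠ 0) (hk : k ≠ 0) :
    κ.annExp x r s i n * κ.creExp x r s j k = κ.creExp x r s j k * κ.annExp x r s i n +
      if n = k then κ.contr x r s i j n • 1 else 0 := by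
  simp only [annExp, creExp, osc_eq, smul_mul_assoc, mul_smul_comm,
    rootOsc_mul_rootOsc x r s i j hn hk]
  by_cases hnk : n = k
  · subst hnk
    simp only [if_true, contr]
    module
  · simp only [if_neg hnk]
    module

theorem Screening.commute_annExp (i j : Fin N) (n k : ℕ) :
    Commute (κ.annExp x r s i n) (κ.annExp x r s j k) := by
  rcases eq_or_ne n 0 with rfl | hn
  · simp [annExp]
  rcases eq_or_ne k 0 with rfl | hk
  · simp [annExp]
  simp only [annExp, osc_eq]
  exact (((commute_rootOsc_pos x r s i j hn hk).smul_left _).smul_left _ |>.smul_right _).smul_right _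

theorem Screening.commute_creExp (i j : Fin N) (n k : ℕ) :
    Commute (κ.creExp x r s i n) (κ.creExp x r s j k) := by
  rcases eq_or_ne n 0 with rfl | hn
  · simp [creExp]
  rcases eq_or_ne k 0 with rfl | hk
  · simp [creExp]
  simp only [creExp, osc_eq]
  exact (((commute_rootOsc_neg x r s i j hn hk).smul_left _).smul_left _ |>.smul_right _).smul_right _

/-- `expCoeff` unfolds to `expSeq` for the endomorphism algebra, so the general recursion applies.
-/
theorem Screening.creation_isExpSeq (j : Fin N) :
    IsExpSeq (κ.creExp x r s j) (κ.creation x r s j) :=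
  isExpSeq_expSeq fun a b => κ.commute_creExp x r s j j a b

theorem Screening.annihilation_isExpSeq (j : Fin N) :
    IsExpSeq (κ.annExp x r s j) (κ.annihilation x r s j) :=
  isExpSeq_expSeq fun a b => κ.commute_annExp x r s j j a b

theorem Screening.contr_isExpSeq (i j : Fin N) :
    IsExpSeq (κ.contr x r s i j) (expSeq (κ.contr x r s i j)) :=
  isExpSeq_expSeq fun _ _ => Commute.all _ _

/-- Normal ordering of the modes of two currents. -/
theorem Screening.annihilation_mul_creation (i j : Fin N) (n a : ℕ) :
    κ.annihilation x r s i n * κ.creation x r s j a =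
      ∑ k ∈ Finset.range (min n a + 1), expSeq (κ.contr x r s i j) k •
        (κ.creation x r s j (a - k) * κ.annihilation x r s i (n - k)) := by
  have h := (κ.creation_isExpSeq x r s j).normalOrder (κ.annihilation_isExpSeq x r s i)
    (κ.contr_isExpSeq x r s i j)
    (fun n k hn hk => κ.annExp_mul_creExp x r s i j hn hk) a n (n + 1) (by omega)
  rw [extZ_natCast] at h
  rw [h]
  symm
  rw [← Finset.sum_subset (Finset.range_mono (show min n a + 1 ≤ n + 1 by omega))]
  · refine Finset.sum_congr rfl fun k hk => ?_
    rw [Finset.mem_range] at hk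
    rw [extZ_natCast_sub _ (by omega), extZ_natCast_sub _ (by omega)]
  · intro k hk hk'
    rw [Finset.mem_range] at hk hk'
    rw [extZ_of_neg _ (by omega), zero_mul, smul_zero]

end

/-! ### Contractions of screening currents -/

theorem val_finRotate {N : ℕ} (j : Fin N) :
    ((finRotate N j : Fin N) : ℕ) = if (j : ℕ) + 1 < N then (j : ℕ) + 1 else 0 := by
  obtain ⟨n, rfl⟩ : ∃ n, N = n + 1 := ⟨N - 1, by have := j.pos; omega⟩
  rw [finRotate_apply]
  split_ifs with h
  · rw [Fin.val_add_one_of_lt]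
    rw [Fin.lt_def, Fin.val_last]; omega
  · have : j = Fin.last n := Fin.ext (by rw [Fin.val_last]; omega)
    rw [this, Fin.last_add_one, Fin.val_zero]

theorem finRotate_val_of_lt {N : ℕ} {j : Fin N} (h : (j : ℕ) + 1 < N) :
    ((finRotate N j : Fin N) : ℕ) = (j : ℕ) + 1 := by rw [val_finRotate, if_pos h]

theorem finRotate_val_of_not_lt {N : ℕ} {j : Fin N} (h : ¬ (j : ℕ) + 1 < N) :
    ((finRotate N j : Fin N) : ℕ) = 0 := by rw [val_finRotate, if_neg h]

theorem sub_inv_ne_zero {x : ℝ} (hx0 : 0 < x) (hx1 : x < 1) : (x : ℂ) - (x : ℂ)⁻¹ ≠ 0 := by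
  rw [← Complex.ofReal_inv, ← Complex.ofReal_sub, Complex.ofReal_ne_zero]
  have : 1 < x⁻¹ := (one_lt_inv₀ hx0).mpr hx1
  linarith

section

variable {N : ℕ} {x : ℝ} {r s : ℂ}

/-- The factor `n [(r-1)n] / [rn]`. -/
def levelFactor (x : ℝ) (r : ℂ) (n : ℕ) : ℂ := n * (bracket x ((r - 1) * n) / bracket x (r * n))

/-- The factor `[(s-1)n] / [sn]`. -/
def diagFactor (x : ℝ) (s : ℂ) (n : ℕ) : ℂ := bracket x ((s - 1) * n) / bracket x (s * n)

/-- This is `[(s-1)n] = x^{±n} [sn] - x^{±sn} [n]`. The off-diagonal commutators thus differ from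
the diagonal one by a plain power of `x`, and the common part drops out of differences of
oscillators. -/
theorem diagFactor_sub (hx0 : 0 < x) (hx1 : x < 1) {n : ℕ} (hs : bracket x (s * n) ≠ 0) :
    diagFactor x s n - xpow x n = -(bracket x n / bracket x (s * n)) * xpow x (s * n) ∧
    diagFactor x s n - (xpow x n)⁻¹ =
      -(bracket x n / bracket x (s * n)) * (xpow x (s * n))⁻¹ := by
  have hd := sub_inv_ne_zero hx0 hx1
  have hX := xpow_ne_zero x (n : ℂ)
  have hS := xpow_ne_zero x (s * n)
  have e : xpow x ((s - 1) * n) = xpow x (s * n) * (xpow x n)⁻¹ := by rw [← xpow_sub]; congr 1; ring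
  have hs' : xpow x (s * n) - (xpow x (s * n))⁻¹ ≠ 0 := by
    intro h; apply hs; rw [bracket_eq, h, zero_div]
  simp only [diagFactor, bracket_eq, e]
  generalize xpow x (s * n) = S at *
  generalize xpow x n = X at *
  generalize (x : ℂ) - (x : ℂ)⁻¹ = d at *
  have hS2 : S ^ 2 - 1 ≠ 0 := by
    intro h; apply hs'; field_simp; linear_combination h
  constructor
  · field_simp
    ring
  · field_simp
    ring

theorem oscComm_eq (hx0 : 0 < x) (hx1 : x < 1) {n : ℕ} (hs : bracket x (s * n) ≠ 0)
    (i j : Fin N) : oscComm x r s i j n = levelFactor x r n *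
      (if i = j then diagFactor x s n else if j < i then diagFactor x s n - xpow x n
        else diagFactor x s n - (xpow x n)⁻¹) := by
  obtain ⟨h1, h2⟩ := diagFactor_sub hx0 hx1 hs
  unfold oscComm levelFactor
  split_ifs with h3 h4
  · simp only [diagFactor, Int.cast_natCast]
  · rw [h1, mul_one]; simp only [Int.cast_natCast]; ring
  · rw [h2, ← xpow_neg]
    simp only [Int.cast_natCast, mul_neg_one]
    ring

/-- Needed for the last colour, where the coefficients of the two oscillators differ by `x^{-2sn}`
and the diagonal factor does not cancel by itself. -/
theorem diagFactor_rel (hx0 : 0 < x) (hx1 : x < 1) {n : ℕ} (hs : bracket x (s * n) ≠ 0) :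
    diagFactor x s n - xpow x n = xpow x (2 * s * n) * (diagFactor x s n - (xpow x n)⁻¹) := by
  obtain ⟨h1, h2⟩ := diagFactor_sub hx0 hx1 hs
  have hS := xpow_ne_zero x (s * n)
  have e : xpow x (2 * s * n) = xpow x (s * n) * xpow x (s * n) := by
    rw [← xpow_add]; congr 1; ring
  rw [h1, h2, e]
  field_simp

theorem rootCoefLeft_neg (j : Fin N) (n : ℕ) :
    rootCoefLeft x s j (-n) = (rootCoefLeft x s j n)⁻¹ := by
  unfold rootCoefLeft
  split_ifs <;> rw [← xpow_neg] <;> congr 1 <;> push_cast <;> ring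

theorem rootCoefLeft_ne_zero (j : Fin N) (m : ℤ) : rootCoefLeft x s j m ≠ 0 := by
  unfold rootCoefLeft
  split_ifs <;> exact xpow_ne_zero _ _

theorem rootCoefRight_eq (j : Fin N) (m : ℤ) : rootCoefRight x s j m =
    if (j : ℕ) + 1 < N then -rootCoefLeft x s j m else -1 := by
  unfold rootCoefRight rootCoefLeft
  split_ifs <;> rfl

/-- The deformed diagonal entry of the Cartan matrix, with `x^n + x^{-n}` in place of `2`. -/
theorem rootComm_self (hN : 3 ≤ N) (hx0 : 0 < x) (hx1 : x < 1) {n : ℕ}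
    (hs : bracket x (s * n) ≠ 0) (j : Fin N) :
    rootComm x r s j j n = levelFactor x r n * (xpow x n + (xpow x n)⁻¹) := by
  have hne := rootCoefLeft_ne_zero (x := x) (s := s) j n
  have hX := xpow_ne_zero x (n : ℂ)
  have hrel := diagFactor_rel hx0 hx1 hs
  simp only [rootComm, oscComm_eq hx0 hx1 hs, rootCoefRight_eq, rootCoefLeft_neg]
  by_cases hj : (j : ℕ) + 1 < N
  · have h1 := finRotate_val_of_lt hj
    have h2 : j ≠ finRotate N j := by rw [Ne, Fin.ext_iff]; omega
    have h3 : ¬ finRotate N j < j := by rw [Fin.lt_def]; omega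
    have h4 : j < finRotate N j := by rw [Fin.lt_def]; omega
    simp only [if_pos hj, if_true, if_neg h2, if_neg h2.symm, if_neg h3, if_pos h4]
    field_simp
    ring
  · have h1 := finRotate_val_of_not_lt hj
    have h2 : j ≠ finRotate N j := by rw [Ne, Fin.ext_iff]; omega
    have h3 : finRotate N j < j := by rw [Fin.lt_def]; omega
    have h4 : ¬ j < finRotate N j := by rw [Fin.lt_def]; omega
    simp only [if_neg hj, if_true, if_neg h2, if_neg h2.symm, if_pos h3, if_neg h4]
    have e : rootCoefLeft x s j n = (xpow x (2 * s * n))⁻¹ := by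
      rw [rootCoefLeft, if_neg hj, xpow_neg]; rfl
    have hT := xpow_ne_zero x (2 * s * n)
    rw [e, inv_inv]
    have hrel2 : (xpow x (2 * s * n))⁻¹ * (diagFactor x s n - xpow x n) =
        diagFactor x s n - (xpow x n)⁻¹ := by rw [hrel]; field_simp
    linear_combination (norm := skip) levelFactor x r n * hrel - levelFactor x r n * hrel2
    field_simp
    ring

/-- The diagonal factors cancel and one term `x^{-n}` survives. The ratio of the two normalizations
is `x^{2sn/N}` also when the second colour is the last one, since `x^{-2sn}` continues the pattern
of exponents. -/
theorem rootComm_adj (hN : 3 ≤ N) (hx0 : 0 < x) (hx1 : x < 1) {n : ℕ}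
    (hs : bracket x (s * n) ≠ 0) {j : Fin N} (hj : (j : ℕ) + 1 < N) :
    rootComm x r s j (finRotate N j) n =
      -(levelFactor x r n * (xpow x (2 * s / N * n) * (xpow x n)⁻¹)) := by
  have hne := rootCoefLeft_ne_zero (x := x) (s := s) j n
  have hne2 := rootCoefLeft_ne_zero (x := x) (s := s) (finRotate N j) n
  have hN0 : (N : ℂ) ≠ 0 := by exact_mod_cast (show N ≠ 0 by omega)
  have hX := xpow_ne_zero x (n : ℂ)
  have h1 := finRotate_val_of_lt hj
  have key : rootCoefLeft x s j n * (rootCoefLeft x s (finRotate N j) n)⁻¹ =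
      xpow x (2 * s / N * n) := by
    rw [← rootCoefLeft_neg]
    unfold rootCoefLeft
    rw [if_pos hj, h1]
    split_ifs with h
    · rw [← xpow_add]; congr 1; push_cast; ring
    · have hjN : (N : ℂ) = (j : ℂ) + 2 := by
        have : N = (j : ℕ) + 2 := by omega
        exact_mod_cast this
      rw [← xpow_add]; congr 1; push_cast
      field_simp
      rw [hjN]; ring
  rw [← key]
  simp only [rootComm, oscComm_eq hx0 hx1 hs, rootCoefRight_eq, rootCoefLeft_neg]
  have a1 : j ≠ finRotate N j := by rw [Ne, Fin.ext_iff]; omega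
  have a2 : ¬ finRotate N j < j := by rw [Fin.lt_def]; omega
  by_cases hj2 : ((finRotate N j : Fin N) : ℕ) + 1 < N
  · have h2 := finRotate_val_of_lt hj2
    have b1 : j ≠ finRotate N (finRotate N j) := by rw [Ne, Fin.ext_iff]; omega
    have b2 : ¬ finRotate N (finRotate N j) < j := by rw [Fin.lt_def]; omega
    have b3 : finRotate N j ≠ finRotate N (finRotate N j) := by rw [Ne, Fin.ext_iff]; omega
    have b4 : ¬ finRotate N (finRotate N j) < finRotate N j := by rw [Fin.lt_def]; omega
    simp only [if_pos hj, if_pos hj2, if_neg a1, if_neg a2, if_neg b1, if_neg b2, if_neg b3,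
      if_neg b4, if_true]
    field_simp
    ring
  · have h2 := finRotate_val_of_not_lt hj2
    have b1 : j ≠ finRotate N (finRotate N j) := by rw [Ne, Fin.ext_iff]; omega
    have b2 : finRotate N (finRotate N j) < j := by rw [Fin.lt_def]; omega
    have b3 : finRotate N j ≠ finRotate N (finRotate N j) := by rw [Ne, Fin.ext_iff]; omega
    have b4 : finRotate N (finRotate N j) < finRotate N j := by rw [Fin.lt_def]; omega
    simp only [if_pos hj, if_neg hj2, if_neg a1, if_neg a2, if_neg b1, if_pos b2, if_neg b3,
      if_pos b4, if_true]
    field_simp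
    ring

/-- In the operator product the first colour precedes the last. The commutator is therefore taken in
the order opposite to the cyclic one, and the inverse of the power in `rootComm_adj` appears. -/
theorem rootComm_wrap (hN : 3 ≤ N) (hx0 : 0 < x) (hx1 : x < 1) {n : ℕ}
    (hs : bracket x (s * n) ≠ 0) {j : Fin N} (hj : ¬ (j : ℕ) + 1 < N) :
    rootComm x r s (finRotate N j) j n =
      -(levelFactor x r n * ((xpow x (2 * s / N * n))⁻¹ * xpow x n)) := by
  have hN0 : (N : ℂ) ≠ 0 := by exact_mod_cast (show N ≠ 0 by omega)
  have hX := xpow_ne_zero x (n : ℂ)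
  have hrel := diagFactor_rel hx0 hx1 hs
  have h1 := finRotate_val_of_not_lt hj
  have hj0 : ((finRotate N j : Fin N) : ℕ) + 1 < N := by omega
  have h2 := finRotate_val_of_lt hj0
  have e0 : rootCoefLeft x s (finRotate N j) n = (xpow x (2 * s / N * n))⁻¹ := by
    rw [rootCoefLeft, if_pos hj0, ← xpow_neg, h1]; congr 1; push_cast; ring
  have e1 : rootCoefLeft x s j n = (xpow x (2 * s * n))⁻¹ := by
      rw [rootCoefLeft, if_neg hj, xpow_neg]; rfl
  simp only [rootComm, oscComm_eq hx0 hx1 hs, rootCoefRight_eq, rootCoefLeft_neg]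
  have a1 : finRotate N j ≠ j := by rw [Ne, Fin.ext_iff]; omega
  have a2 : ¬ j < finRotate N j := by rw [Fin.lt_def]; omega
  have b1 : finRotate N (finRotate N j) ≠ j := by rw [Ne, Fin.ext_iff]; omega
  have b2 : ¬ j < finRotate N (finRotate N j) := by rw [Fin.lt_def]; omega
  have b3 : finRotate N (finRotate N j) ≠ finRotate N j := by rw [Ne, Fin.ext_iff]; omega
  have b4 : finRotate N j < finRotate N (finRotate N j) := by rw [Fin.lt_def]; omega
  simp only [if_pos hj0, if_neg hj, if_neg a1, if_neg a2, if_neg b1, if_neg b2, if_neg b3,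
      if_pos b4, if_true, e0, e1, inv_inv]
  ring

/-- Both oscillators of colour `i` lie on the same side of each oscillator of colour `j`, so their
contributions cancel. -/
theorem rootComm_far (hx0 : 0 < x) (hx1 : x < 1) {n : ℕ}
    (hs : bracket x (s * n) ≠ 0) {i j : Fin N} (hij : i < j) (h1 : (i : ℕ) + 1 ≠ j)
    (h2 : ¬ ((i : ℕ) = 0 ∧ (j : ℕ) + 1 = N)) : rootComm x r s i j n = 0 := by
  rw [Fin.lt_def] at hij
  have hi : (i : ℕ) + 1 < N := by have := j.isLt; omega
  have e1 := finRotate_val_of_lt hi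
  simp only [rootComm, oscComm_eq hx0 hx1 hs, rootCoefRight_eq, rootCoefLeft_neg]
  have a1 : i ≠ j := by rw [Ne, Fin.ext_iff]; omega
  have a2 : ¬ j < i := by rw [Fin.lt_def]; omega
  have a3 : finRotate N i ≠ j := by rw [Ne, Fin.ext_iff]; omega
  have a4 : ¬ j < finRotate N i := by rw [Fin.lt_def]; omega
  by_cases hj : (j : ℕ) + 1 < N
  · have e2 := finRotate_val_of_lt hj
    have b1 : i ≠ finRotate N j := by rw [Ne, Fin.ext_iff]; omega
    have b2 : ¬ finRotate N j < i := by rw [Fin.lt_def]; omega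
    have b3 : finRotate N i ≠ finRotate N j := by rw [Ne, Fin.ext_iff]; omega
    have b4 : ¬ finRotate N j < finRotate N i := by rw [Fin.lt_def]; omega
    simp only [if_pos hi, if_pos hj, if_neg a1, if_neg a2, if_neg a3, if_neg a4, if_neg b1,
      if_neg b2, if_neg b3, if_neg b4]
    ring
  · have e2 := finRotate_val_of_not_lt hj
    have b1 : i ≠ finRotate N j := by
      rw [Ne, Fin.ext_iff]; have := j.isLt; omega
    have b2 : finRotate N j < i := by rw [Fin.lt_def]; have := j.isLt; omega
    have b3 : finRotate N i ≠ finRotate N j := by rw [Ne, Fin.ext_iff]; omega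
    have b4 : finRotate N j < finRotate N i := by rw [Fin.lt_def]; omega
    simp only [if_pos hi, if_neg hj, if_neg a1, if_neg a2, if_neg a3, if_neg a4, if_neg b1,
      if_pos b2, if_neg b3, if_pos b4]
    ring

end

/-! ### From commutators to infinite products -/

theorem logCoeff_mul_pow (q z y : ℂ) (n : ℕ) : logCoeff q z n * y ^ n = logCoeff q (z * y) n := by
  rw [logCoeff, logCoeff, mul_pow]; ring

/-- The exponential of a combination of the series `∑ z ^ n y ^ n / (n (1 - q ^ n))`. -/
theorem tsum_expSeq_logCoeff {q a b c d y : ℂ} (hq : ‖q‖ < 1) (ha : ‖a * y‖ < 1) (hb : ‖b * y‖ < 1)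
    (hc : ‖c * y‖ < 1) (hd : ‖d * y‖ < 1) {l : ℕ → ℂ}
    (hl : ∀ n, l n = logCoeff q a n + logCoeff q b n - logCoeff q c n - logCoeff q d n) :
    (Summable fun k => ‖expSeq l k * y ^ k‖) ∧
      (∑' k, expSeq l k * y ^ k) * (qPoch (a * y) q * qPoch (b * y) q) =
        qPoch (c * y) q * qPoch (d * y) q := by
  have sa := summable_norm_logCoeff hq ha
  have sb := summable_norm_logCoeff hq hb
  have sc := summable_norm_logCoeff hq hc
  have sd := summable_norm_logCoeff hq hd
  have e : ∀ n, l n * y ^ n = logCoeff q (a * y) n + logCoeff q (b * y) n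
      - logCoeff q (c * y) n - logCoeff q (d * y) n := by
    intro n
    rw [hl]
    simp only [← logCoeff_mul_pow]
    ring
  have hs : Summable fun n => ‖l n * y ^ n‖ := by
    simp_rw [e]
    refine Summable.of_nonneg_of_le (fun _ => norm_nonneg _) (fun n => ?_)
      (((sa.add sb).add sc).add sd)
    exact (norm_sub_le _ _).trans (add_le_add_left ((norm_sub_le _ _).trans
      (add_le_add_left (norm_add_le _ _) _)) _)
  have h0 : l 0 = 0 := by rw [hl]; simp [logCoeff]
  obtain ⟨h1, h2⟩ := hasSum_expSeq h0 hs
  refine ⟨h1, ?_⟩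
  rw [h2, qPoch_eq_exp hq ha, qPoch_eq_exp hq hb, qPoch_eq_exp hq hc, qPoch_eq_exp hq hd]
  simp_rw [e]
  rw [((sa.of_norm.add sb.of_norm).sub sc.of_norm).tsum_sub sd.of_norm,
    (sa.of_norm.add sb.of_norm).tsum_sub sc.of_norm, sa.of_norm.tsum_add sb.of_norm,
    ← Complex.exp_add, ← Complex.exp_add, ← Complex.exp_add]
  congr 1; ring

section

variable {N : ℕ} {x : ℝ} {r s : ℂ} (κ : Screening)

theorem xpow_ne_one {x : ℝ} (hx0 : 0 < x) (hx1 : x < 1) {a : ℂ} (ha : a.re ≠ 0) : xpow x a ≠ 1 := by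
  intro h
  have h1 : ‖xpow x a‖ = 1 := by rw [h, norm_one]
  rw [norm_xpow, Real.exp_eq_one_iff, mul_eq_zero] at h1
  rcases h1 with h1 | h1
  · exact ha h1
  · exact (Real.log_neg hx0 hx1).ne h1

theorem bracket_ne_zero (hx0 : 0 < x) (hx1 : x < 1) {a : ℂ} (ha : a.re ≠ 0) : bracket x a ≠ 0 := by
  rw [bracket_eq]
  refine div_ne_zero ?_ (sub_inv_ne_zero hx0 hx1)
  intro h
  have h1 : xpow x (2 * a) = 1 := by
    rw [two_mul, xpow_add]
    nth_rewrite 1 [sub_eq_zero.mp h]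
    exact inv_mul_cancel₀ (xpow_ne_zero _ _)
  refine xpow_ne_one hx0 hx1 ?_ h1
  simpa using ha

theorem bracket_mul_nat_ne_zero (hx0 : 0 < x) (hx1 : x < 1) {a : ℂ} (ha : a.re ≠ 0) {n : ℕ}
    (hn : n ≠ 0) : bracket x (a * n) ≠ 0 := by
  refine bracket_ne_zero hx0 hx1 ?_
  rw [Complex.mul_re]
  simpa using ⟨ha, hn⟩

/-- `1` or `-1`, according to the regime. -/
def Screening.sign (r : ℂ) : ℂ := 2 * κ.regime r - 1

theorem Screening.nome_re (hκ : (κ.level r).re ≠ 0) : 0 < (κ.nome r).re := by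
  unfold nome
  split_ifs with h
  · exact h
  · rw [Complex.neg_re]
    rcases lt_or_gt_of_ne hκ with h' | h'
    · linarith
    · exact absurd h' h

theorem Screening.sign_mul_nome : κ.sign r * κ.nome r = κ.level r := by
  unfold sign nome regime
  split_ifs <;> ring

theorem Screening.sign_sq : κ.sign r ^ 2 = 1 := by
  unfold sign regime
  split_ifs <;> norm_num

theorem bracket_neg (a : ℂ) : bracket x (-a) = -bracket x a := by
  unfold bracket; rw [neg_neg]; ring

/-- One formula for both families and both regimes: the base `x^{2R}` always has modulus less than
one, and only the sign of the exponent `n` remembers the regime. -/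
theorem Screening.contr_factor (hx0 : 0 < x) (hx1 : x < 1) (hκ : (κ.level r).re ≠ 0) {n : ℕ}
    (hn : n ≠ 0) (hr : bracket x (r * n) ≠ 0) :
    κ.oscCoef x r n * κ.oscCoef x r (-n) * levelFactor x r n =
      n * ((xpow x (κ.sign r * n) - xpow x (2 * κ.nome r) ^ n * (xpow x (κ.sign r * n))⁻¹) /
        (1 - xpow x (2 * κ.nome r) ^ n)) := by
  have hd := sub_inv_ne_zero hx0 hx1
  have hX := xpow_ne_zero x (n : ℂ)
  have hY := xpow_ne_zero x (κ.level r * n)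
  have hYb : bracket x (κ.level r * n) ≠ 0 := bracket_mul_nat_ne_zero hx0 hx1 hκ hn
  have hY' : xpow x (κ.level r * n) - (xpow x (κ.level r * n))⁻¹ ≠ 0 := by
    intro h; apply hYb; rw [bracket_eq, h, zero_div]
  have hq := one_sub_pow_ne_zero (norm_nome_lt_one hx0 hx1 (κ.nome_re hκ)) hn
  -- For both families the left-hand side is `n [(ℓ-1)n] / [ℓn]`, where `ℓ` is `κ.level r`; for `E`
  -- the two scalars `f_n`, `f_{-n}` invert the ratio of brackets.
  have step1 : κ.oscCoef x r n * κ.oscCoef x r (-n) * levelFactor x r n =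
      n * ((xpow x (κ.level r * n) * (xpow x n)⁻¹ - (xpow x (κ.level r * n))⁻¹ * xpow x n) /
        (xpow x (κ.level r * n) - (xpow x (κ.level r * n))⁻¹)) := by
    cases κ
    · simp only [oscCoef, levelFactor, level, one_mul]
      have e : xpow x ((r - 1) * n) = xpow x (r * n) * (xpow x n)⁻¹ := by
        rw [← xpow_sub]; congr 1; ring
      simp only [level] at hY'
      rw [bracket_eq, bracket_eq, e, mul_inv, inv_inv, div_div_div_cancel_right₀ hd]
    · simp only [oscCoef, levelFactor, level]
      simp only [level] at hY hY' hYb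
      have e0 : (r - 1) * (n : ℂ) = -((1 - r) * n) := by ring
      have e1 : xpow x (r * n) = (xpow x ((1 - r) * n))⁻¹ * xpow x n := by
        rw [← xpow_neg, ← xpow_add]; congr 1; ring
      have e2 : bracket x (r * n) = (((xpow x ((1 - r) * n))⁻¹ * xpow x n) -
        xpow x ((1 - r) * n) * (xpow x n)⁻¹) / ((x : ℂ) - (x : ℂ)⁻¹) := by
        rw [bracket_eq, e1, mul_inv, inv_inv]
      have f1 : bracket x ((r - 1) * n) = -bracket x ((1 - r) * n) := by rw [e0, bracket_neg]
      have f2 : bracket x (r * -n) = -bracket x (r * n) := by rw [mul_neg, bracket_neg]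
      have f3 : bracket x ((r - 1) * -n) = bracket x ((1 - r) * n) := by
        rw [mul_neg, bracket_neg, f1, neg_neg]
      push_cast
      rw [f1, f2, f3]
      have f4 : -(bracket x (r * n) / -bracket x ((1 - r) * n)) *
          -(-bracket x (r * n) / bracket x ((1 - r) * n)) *
          (n * (-bracket x ((1 - r) * n) / bracket x (r * n))) =
          n * (-(bracket x (r * n) / bracket x ((1 - r) * n))) := by
        field_simp
      rw [f4, e2, bracket_eq x ((1 - r) * n), div_div_div_cancel_right₀ hd]
      ring
  rw [step1]
  congr 1
  rw [← xpow_mul_nat] at hq ⊢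
  unfold sign nome regime at *
  split_ifs at * with h
  · have e1 : xpow x (2 * κ.level r * n) = xpow x (κ.level r * n) * xpow x (κ.level r * n) := by
      rw [← xpow_add]; congr 1; ring
    have e2 : (2 * 1 - 1) * (n : ℂ) = n := by ring
    rw [e1] at hq ⊢
    rw [e2, div_eq_div_iff hY' hq]
    field_simp
    ring
  · have e1 : xpow x (2 * -κ.level r * n) =
        (xpow x (κ.level r * n))⁻¹ * (xpow x (κ.level r * n))⁻¹ := by
      rw [← xpow_neg, ← xpow_add]; congr 1; ring
    have e2 : (2 * 0 - 1) * (n : ℂ) = -n := by ring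
    rw [e1] at hq ⊢
    rw [e2, div_eq_div_iff hY' hq, xpow_neg]
    field_simp

theorem Screening.contr_of_rootComm (hx0 : 0 < x) (hx1 : x < 1) (hκ : (κ.level r).re ≠ 0) {n : ℕ}
    (hn : n ≠ 0) (hr : bracket x (r * n) ≠ 0) {i j : Fin N} {M : ℂ}
    (hM : rootComm x r s i j n = levelFactor x r n * M) :
    κ.contr x r s i j n = -(M * (xpow x (κ.sign r * n)
        - xpow x (2 * κ.nome r) ^ n * (xpow x (κ.sign r * n))⁻¹)) /
        (n * (1 - xpow x (2 * κ.nome r) ^ n)) := by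
  have hn' : (n : ℂ) ≠ 0 := by exact_mod_cast hn
  have hq := one_sub_pow_ne_zero (norm_nome_lt_one hx0 hx1 (κ.nome_re hκ)) hn
  have h := κ.contr_factor hx0 hx1 hκ hn hr
  rw [contr, hM]
  calc _ = -((n : ℂ)⁻¹ * (n : ℂ)⁻¹ * M *
        (κ.oscCoef x r n * κ.oscCoef x r (-n) * levelFactor x r n)) := by ring
    _ = _ := by
      rw [h]; field_simp

theorem Screening.contr_zero (i j : Fin N) : κ.contr x r s i j 0 = 0 := by simp [contr]

/-- With `X = x^{σn}` the coefficient is governed by `(X + X⁻¹)(X - qⁿX⁻¹)`; its four monomials are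
the four infinite products in the contraction. -/
theorem Screening.contr_self (hN : 3 ≤ N) (hx0 : 0 < x) (hx1 : x < 1) (hκ : (κ.level r).re ≠ 0)
    (hr : ∀ n : ℕ, 1 ≤ n → bracket x (r * n) ≠ 0) (hs : s.re ≠ 0) (j : Fin N) (n : ℕ) :
    κ.contr x r s j j n = logCoeff (xpow x (2 * κ.nome r)) (xpow x (2 * κ.nome r)) n
      + logCoeff (xpow x (2 * κ.nome r)) (xpow x (2 * κ.nome r) * xpow x (-2 * κ.sign r)) n
      - logCoeff (xpow x (2 * κ.nome r)) 1 n
      - logCoeff (xpow x (2 * κ.nome r)) (xpow x (2 * κ.sign r)) n := by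
  rcases Nat.eq_zero_or_pos n with rfl | hpos
  · simp [contr_zero, logCoeff]
  have hn := hpos.ne'
  have hsn := bracket_mul_nat_ne_zero hx0 hx1 hs hn
  rw [κ.contr_of_rootComm hx0 hx1 hκ hn (hr n hpos) (rootComm_self hN hx0 hx1 hsn j)]
  have e1 : xpow x (2 * κ.sign r) ^ n = xpow x (κ.sign r * n) * xpow x (κ.sign r * n) := by
    rw [← xpow_mul_nat, ← xpow_add]; congr 1; ring
  have e2 : xpow x (-2 * κ.sign r) ^ n =
      (xpow x (κ.sign r * n))⁻¹ * (xpow x (κ.sign r * n))⁻¹ := by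
    rw [← xpow_neg, ← xpow_mul_nat, ← xpow_add]; congr 1; ring
  -- The Cartan entry is even in `n`, so the sign of the regime may be inserted.
  have e3 : xpow x n + (xpow x n)⁻¹ = xpow x (κ.sign r * n) + (xpow x (κ.sign r * n))⁻¹ := by
    rw [← xpow_neg, ← xpow_neg]
    unfold sign regime
    split_ifs
    · congr 2 <;> ring
    · rw [add_comm]; congr 2 <;> ring
  rw [e3]
  simp only [logCoeff, mul_pow, one_pow, e1, e2, ← add_div, ← sub_div]
  have hX := xpow_ne_zero x (κ.sign r * n)
  congr 1
  field_simp
  ring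

/-- Here the Cartan entry is one monomial, so one product remains in the numerator and one in the
denominator. The exponents combine by `2A = 2s/N - 1 + σ` and `2B = 2s/N - 1 - σ`. -/
theorem Screening.contr_adj (hN : 3 ≤ N) (hx0 : 0 < x) (hx1 : x < 1) (hκ : (κ.level r).re ≠ 0)
    (hr : ∀ n : ℕ, 1 ≤ n → bracket x (r * n) ≠ 0) (hs : s.re ≠ 0) {j : Fin N}
    (hj : (j : ℕ) + 1 < N) (n : ℕ) :
    κ.contr x r s j (finRotate N j) n =
      logCoeff (xpow x (2 * κ.nome r)) (xpow x (2 * κ.innerExp N r s)) n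
      - logCoeff (xpow x (2 * κ.nome r))
        (xpow x (2 * κ.nome r) * xpow x (2 * κ.outerExp N r s)) n := by
  rcases Nat.eq_zero_or_pos n with rfl | hpos
  · simp [contr_zero, logCoeff]
  have hn := hpos.ne'
  have hsn := bracket_mul_nat_ne_zero hx0 hx1 hs hn
  rw [κ.contr_of_rootComm (M := -(xpow x (2 * s / N * n) * (xpow x n)⁻¹)) hx0 hx1 hκ hn (hr n hpos)
    (by rw [rootComm_adj hN hx0 hx1 hsn hj]; ring)]
  have e1 : xpow x (2 * κ.innerExp N r s) ^ n =
      xpow x (2 * s / N * n) * (xpow x n)⁻¹ * xpow x (κ.sign r * n) := by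
    rw [← xpow_mul_nat, ← xpow_neg, ← xpow_add, ← xpow_add]; congr 1
    unfold innerExp sign; ring
  have e2 : xpow x (2 * κ.outerExp N r s) ^ n =
      xpow x (2 * s / N * n) * (xpow x n)⁻¹ * (xpow x (κ.sign r * n))⁻¹ := by
    rw [← xpow_mul_nat, ← xpow_neg, ← xpow_neg, ← xpow_add, ← xpow_add]; congr 1
    unfold outerExp sign; ring
  simp only [logCoeff, mul_pow, e1, e2, ← sub_div]
  congr 1
  ring

/-- Inverting the monomial exchanges the roles of `A` and `B` and reverses their signs. -/
theorem Screening.contr_wrap (hN : 3 ≤ N) (hx0 : 0 < x) (hx1 : x < 1) (hκ : (κ.level r).re ≠ 0)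
    (hr : ∀ n : ℕ, 1 ≤ n → bracket x (r * n) ≠ 0) (hs : s.re ≠ 0) {j : Fin N}
    (hj : ¬ (j : ℕ) + 1 < N) (n : ℕ) :
    κ.contr x r s (finRotate N j) j n =
      logCoeff (xpow x (2 * κ.nome r)) (xpow x (-2 * κ.outerExp N r s)) n
      - logCoeff (xpow x (2 * κ.nome r))
        (xpow x (2 * κ.nome r) * xpow x (-2 * κ.innerExp N r s)) n := by
  rcases Nat.eq_zero_or_pos n with rfl | hpos
  · simp [contr_zero, logCoeff]
  have hn := hpos.ne'
  have hsn := bracket_mul_nat_ne_zero hx0 hx1 hs hn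
  rw [κ.contr_of_rootComm (M := -((xpow x (2 * s / N * n))⁻¹ * xpow x n)) hx0 hx1 hκ hn (hr n hpos)
    (by rw [rootComm_wrap hN hx0 hx1 hsn hj]; ring)]
  have e1 : xpow x (-2 * κ.innerExp N r s) ^ n =
      (xpow x (2 * s / N * n))⁻¹ * xpow x n * (xpow x (κ.sign r * n))⁻¹ := by
    rw [← xpow_mul_nat, ← xpow_neg, ← xpow_neg, ← xpow_add, ← xpow_add]; congr 1
    unfold innerExp sign; ring
  have e2 : xpow x (-2 * κ.outerExp N r s) ^ n =
      (xpow x (2 * s / N * n))⁻¹ * xpow x n * xpow x (κ.sign r * n) := by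
    rw [← xpow_mul_nat, ← xpow_neg, ← xpow_add, ← xpow_add]; congr 1
    unfold outerExp sign; ring
  simp only [logCoeff, mul_pow, e1, e2, ← sub_div]
  congr 1
  ring

theorem Screening.contr_far (hx0 : 0 < x) (hx1 : x < 1) (hs : s.re ≠ 0) {i j : Fin N}
    (hij : i < j) (h1 : (i : ℕ) + 1 ≠ j) (h2 : ¬ ((i : ℕ) = 0 ∧ (j : ℕ) + 1 = N)) (n : ℕ) :
    κ.contr x r s i j n = 0 := by
  rcases Nat.eq_zero_or_pos n with rfl | hpos
  · exact κ.contr_zero i j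
  rw [contr, rootComm_far hx0 hx1 (bracket_mul_nat_ne_zero hx0 hx1 hs hpos.ne') hij h1 h2, mul_zero]

end

/-! ### The grading by the energy -/

section

variable {N : ℕ}

/-- The energy `n` of `β_{-n}^j`. -/
def energy (p : OscIndex N) : ℤ := (p.2 : ℕ)

/-- Operators that shift the energy by `k`. -/
def Shifts (k : ℤ) (T : Module.End ℂ (Osc N)) : Prop :=
  ∀ p d, MvPolynomial.IsWeightedHomogeneous energy p d →
    MvPolynomial.IsWeightedHomogeneous energy (T p) (d + k)

theorem Shifts.add {k : ℤ} {S T : Module.End ℂ (Osc N)} (hS : Shifts k S) (hT : Shifts k T) :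
    Shifts k (S + T) := fun p d hp => (hS p d hp).add (hT p d hp)

theorem Shifts.smul {k : ℤ} {T : Module.End ℂ (Osc N)} (hT : Shifts k T) (c : ℂ) :
    Shifts k (c • T) := fun p d hp =>
  (MvPolynomial.weightedHomogeneousSubmodule ℂ energy (d + k)).smul_mem c (hT p d hp)

theorem shifts_zero (k : ℤ) : Shifts k (0 : Module.End ℂ (Osc N)) := fun _ d _ =>
  (MvPolynomial.weightedHomogeneousSubmodule ℂ energy (d + k)).zero_mem

theorem Shifts.sum {k : ℤ} {ι : Type*} (s : Finset ι) {T : ι → Module.End ℂ (Osc N)}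
    (hT : ∀ i ∈ s, Shifts k (T i)) : Shifts k (∑ i ∈ s, T i) := by
  classical
  induction s using Finset.induction_on with
  | empty => exact shifts_zero k
  | insert a s ha ih =>
    rw [Finset.sum_insert ha]
    exact (hT a (Finset.mem_insert_self _ _)).add
      (ih fun i hi => hT i (Finset.mem_insert_of_mem hi))

theorem shifts_one : Shifts 0 (1 : Module.End ℂ (Osc N)) := fun p d hp => by
  rw [add_zero]; exact hp

theorem Shifts.mul {k l : ℤ} {S T : Module.End ℂ (Osc N)} (hS : Shifts k S) (hT : Shifts l T) :
    Shifts (k + l) (S * T) := fun p d hp => by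
  have := hS _ _ (hT p d hp)
  rwa [add_assoc, add_comm l k] at this

theorem Shifts.list_prod {ι : Type*} (l : List ι) {k : ι → ℤ} {T : ι → Module.End ℂ (Osc N)}
    (hT : ∀ i, Shifts (k i) (T i)) : Shifts (l.map k).sum (l.map T).prod := by
  induction l with
  | nil => exact shifts_one
  | cons a l ih =>
    rw [List.map_cons, List.map_cons, List.sum_cons, List.prod_cons]
    exact (hT a).mul ih

theorem Shifts.expSeq {A E : ℕ → Module.End ℂ (Osc N)} (h : IsExpSeq A E) (ε : ℤ)
    (hA : ∀ n : ℕ, Shifts (ε * n) (A n)) (n : ℕ) : Shifts (ε * n) (E n) := by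
  induction n using Nat.strong_induction_on with
  | _ n ih =>
    rcases Nat.eq_zero_or_pos n with rfl | hn
    · rw [h.1, Nat.cast_zero, mul_zero]; exact shifts_one
    · have hn' : (n : ℂ) ≠ 0 := by exact_mod_cast hn.ne'
      have h1 : E n = (n : ℂ)⁻¹ • ((n : ℂ) • E n) := by
        rw [smul_smul, inv_mul_cancel₀ hn', one_smul]
      rw [h1, h.2]
      refine (Shifts.sum _ fun p hp => ?_).smul _
      rw [Finset.HasAntidiagonal.mem_antidiagonal] at hp
      rcases Nat.eq_zero_or_pos p.1 with h0 | h0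
      · rw [h0, Nat.cast_zero, zero_smul]; exact shifts_zero _
      · have := ((hA p.1).mul (ih p.2 (by omega))).smul (p.1 : ℂ)
        rwa [← mul_add, ← Nat.cast_add, hp] at this

variable (x : ℝ) (r s : ℂ) (κ : Screening)

theorem shifts_beta (j : Fin N) (m : ℤ) : Shifts (-m) (beta x r s j m) := by
  rcases lt_trichotomy m 0 with hm | rfl | hm
  · obtain ⟨n, rfl⟩ : ∃ n : ℕ, m = -(n : ℤ) := ⟨m.natAbs, by omega⟩
    have hn : n ≠ 0 := by omega
    intro p d hp
    rw [beta_neg_apply x r s j hn, neg_neg, add_comm]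
    have h1 := MvPolynomial.isWeightedHomogeneous_X ℂ (energy (N := N)) (j, n.toPNat')
    have h2 : energy (N := N) (j, n.toPNat') = n := by
      simp [energy, Nat.toPNat'_coe, Nat.pos_of_ne_zero hn]
    rw [h2] at h1
    exact h1.mul hp
  · simp only [beta, lt_irrefl, if_false]; exact shifts_zero _
  · obtain ⟨n, rfl⟩ : ∃ n : ℕ, m = (n : ℤ) := ⟨m.natAbs, by omega⟩
    have hn : n ≠ 0 := by omega
    intro p d hp
    rw [beta_pos_apply x r s j hn]
    refine (MvPolynomial.weightedHomogeneousSubmodule ℂ energy (d + -n)).sum_mem fun i _ => ?_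
    refine Submodule.smul_mem _ _ ?_
    have h2 : energy (N := N) (i, n.toPNat') = n := by
      simp [energy, Nat.toPNat'_coe, Nat.pos_of_ne_zero hn]
    exact hp.pderiv (by rw [h2]; ring)

theorem shifts_osc (j : Fin N) (m : ℤ) : Shifts (-m) (κ.osc x r s j m) := by
  rw [κ.osc_eq, rootOsc_eq]
  exact (((shifts_beta x r s _ m).smul _).add ((shifts_beta x r s _ m).smul _)).smul _

theorem shifts_creation (j : Fin N) (n : ℕ) : Shifts (n : ℤ) (κ.creation x r s j n) := by
  have := Shifts.expSeq (κ.creation_isExpSeq x r s j) 1 (fun n => ?_) n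
  · rwa [one_mul] at this
  · have h := (shifts_osc x r s κ j (-(n : ℤ))).smul (-(n : ℂ)⁻¹)
    rw [neg_neg] at h
    rw [one_mul]
    exact h

theorem shifts_annihilation (j : Fin N) (n : ℕ) :
    Shifts (-(n : ℤ)) (κ.annihilation x r s j n) := by
  have := Shifts.expSeq (κ.annihilation_isExpSeq x r s j) (-1) (fun n => ?_) n
  · rwa [neg_one_mul] at this
  · have h := (shifts_osc x r s κ j (n : ℤ)).smul ((n : ℂ)⁻¹)
    rw [neg_one_mul]
    exact h

theorem weight_energy_nonneg (μ : OscIndex N →₀ ℕ) : 0 ≤ Finsupp.weight energy μ := by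
  rw [Finsupp.weight_apply]
  exact Finsupp.sum_nonneg fun p _ => by simp [energy]

/-- The normally ordered product of modes of screening currents. -/
def Screening.normalProduct {m : ℕ} (l : List (Fin N × Fin m)) (a b : Fin N × Fin m → ℕ) :
    Module.End ℂ (Osc N) :=
  (l.map fun p => κ.creation x r s p.1 (a p)).prod *
    (l.map fun p => κ.annihilation x r s p.1 (b p)).prod

/-- The matrix element of an operator on polynomials. -/
def oscElement (ν μ : OscIndex N →₀ ℕ) : Module.End ℂ (Osc N) →ₗ[ℂ] ℂ where
  toFun T := MvPolynomial.coeff ν (T (MvPolynomial.monomial μ 1))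
  map_add' S T := by simp
  map_smul' c T := by simp

/-- The annihilation modes can remove at most the energy of `μ`, and the creation modes can add at
most the energy of `ν`. -/
theorem finite_normalProduct {m : ℕ} (l : List (Fin N × Fin m)) (hmem : ∀ p, p ∈ l)
    (ν μ : OscIndex N →₀ ℕ) :
    {ab : (Fin N × Fin m → ℕ) × (Fin N × Fin m → ℕ) |
      oscElement ν μ (κ.normalProduct x r s l ab.1 ab.2) ≠ 0}.Finite := by
  refine ((Set.finite_Iic (fun _ => (Finsupp.weight energy ν).toNat)).prod
    (Set.finite_Iic (fun _ => (Finsupp.weight energy μ).toNat))).subset ?_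
  rintro ⟨a, b⟩ hab
  change MvPolynomial.coeff ν ((κ.normalProduct x r s l a b) _) ≠ 0 at hab
  have hle : ∀ (c : Fin N × Fin m → ℕ) p, (c p : ℤ) ≤ (l.map fun p => (c p : ℤ)).sum := by
    intro c p
    refine List.single_le_sum (fun y hy => ?_) _ (List.mem_map_of_mem (hmem p))
    obtain ⟨q, -, rfl⟩ := List.mem_map.mp hy
    exact Int.natCast_nonneg _
  have hA : Shifts (l.map fun p => -(b p : ℤ)).sum
      (l.map fun p => κ.annihilation x r s p.1 (b p)).prod :=
    Shifts.list_prod l fun p => shifts_annihilation x r s κ p.1 (b p)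
  have hC : Shifts (l.map fun p => (a p : ℤ)).sum
      (l.map fun p => κ.creation x r s p.1 (a p)).prod :=
    Shifts.list_prod l fun p => shifts_creation x r s κ p.1 (a p)
  have hneg : ∀ l' : List (Fin N × Fin m),
      (l'.map fun p => -(b p : ℤ)).sum = -(l'.map fun p => (b p : ℤ)).sum := by
    intro l'
    induction l' with
    | nil => simp
    | cons q l' ih => simp only [List.map_cons, List.sum_cons, ih]; ring
  rw [hneg] at hA
  have h0 := MvPolynomial.isWeightedHomogeneous_monomial (energy (N := N)) μ (1 : ℂ) rfl
  have h1 := hA _ _ h0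
  have h2 := hC _ _ h1
  have h3 := h2 hab
  -- The intermediate vector is nonzero and homogeneous, so its degree is the energy of some
  -- monomial and is nonnegative. This bounds the sums of both kinds of modes.
  have h4 : (l.map fun p => κ.annihilation x r s p.1 (b p)).prod (MvPolynomial.monomial μ 1) ≠ 0 := by
    intro h
    apply hab
    rw [Screening.normalProduct, Module.End.mul_apply, h, map_zero, MvPolynomial.coeff_zero]
  obtain ⟨μ', hμ'⟩ := MvPolynomial.ne_zero_iff.mp h4
  have h5 := h1 hμ'
  have h6 := weight_energy_nonneg μ'
  rw [Set.mem_prod, Set.mem_Iic, Set.mem_Iic]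
  constructor
  · intro p
    have := hle a p
    simp only
    omega
  · intro p
    have := hle b p
    simp only
    omega

end

/-! ### The automorphism acting on the modes -/

section

variable {N : ℕ} (x : ℝ) (r s : ℂ) (κ : Screening)

/-- The creation operators generate the Fock space from the vacuum. The criterion identifies a
conjugated annihilation operator through its commutators. -/
theorem eq_zero_of_commute_beta {T : Module.End ℂ (Osc N)} (h1 : T 1 = 0)
    (hT : ∀ (j : Fin N) (k : ℕ), k ≠ 0 → Commute T (beta x r s j (-(k : ℤ)))) : T = 0 := by
  refine LinearMap.ext fun p => ?_
  induction p using MvPolynomial.induction_on with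
  | C a =>
    have : (MvPolynomial.C a : Osc N) = a • 1 := by rw [MvPolynomial.smul_eq_C_mul, mul_one]
    rw [this, map_smul, h1, smul_zero]; rfl
  | add p q hp hq => rw [map_add, hp, hq]; simp
  | mul_X p i hp =>
    have h2 := congrArg (fun S : Module.End ℂ (Osc N) => S p) (hT i.1 i.2 i.2.ne_zero).eq
    have h3 : (i.2 : ℕ).toPNat' = i.2 := PNat.coe_toPNat' i.2
    simp only [Module.End.mul_apply, beta_neg_apply x r s _ i.2.ne_zero, h3] at h2
    rw [mul_comm, h2, hp]
    simp

theorem etaCoef_neg (j : Fin N) (m : ℤ) : etaCoef x s j (-m) = (etaCoef x s j m)⁻¹ := by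
  unfold etaCoef
  split_ifs <;> rw [← xpow_neg] <;> congr 1 <;> push_cast <;> ring

/-- The automorphism respects the commutation relations. The only delicate case is that one of the
indices is the last: the sign of `i - j` flips, and the resulting `x^{±2sn}` is compensated by `η`,
whose coefficients for the last and another colour have ratio `x^{2sn}`. -/
theorem oscComm_rotate (hN : 3 ≤ N) (i j : Fin N) (n : ℕ) :
    oscComm x r s i j n = etaCoef x s i n * etaCoef x s j (-n) *
      oscComm x r s (finRotate N i) (finRotate N j) n := by
  have hN0 : (N : ℂ) ≠ 0 := by exact_mod_cast (show N ≠ 0 by omega)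
  have hinj : finRotate N i = finRotate N j ↔ i = j := (finRotate N).injective.eq_iff
  unfold oscComm
  rw [if_congr hinj rfl rfl]
  by_cases hij : i = j
  · subst hij
    rw [if_pos rfl, if_pos rfl, etaCoef_neg, mul_inv_cancel₀ (etaCoef_ne_zero _ _ _ _), one_mul]
  rw [if_neg hij, if_neg hij]
  have hij' : (i : ℕ) ≠ j := fun h => hij (Fin.ext h)
  have hi' := i.isLt
  have hj' := j.isLt
  have key : xpow x (s * ((n : ℤ) : ℂ) * (if j < i then 1 else -1)) =
      etaCoef x s i n * etaCoef x s j (-n) *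
        xpow x (s * ((n : ℤ) : ℂ) * (if finRotate N j < finRotate N i then 1 else -1)) := by
    unfold etaCoef
    simp only [Fin.lt_def, val_finRotate]
    split_ifs <;> first | (exfalso; omega) | skip
    all_goals
      rw [← xpow_add, ← xpow_add]
      congr 1
      push_cast
      field_simp
      try ring
  rw [key]
  ring

/-- Conjugation by `η` on operators on polynomials in the creation operators. -/
def etaConj (N : ℕ) (x : ℝ) (s : ℂ) : Module.End ℂ (Osc N) ≃ₐ[ℂ] Module.End ℂ (Osc N) :=
  LinearEquiv.conjAlgEquiv ℂ (etaOsc N x s).toLinearEquiv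

theorem etaConj_apply (T : Module.End ℂ (Osc N)) (p : Osc N) :
    etaConj N x s T p = etaOsc N x s (T ((etaOsc N x s).symm p)) := rfl

theorem etaOsc_X (j : Fin N) (k : ℕ+) : etaOsc N x s (MvPolynomial.X (j, k)) =
    MvPolynomial.C (etaCoef x s j (-(k : ℤ))) * MvPolynomial.X (finRotate N j, k) :=
  MvPolynomial.aeval_X _ _

theorem etaConj_beta_neg (j : Fin N) {n : ℕ} (hn : n ≠ 0) :
    etaConj N x s (beta x r s j (-(n : ℤ))) =
      etaCoef x s j (-(n : ℤ)) • beta x r s (finRotate N j) (-(n : ℤ)) := by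
  refine LinearMap.ext fun p => ?_
  rw [etaConj_apply, beta_neg_apply x r s _ hn, map_mul, AlgEquiv.apply_symm_apply, etaOsc_X,
    LinearMap.smul_apply, beta_neg_apply x r s _ hn, MvPolynomial.smul_eq_C_mul, mul_assoc,
    Nat.toPNat'_coe, if_pos (Nat.pos_of_ne_zero hn)]

theorem etaConj_beta_pos (hN : 3 ≤ N) (j : Fin N) {n : ℕ} (hn : n ≠ 0) :
    etaConj N x s (beta x r s j n) = etaCoef x s j n • beta x r s (finRotate N j) n := by
  rw [← sub_eq_zero]
  -- Both sides annihilate the vacuum and have equal commutators with all creation operators.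
  refine eq_zero_of_commute_beta x r s ?_ fun i k hk => ?_
  · rw [LinearMap.sub_apply, etaConj_apply, LinearMap.smul_apply, map_one,
      beta_pos_apply x r s _ hn, beta_pos_apply x r s _ hn]
    simp
  · obtain ⟨i', rfl⟩ := (finRotate N).surjective i
    have h1 := congrArg (etaConj N x s) (beta_mul_beta x r s j i' hn hk)
    have h2 := beta_mul_beta x r s (finRotate N j) (finRotate N i') hn hk
    rw [map_mul, map_add, map_mul, etaConj_beta_neg x r s i' hk] at h1
    have hc := etaCoef_ne_zero x s i' (-(k : ℤ))
    have h3 : etaConj N x s (if n = k then oscComm x r s j i' n • 1 else 0) =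
        if n = k then oscComm x r s j i' n • 1 else 0 := by
      split_ifs
      · rw [map_smul, map_one]
      · rw [map_zero]
    rw [h3, mul_smul_comm, smul_mul_assoc] at h1
    refine smul_right_injective _ hc ?_
    simp only [sub_mul, mul_sub, smul_sub, smul_mul_assoc, mul_smul_comm, h2, h1]
    by_cases hnk : n = k
    · subst hnk
      rw [if_pos rfl, if_pos rfl, oscComm_rotate x r s hN j i' n]
      module
    · rw [if_neg hnk, if_neg hnk]
      module

theorem etaConj_beta (hN : 3 ≤ N) (j : Fin N) (m : ℤ) :
    etaConj N x s (beta x r s j m) = etaCoef x s j m • beta x r s (finRotate N j) m := by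
  rcases lt_trichotomy m 0 with hm | rfl | hm
  · obtain ⟨n, rfl⟩ : ∃ n : ℕ, m = -(n : ℤ) := ⟨m.natAbs, by omega⟩
    exact etaConj_beta_neg x r s j (by omega)
  · simp only [beta, lt_irrefl, if_false, map_zero, smul_zero]
  · obtain ⟨n, rfl⟩ : ∃ n : ℕ, m = (n : ℤ) := ⟨m.natAbs, by omega⟩
    exact etaConj_beta_pos x r s hN j (by omega)

/-- The powers of `x` in the definition of the root oscillators are chosen for this: going around
the circle, including the step from the last colour to the first, no scalar is left. -/
theorem etaConj_rootOsc (hN : 3 ≤ N) (j : Fin N) (m : ℤ) :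
    etaConj N x s (rootOsc x r s j m) = rootOsc x r s (finRotate N j) m := by
  have hN0 : (N : ℂ) ≠ 0 := by exact_mod_cast (show N ≠ 0 by omega)
  rw [rootOsc_eq, rootOsc_eq, map_add, map_smul, map_smul, etaConj_beta x r s hN,
    etaConj_beta x r s hN, smul_smul, smul_smul]
  have hj := j.isLt
  have hNj : ¬ (j : ℕ) + 1 < N → (N : ℂ) = (j : ℂ) + 1 := fun h => by
    have : N = (j : ℕ) + 1 := by omega
    exact_mod_cast this
  have hNj2 : ¬ (j : ℕ) + 1 + 1 < N → (j : ℕ) + 1 < N → (N : ℂ) = (j : ℂ) + 1 + 1 := fun h h' => by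
    have : N = (j : ℕ) + 1 + 1 := by omega
    exact_mod_cast this
  congr 2
  · unfold rootCoefLeft etaCoef
    simp only [val_finRotate]
    split_ifs <;> first | (exfalso; omega) | skip
    all_goals
      rw [← xpow_add]
      congr 1
      push_cast
    · ring
    · have h := hNj2 (by assumption) (by assumption)
      field_simp
      rw [h]; ring
    · field_simp; ring
  · unfold rootCoefRight etaCoef
    simp only [val_finRotate]
    split_ifs <;> first | (exfalso; omega) | skip
    · rw [neg_mul, ← xpow_add]
      congr 2
      push_cast; ring
    · have h := hNj2 (by assumption) (by assumption)
      rw [neg_mul, ← xpow_add, neg_inj]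
      have : -(2 * s / (N : ℂ)) * (((j : ℕ) : ℂ) + 1) * (m : ℂ) +
        2 * s / (N : ℂ) * ((N : ℂ) - 1) * (m : ℂ) = 0 := by rw [h]; ring
      rw [this, xpow_zero]
    · rw [neg_one_mul]
      congr 2
      push_cast; ring

/-- Conjugation is an algebra automorphism, so it maps an exponential sequence to the exponential
sequence of the conjugated exponents. -/
theorem etaConj_creation (hN : 3 ≤ N) (j : Fin N) (n : ℕ) :
    etaConj N x s (κ.creation x r s j n) = κ.creation x r s (finRotate N j) n := by
  have h1 := (κ.creation_isExpSeq x r s j).map (etaConj N x s).toAlgHom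
  have h2 : (fun n => (etaConj N x s).toAlgHom (κ.creExp x r s j n)) =
      κ.creExp x r s (finRotate N j) := by
    funext n
    change etaConj N x s _ = _
    rw [Screening.creExp, Screening.creExp, κ.osc_eq, κ.osc_eq, map_smul, map_smul,
      etaConj_rootOsc x r s hN]
  rw [h2] at h1
  exact congrFun (h1.unique (κ.creation_isExpSeq x r s (finRotate N j))) n

theorem etaConj_annihilation (hN : 3 ≤ N) (j : Fin N) (n : ℕ) :
    etaConj N x s (κ.annihilation x r s j n) = κ.annihilation x r s (finRotate N j) n := by
  have h1 := (κ.annihilation_isExpSeq x r s j).map (etaConj N x s).toAlgHom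
  have h2 : (fun n => (etaConj N x s).toAlgHom (κ.annExp x r s j n)) =
      κ.annExp x r s (finRotate N j) := by
    funext n
    change etaConj N x s _ = _
    rw [Screening.annExp, Screening.annExp, κ.osc_eq, κ.osc_eq, map_smul, map_smul,
      etaConj_rootOsc x r s hN]
  rw [h2] at h1
  exact congrFun (h1.unique (κ.annihilation_isExpSeq x r s (finRotate N j))) n

end

/-! ### Products over ordered pairs -/

section

variable {ι M : Type*} [CommMonoid M]

theorem pairProd_mul (f g : ι → ι → M) (l : List ι) :
    pairProd (fun p q => f p q * g p q) l = pairProd f l * pairProd g l := by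
  induction l with
  | nil => simp [pairProd]
  | cons p l ih => rw [pairProd, pairProd, pairProd, ih, List.prod_map_mul, mul_mul_mul_comm]

/-- An ordered list becomes a product over all pairs with an indicator, which can then be regrouped
by colours. -/
theorem pairProd_eq_prod_ite {R : ι → ι → Prop} [DecidableRel R] (hR : ∀ p q, R p q → ¬ R q p)
    (f : ι → ι → M) {l : List ι} (hl : l.Pairwise R) :
    pairProd f l = (l.map fun p => (l.map fun q => if R p q then f p q else 1).prod).prod := by
  induction l with
  | nil => simp [pairProd]
  | cons p l ih =>
    rw [List.pairwise_cons] at hl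
    have h1 : (l.map fun q => if R p q then f p q else 1) = l.map (f p) :=
      List.map_congr_left fun q hq => if_pos (hl.1 q hq)
    have h2 : (l.map fun p' => (if R p' p then f p' p else 1) *
        (l.map fun q => if R p' q then f p' q else 1).prod) =
        l.map fun p' => (l.map fun q => if R p' q then f p' q else 1).prod :=
      List.map_congr_left fun p' hp' => by rw [if_neg (hR _ _ (hl.1 p' hp')), one_mul]
    simp only [List.map_cons, List.prod_cons]
    rw [pairProd, ih hl.2, h1, h2, if_neg fun h => hR _ _ h h, one_mul]

theorem List.prod_map_eq_prod_univ [Fintype ι] {l : List ι} (hl : l.Nodup) (hmem : ∀ p, p ∈ l)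
    (f : ι → M) : (l.map f).prod = ∏ p, f p := by
  classical
  rw [← List.prod_toFinset f hl]
  congr 1
  ext p; simp [hmem]

end

section

variable {N m : ℕ}

/-- The order in which the currents are multiplied. -/
def orderedPairs (N m : ℕ) : List (Fin N × Fin m) :=
  (List.finRange N).flatMap fun t => (List.finRange m).map (Prod.mk t)

theorem mem_orderedPairs (p : Fin N × Fin m) : p ∈ orderedPairs N m := by
  simp [orderedPairs]

/-- The order relation of `orderedPairs`. -/
def Precedes (p q : Fin N × Fin m) : Prop := p.1 < q.1 ∨ (p.1 = q.1 ∧ p.2 < q.2)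

instance : DecidableRel (Precedes (N := N) (m := m)) := fun p q => by
  unfold Precedes; infer_instance

theorem Precedes.not_symm (p q : Fin N × Fin m) (h : Precedes p q) : ¬ Precedes q p := by
  unfold Precedes at *
  rintro (h' | ⟨h', h''⟩) <;> rcases h with h | ⟨h1, h2⟩ <;> omega

theorem pairwise_orderedPairs : (orderedPairs N m).Pairwise Precedes := by
  rw [orderedPairs, List.pairwise_flatMap]
  constructor
  · intro t _
    rw [List.pairwise_map]
    exact (List.pairwise_lt_finRange m).imp fun h => Or.inr ⟨rfl, h⟩
  · refine (List.pairwise_lt_finRange N).imp fun h => ?_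
    intro p hp q hq
    obtain ⟨i, -, rfl⟩ := List.mem_map.mp hp
    obtain ⟨j, -, rfl⟩ := List.mem_map.mp hq
    exact Or.inl h

theorem nodup_orderedPairs : (orderedPairs N m).Nodup :=
  pairwise_orderedPairs.imp fun {p q} h => by
    rintro rfl
    exact Precedes.not_symm _ _ h h

theorem prod_ofFn_ofFn {M : Type*} [Monoid M] (g : Fin N × Fin m → M) :
    (List.ofFn fun t => (List.ofFn fun i => g (t, i)).prod).prod =
      ((orderedPairs N m).map g).prod := by
  simp only [orderedPairs, List.ofFn_eq_map, List.map_flatMap, List.map_map]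
  rw [List.flatMap_def, List.prod_flatten, List.map_map]
  rfl

variable {M : Type*} [CommMonoid M]

/-- Among the pairs `t < t'` the nontrivial ones are the edges of the circle of colours. For `N ≥ 3`
every edge occurs once, the edge between first and last in reversed cyclic order. -/
theorem prod_lt_eq_prod_neighbours (hN : 3 ≤ N) {g : Fin N → Fin N → M}
    (hg : ∀ i j : Fin N, i < j → (i : ℕ) + 1 ≠ j → ¬ ((i : ℕ) = 0 ∧ (j : ℕ) + 1 = N) → g i j = 1) :
    (∏ t, ∏ t', if t < t' then g t t' else 1) =
      ∏ t : Fin N, if (t : ℕ) + 1 < N then g t (finRotate N t) else g (finRotate N t) t := by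
  have h1 : ∀ t t' : Fin N, (if t < t' then g t t' else 1) =
      (if t' = finRotate N t then (if (t : ℕ) + 1 < N then g t t' else 1) else 1) *
      (if t = finRotate N t' then (if (t' : ℕ) + 1 < N then 1 else g t t') else 1) := by
    intro t t'
    have ht := t.isLt
    have ht' := t'.isLt
    simp only [Fin.ext_iff, val_finRotate, Fin.lt_def]
    by_cases h : (t : ℕ) < t'
    · rw [if_pos h]
      by_cases h2 : (t : ℕ) + 1 = t'
      · have a1 : (t : ℕ) + 1 < N := by omega
        have a2 : ¬ (t : ℕ) = if (t' : ℕ) + 1 < N then (t' : ℕ) + 1 else 0 := by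
          split_ifs <;> omega
        rw [if_pos a1, if_pos h2.symm, if_pos a1, if_neg a2, mul_one]
      · have a1 : ¬ (t' : ℕ) = if (t : ℕ) + 1 < N then (t : ℕ) + 1 else 0 := by
          split_ifs <;> omega
        rw [if_neg a1, one_mul]
        by_cases h3 : (t : ℕ) = 0 ∧ (t' : ℕ) + 1 = N
        · have a2 : ¬ (t' : ℕ) + 1 < N := by omega
          rw [if_neg a2, if_pos h3.1, if_neg a2]
        · rw [hg t t' (Fin.lt_def.mpr h) h2 h3]
          simp
    · rw [if_neg h]
      split_ifs <;> first | omega | simp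
  simp_rw [h1, Finset.prod_mul_distrib]
  rw [Finset.prod_comm (f := fun t t' : Fin N =>
    if t = finRotate N t' then (if (t' : ℕ) + 1 < N then 1 else g t t') else 1)]
  simp only [Finset.prod_ite_eq', Finset.mem_univ, if_true]
  rw [← Finset.prod_mul_distrib]
  refine Finset.prod_congr rfl fun t _ => ?_
  split_ifs <;> simp

/-- The pairs split into those of equal colour and those along the edges of the circle, in agreement
with the shape of `numerator` and `denominator`. -/
theorem pairProd_orderedPairs (hN : 3 ≤ N) (f : Fin N × Fin m → Fin N × Fin m → M)
    (hf : ∀ p q : Fin N × Fin m, p.1 < q.1 → (p.1 : ℕ) + 1 ≠ q.1 →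
      ¬ ((p.1 : ℕ) = 0 ∧ (q.1 : ℕ) + 1 = N) → f p q = 1) :
    pairProd f (orderedPairs N m) = (∏ t, ∏ i, ∏ j ∈ Finset.Ioi i, f (t, i) (t, j)) *
      ∏ t : Fin N, ∏ i, ∏ j, if (t : ℕ) + 1 < N then f (t, i) (finRotate N t, j)
        else f (finRotate N t, i) (t, j) := by
  rw [pairProd_eq_prod_ite Precedes.not_symm f pairwise_orderedPairs]
  simp only [List.prod_map_eq_prod_univ nodup_orderedPairs mem_orderedPairs]
  have h1 : ∀ p q : Fin N × Fin m, (if Precedes p q then f p q else 1) =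
      (if p.1 = q.1 then (if p.2 < q.2 then f p q else 1) else 1) *
      (if p.1 < q.1 then f p q else 1) := by
    intro p q
    unfold Precedes
    by_cases h : p.1 < q.1
    · have h' : p.1 ≠ q.1 := h.ne
      simp [h, h']
    · by_cases h' : p.1 = q.1
      · simp [h']
      · simp [h, h']
  simp_rw [h1, Finset.prod_mul_distrib, Fintype.prod_prod_type]
  congr 1
  · refine Finset.prod_congr rfl fun t _ => Finset.prod_congr rfl fun i _ => ?_
    rw [Finset.prod_comm]
    simp only [Finset.prod_ite_eq, Finset.mem_univ, if_true]
    rw [← Finset.prod_filter]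
    congr 1
    ext j; simp
  · have h2 := prod_lt_eq_prod_neighbours hN (g := fun t t' => ∏ i, ∏ j, f (t, i) (t', j))
      (fun i j hij h h' => Finset.prod_eq_one fun a _ => Finset.prod_eq_one fun b _ =>
        hf (i, a) (j, b) hij h h')
    have h3 : ∀ t : Fin N, (∏ i, ∏ j, if (t : ℕ) + 1 < N then f (t, i) (finRotate N t, j)
        else f (finRotate N t, i) (t, j)) = if (t : ℕ) + 1 < N then
          ∏ i, ∏ j, f (t, i) (finRotate N t, j) else ∏ i, ∏ j, f (finRotate N t, i) (t, j) := by
      intro t; split_ifs <;> rfl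
    simp_rw [h3]
    rw [← h2]
    refine Finset.prod_congr rfl fun t _ => ?_
    rw [Finset.prod_comm]
    refine Finset.prod_congr rfl fun t' _ => ?_
    split_ifs with h
    · rfl
    · simp

end

/-! ### Zero modes -/

section

variable {N : ℕ} (κ : Screening) (x : ℝ) (r s ρ : ℂ)

theorem sectorOp_single (σ : Sector N → Sector N) (f : Sector N → ℂ) (T : Module.End ℂ (Osc N))
    (v : Sector N) (p : Osc N) :
    sectorOp σ f T (Finsupp.single v p) = Finsupp.single (σ v) (f v • T p) := by
  simp [sectorOp]

theorem sectorOp_mul (σ σ' : Sector N → Sector N) (f f' : Sector N → ℂ)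
    (T T' : Module.End ℂ (Osc N)) : sectorOp σ f T * sectorOp σ' f' T' =
      sectorOp (σ ∘ σ') (fun v => f (σ' v) * f' v) (T * T') := by
  refine Finsupp.lhom_ext' fun v => LinearMap.ext fun p => ?_
  simp only [LinearMap.comp_apply, Finsupp.lsingle_apply, Module.End.mul_apply, sectorOp_single,
    map_smul, smul_smul, Function.comp_apply]

/-- The translation of labels by a weight. -/
def Screening.shiftBy (w : weightLattice N) (v : Sector N) : Sector N :=
  match κ with
  | .F => (v.1, v.2 - w)
  | .E => (v.1 - w, v.2)

theorem Screening.shift_eq (j : Fin N) : κ.shift j = κ.shiftBy (alpha j) := by cases κ <;> rfl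

theorem Screening.shiftBy_zero (v : Sector N) : κ.shiftBy 0 v = v := by
  cases κ <;> simp [shiftBy]

theorem Screening.shiftBy_add (w w' : weightLattice N) (v : Sector N) :
    κ.shiftBy (w + w') v = κ.shiftBy w (κ.shiftBy w' v) := by
  cases κ <;> simp [shiftBy, sub_sub, add_comm]

/-- The inner product of two weights. -/
def weightInner (w w' : weightLattice N) : ℂ :=
  (((w : Fin N → ℝ) ⬝ᵥ (w' : Fin N → ℝ) : ℝ) : ℂ)

theorem weightInner_add_right (w a b : weightLattice N) :
    weightInner w (a + b) = weightInner w a + weightInner w b := by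
  simp [weightInner, dotProduct_add]

theorem weightInner_sub_left (a b w : weightLattice N) :
    weightInner (a - b) w = weightInner a w - weightInner b w := by
  simp [weightInner, sub_dotProduct]

theorem weightInner_sub_right (w a b : weightLattice N) :
    weightInner w (a - b) = weightInner w a - weightInner w b := by
  simp [weightInner, dotProduct_sub]

theorem weightInner_zero_right (w : weightLattice N) : weightInner w 0 = 0 := by
  simp [weightInner]

theorem weightInner_ebar (hN : 3 ≤ N) (i j : Fin N) :
    weightInner (ebar i) (ebar j) = (if i = j then 1 else 0) - 1 / N := by
  have hN0 : (N : ℝ) ≠ 0 := by exact_mod_cast (show N ≠ 0 by omega)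
  have : (ebarVec N i ⬝ᵥ ebarVec N j) = (if i = j then 1 else 0) - 1 / (N : ℝ) := by
    simp only [dotProduct, ebarVec, Pi.single_apply, sub_mul, mul_sub, Finset.sum_sub_distrib]
    simp only [ite_mul, one_mul, zero_mul, mul_ite, mul_one, mul_zero, Finset.sum_ite_eq',
      Finset.mem_univ, if_true, Finset.sum_const, Finset.card_univ, Fintype.card_fin, nsmul_eq_mul]
    rw [if_congr (eq_comm (a := j) (b := i)) rfl rfl]
    field_simp
    ring
  unfold weightInner
  change ((ebarVec N i ⬝ᵥ ebarVec N j : ℝ) : ℂ) = _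
  rw [this]
  split_ifs <;> push_cast <;> rfl

theorem weightInner_alpha (hN : 3 ≤ N) (i j : Fin N) : weightInner (alpha i) (alpha j) =
    (if i = j then 2 else 0) - (if i = finRotate N j then 1 else 0)
      - (if finRotate N i = j then 1 else 0) := by
  have hinj : finRotate N i = finRotate N j ↔ i = j := (finRotate N).injective.eq_iff
  unfold alpha
  simp only [weightInner_sub_left, weightInner_sub_right, weightInner_ebar hN, hinj]
  split_ifs <;> ring

theorem momentum_eq (w : weightLattice N) (v : Sector N) :
    momentum ρ w v = ρ⁻¹ * weightInner w v.1 - ρ * weightInner w v.2 := rfl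

/-- The signs in `zeroCoef`, in the momentum and in the translation combine to `+c²` for both
families, so that they can be treated together from here on. -/
theorem Screening.momentum_shiftBy (w w' : weightLattice N) (v : Sector N) :
    κ.zeroCoef ρ * momentum ρ w (κ.shiftBy w' v) =
      κ.zeroCoef ρ * momentum ρ w v + κ.zeroCoef ρ ^ 2 * weightInner w w' := by
  cases κ <;> simp only [zeroCoef, shiftBy, momentum_eq, weightInner_sub_right] <;> ring

/-- The scalar `y` such that the zero-mode factor contains the power of `x ^ y z`. -/
def zeroShift (N : ℕ) (s : ℂ) (j : Fin N) : ℂ := (2 * s / N - 1) * ((j : ℂ) + 1)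

/-- The weight in the exponent of `x ^ zeroShift`. -/
def zeroWeight (j : Fin N) : weightLattice N := if (j : ℕ) + 1 < N then alpha j else ebar j

/-- The part of the zero-mode factor that is independent of `z`. -/
def Screening.zeroConst (j : Fin N) (v : Sector N) : ℂ :=
  xpow x (zeroShift N s j * (κ.zeroCoef ρ * momentum ρ (zeroWeight j) v
    + if (j : ℕ) + 1 < N then κ.zeroCoef ρ ^ 2 else κ.zeroCoef ρ ^ 2 / 2))

/-- The part of the zero-mode factor that depends on `z = x ^ (2 u)`. -/
def Screening.zeroPower (j : Fin N) (u : ℂ) (v : Sector N) : ℂ :=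
  xpow x (2 * u * (κ.zeroCoef ρ * momentum ρ (alpha j) v + κ.zeroCoef ρ ^ 2))

/-- The exponent of `z` is `c P_{α_j} + c²` for every colour, the last one included; the special
form of the last current affects only the part independent of `z`. -/
theorem Screening.zeroFactor_eq (hN : 3 ≤ N) (j : Fin N) (u : ℂ) (v : Sector N) :
    κ.zeroFactor x s ρ j u v = κ.zeroConst x s ρ j v * κ.zeroPower x ρ j u v := by
  have hN0 : (N : ℂ) ≠ 0 := by exact_mod_cast (show N ≠ 0 by omega)
  unfold zeroFactor zeroConst zeroPower zeroWeight zeroShift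
  simp only
  split_ifs with h
  · rw [← xpow_add]; congr 1; ring
  · have hj : (N : ℂ) = (j : ℂ) + 1 := by
      have : N = (j : ℕ) + 1 := by have := j.isLt; omega
      exact_mod_cast this
    have e : (2 * s / N - 1) * ((j : ℂ) + 1) = 2 * s - N := by rw [← hj]; field_simp
    have e2 : momentum ρ (alpha j) v = momentum ρ (ebar j) v - momentum ρ (ebar (finRotate N j)) v := by
      simp only [alpha, momentum_eq, weightInner_sub_left]; ring
    rw [e, e2, ← xpow_add, ← xpow_add]; congr 1; ring

/-- The factor from moving the zero modes of the current of colour `j` at `z = x ^ (2 u)` past a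
translation by a weight. -/
def Screening.zeroChar (j : Fin N) (u : ℂ) (w : weightLattice N) : ℂ :=
  xpow x (zeroShift N s j * (κ.zeroCoef ρ ^ 2 * weightInner (zeroWeight j) w))
    * xpow x (2 * u * (κ.zeroCoef ρ ^ 2 * weightInner (alpha j) w))

theorem Screening.zeroFactor_shiftBy (hN : 3 ≤ N) (j : Fin N) (u : ℂ) (w : weightLattice N)
    (v : Sector N) : κ.zeroFactor x s ρ j u (κ.shiftBy w v) =
      κ.zeroFactor x s ρ j u v * κ.zeroChar x s ρ j u w := by
  rw [κ.zeroFactor_eq x s ρ hN, κ.zeroFactor_eq x s ρ hN]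
  unfold zeroConst zeroPower zeroChar
  rw [κ.momentum_shiftBy, κ.momentum_shiftBy, ← xpow_add, ← xpow_add, ← xpow_add, ← xpow_add]
  congr 1; ring

theorem Screening.zeroChar_list_sum {ι : Type*} (j : Fin N) (u : ℂ) (l : List ι)
    (w : ι → weightLattice N) : κ.zeroChar x s ρ j u (l.map w).sum =
      (l.map fun q => κ.zeroChar x s ρ j u (w q)).prod := by
  induction l with
  | nil => simp [zeroChar, weightInner_zero_right]
  | cons q l ih =>
    rw [List.map_cons, List.map_cons, List.sum_cons, List.prod_cons, ← ih]
    unfold zeroChar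
    rw [weightInner_add_right, weightInner_add_right, ← xpow_add, ← xpow_add, ← xpow_add,
      ← xpow_add]
    congr 1; ring

/-- Every current sees the momentum translated by all currents to its right; since the zero-mode
factors are exponentials, this yields one scalar for each ordered pair. -/
theorem Screening.list_prod_term (hN : 3 ≤ N) {m : ℕ} (u : Fin N × Fin m → ℂ)
    (a b : Fin N × Fin m → ℕ) (l : List (Fin N × Fin m)) :
    (l.map fun p => κ.term x r s ρ p.1 (u p) (a p) (b p)).prod =
      sectorOp (κ.shiftBy (l.map fun p => alpha p.1).sum)
        (fun v => (l.map fun p => κ.zeroFactor x s ρ p.1 (u p) v).prod *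
          pairProd (fun p q => κ.zeroChar x s ρ p.1 (u p) (alpha q.1)) l *
          (l.map fun p => xpow x (2 * u p * ((a p : ℂ) - (b p : ℂ)))).prod)
        (l.map fun p => κ.creation x r s p.1 (a p) * κ.annihilation x r s p.1 (b p)).prod := by
  induction l with
  | nil =>
    refine Finsupp.lhom_ext' fun v => LinearMap.ext fun p => ?_
    simp [sectorOp_single, pairProd, κ.shiftBy_zero]
  | cons p l ih =>
    rw [List.map_cons, List.prod_cons, ih, Screening.term, sectorOp_mul, κ.shift_eq]
    congr 1
    · funext v
      rw [Function.comp_apply, List.map_cons, List.sum_cons, κ.shiftBy_add]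
    · funext v
      simp only [List.map_cons, List.prod_cons]
      rw [pairProd, κ.zeroFactor_shiftBy x s ρ hN, κ.zeroChar_list_sum]
      ring

/-- The roots telescope around the circle. Since each colour occurs equally often, the integrals
preserve every Fock space. -/
theorem sum_alpha : ∑ t : Fin N, alpha t = 0 := by
  unfold alpha
  rw [Finset.sum_sub_distrib, Equiv.sum_comp (finRotate N) fun t => ebar t, sub_self]

theorem sum_map_alpha (m : ℕ) : ((orderedPairs N m).map fun p => alpha p.1).sum = 0 := by
  have h := List.prod_map_eq_prod_univ (M := Multiplicative (weightLattice N))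
    nodup_orderedPairs (mem_orderedPairs (N := N) (m := m)) fun p => Multiplicative.ofAdd (alpha p.1)
  have h2 : ((orderedPairs N m).map fun p => alpha p.1).sum = ∑ p : Fin N × Fin m, alpha p.1 := h
  rw [h2, Fintype.sum_prod_type]
  simp only [Finset.sum_const]
  rw [← Finset.smul_sum, sum_alpha, smul_zero]

theorem momentum_sum_ebar (hN : 3 ≤ N) (v : Sector N) : ∑ t : Fin N, momentum ρ (ebar t) v = 0 := by
  have hN0 : (N : ℝ) ≠ 0 := by exact_mod_cast (show N ≠ 0 by omega)
  have h : ∀ w : weightLattice N, ∑ t : Fin N, weightInner (ebar t) w = 0 := by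
    intro w
    unfold weightInner
    rw [← Complex.ofReal_sum, ← sum_dotProduct]
    have : (∑ t : Fin N, ((ebar t : weightLattice N) : Fin N → ℝ)) = 0 := by
      funext k
      rw [Finset.sum_apply]
      change ∑ t : Fin N, ebarVec N t k = 0
      simp [ebarVec, Pi.single_apply, hN0]
    rw [this, zero_dotProduct, Complex.ofReal_zero]
  simp only [momentum_eq, Finset.sum_sub_distrib, ← Finset.mul_sum, h, mul_zero, sub_zero]

/-- The product of the constant parts over all colours does not depend on the zero modes. -/
theorem Screening.prod_zeroConst (hN : 3 ≤ N) (v v' : Sector N) :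
    ∏ t : Fin N, κ.zeroConst x s ρ t v = ∏ t : Fin N, κ.zeroConst x s ρ t v' := by
  have key : ∀ v : Sector N, ∑ t : Fin N, ((t : ℂ) + 1) * momentum ρ (zeroWeight t) v = 0 := by
    intro v
    -- Summation by parts: for each colour one copy of `P` at `ε̄_t` splits off and the rest
    -- telescopes cyclically. For the last colour the subtracted term has coefficient zero, which
    -- explains the use of `ε̄_N` instead of `α_N` there.
    have h1 : ∀ t : Fin N, ((t : ℂ) + 1) * momentum ρ (zeroWeight t) v =
        momentum ρ (ebar t) v + ((t : ℂ) * momentum ρ (ebar t) v -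
          ((finRotate N t : Fin N) : ℕ) * momentum ρ (ebar (finRotate N t)) v) := by
      intro t
      unfold zeroWeight
      split_ifs with h
      · rw [finRotate_val_of_lt h]
        simp only [alpha, momentum_eq, weightInner_sub_left]; push_cast; ring
      · rw [finRotate_val_of_not_lt h]; push_cast; ring
    simp_rw [h1]
    rw [Finset.sum_add_distrib, Finset.sum_sub_distrib, momentum_sum_ebar ρ hN,
      Equiv.sum_comp (finRotate N) fun t : Fin N => ((t : ℕ) : ℂ) * momentum ρ (ebar t) v]
    simp
  have key2 : ∀ v : Sector N, ∏ t : Fin N, κ.zeroConst x s ρ t v = xpow x (∑ t : Fin N,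
      zeroShift N s t * if (t : ℕ) + 1 < N then κ.zeroCoef ρ ^ 2 else κ.zeroCoef ρ ^ 2 / 2) := by
    intro v
    unfold zeroConst
    rw [← xpow_sum]
    congr 1
    simp only [mul_add, Finset.sum_add_distrib]
    rw [add_eq_right]
    have h2 := key v
    have : ∀ t : Fin N, zeroShift N s t * (κ.zeroCoef ρ * momentum ρ (zeroWeight t) v) =
        (2 * s / N - 1) * κ.zeroCoef ρ * (((t : ℂ) + 1) * momentum ρ (zeroWeight t) v) := by
      intro t; unfold zeroShift; ring
    simp_rw [this]
    rw [← Finset.mul_sum, h2, mul_zero]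
  rw [key2, key2]

end

/-! ### The ordered operator product -/

section

variable {N m : ℕ} (κ : Screening) (x : ℝ) (r s ρ : ℂ)

/-- The contraction of the currents of colours `i`, `j`, as a function of the ratio `y` of the
arguments. -/
def Screening.contraction (i j : Fin N) (y : ℂ) : ℂ := ∑' k, expSeq (κ.contr x r s i j) k * y ^ k

/-- The matrix element of the normally ordered product of the oscillator parts. -/
def Screening.normalElement (ν μ : OscIndex N →₀ ℕ) (u : Fin N → Fin m → ℂ) : ℂ :=
  ∑' ab : (Fin N × Fin m → ℕ) × (Fin N × Fin m → ℕ),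
    oscElement ν μ (κ.normalProduct x r s (orderedPairs N m) ab.1 ab.2) *
      ∏ p : Fin N × Fin m, xpow x (2 * u p.1 p.2 * ((ab.1 p : ℂ) - (ab.2 p : ℂ)))

/-- The product of all zero-mode factors and contractions. -/
def Screening.scalarPart (u : Fin N → Fin m → ℂ) (v : Sector N) : ℂ :=
  (∏ p : Fin N × Fin m, κ.zeroFactor x s ρ p.1 (u p.1 p.2) v) *
    pairProd (fun p q : Fin N × Fin m => κ.zeroChar x s ρ p.1 (u p.1 p.2) (alpha q.1) *
      κ.contraction x r s p.1 q.1 (xpow x (2 * (u q.1 q.2 - u p.1 p.2)))) (orderedPairs N m)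

theorem xpow_mul_sub_nat (u : ℂ) (a b : ℕ) :
    xpow x (2 * u * ((a : ℂ) - (b : ℂ))) = xpow x (2 * u) ^ a * xpow x (-2 * u) ^ b := by
  rw [← xpow_mul_nat, ← xpow_mul_nat, ← xpow_add]
  congr 1; ring

theorem incl_productTerm (hN : 3 ≤ N) (ϑ : (Fin N → ℂ) → Sector N → ℂ) (u : Fin N → Fin m → ℂ)
    (a b : Fin N × Fin m → ℕ) (v v' : Sector N) (μ ν : OscIndex N →₀ ℕ) :
    incl N (productTerm κ x r s ρ ϑ u (fun t i => a (t, i), fun t i => b (t, i)) (ket v μ)) v' ν =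
      if v = v' then ϑ (fun t => ∑ i, u t i) v *
        ((∏ p : Fin N × Fin m, κ.zeroFactor x s ρ p.1 (u p.1 p.2) v) *
        pairProd (fun p q : Fin N × Fin m => κ.zeroChar x s ρ p.1 (u p.1 p.2) (alpha q.1))
          (orderedPairs N m)) *
        (oscElement ν μ ((orderedPairs N m).map fun p =>
            κ.creation x r s p.1 (a p) * κ.annihilation x r s p.1 (b p)).prod *
          ((∏ p : Fin N × Fin m, xpow x (2 * u p.1 p.2) ^ a p) *
            ∏ p : Fin N × Fin m, xpow x (-2 * u p.1 p.2) ^ b p)) else 0 := by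
  have h1 : (List.ofFn fun t => (List.ofFn fun i =>
      κ.term x r s ρ t (u t i) (a (t, i)) (b (t, i))).prod).prod =
      ((orderedPairs N m).map fun p => κ.term x r s ρ p.1 (u p.1 p.2) (a p) (b p)).prod :=
    prod_ofFn_ofFn fun p => κ.term x r s ρ p.1 (u p.1 p.2) (a p) (b p)
  rw [productTerm]
  simp only
  rw [h1, κ.list_prod_term x r s ρ hN (fun p => u p.1 p.2) a b, sum_map_alpha, Module.End.mul_apply,
    ket, zeroModeOp, sectorOp_single, sectorOp_single, κ.shiftBy_zero, id, Module.End.one_apply,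
    map_smul]
  simp only [List.prod_map_eq_prod_univ nodup_orderedPairs mem_orderedPairs, incl,
    LinearMap.coe_mk, AddHom.coe_mk]
  by_cases h : v = v'
  · subst h
    rw [if_pos rfl, Finsupp.single_eq_same, MvPolynomial.coeff_smul, MvPolynomial.coeff_smul,
      ← Finset.prod_mul_distrib]
    simp only [xpow_mul_sub_nat, smul_eq_mul]
    change _ * (_ * oscElement ν μ _) = _
    ring
  · rw [if_neg h, Finsupp.single_eq_of_ne' h, MvPolynomial.coeff_zero]

/-- Separates the infinite sum over intermediate states into contractions, which carry the
convergence question, and a finite normally ordered sum. -/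
theorem productElement_eq (hN : 3 ≤ N) (ϑ : (Fin N → ℂ) → Sector N → ℂ) (u : Fin N → Fin m → ℂ)
    (v v' : Sector N) (μ ν : OscIndex N →₀ ℕ)
    (hs : (orderedPairs N m).Pairwise fun p q => Summable fun k =>
      ‖expSeq (κ.contr x r s p.1 q.1) k * xpow x (2 * (u q.1 q.2 - u p.1 p.2)) ^ k‖) :
    productElement κ x r s ρ ϑ v μ v' ν u =
      if v = v' then ϑ (fun t => ∑ i, u t i) v * κ.scalarPart x r s ρ u v *
        κ.normalElement x r s ν μ u else 0 := by
  unfold productElement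
  rw [← ((Equiv.curry (Fin N) (Fin m) ℕ).prodCongr (Equiv.curry (Fin N) (Fin m) ℕ)).tsum_eq]
  have h1 : ∀ ab : (Fin N × Fin m → ℕ) × (Fin N × Fin m → ℕ),
      ((Equiv.curry (Fin N) (Fin m) ℕ).prodCongr (Equiv.curry (Fin N) (Fin m) ℕ)) ab =
        (fun t i => ab.1 (t, i), fun t i => ab.2 (t, i)) := fun _ => rfl
  simp_rw [h1, incl_productTerm κ x r s ρ hN]
  by_cases h : v = v'
  · simp only [if_pos h]
    rw [tsum_mul_left]
    have hexp : ∀ p q : Fin N × Fin m, xpow x (-2 * u p.1 p.2) * xpow x (2 * u q.1 q.2) =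
        xpow x (2 * (u q.1 q.2 - u p.1 p.2)) := by
      intro p q; rw [← xpow_add]; congr 1; ring
    have key := tsum_ordered_product (orderedPairs N m) nodup_orderedPairs mem_orderedPairs
      (fun p n => κ.creation x r s p.1 n) (fun p n => κ.annihilation x r s p.1 n)
      (fun p q => expSeq (κ.contr x r s p.1 q.1))
      (List.pairwise_of_forall fun p q n a => κ.annihilation_mul_creation x r s p.1 q.1 n a)
      (oscElement ν μ) (finite_normalProduct x r s κ (orderedPairs N m) mem_orderedPairs ν μ)
      (fun p => xpow x (2 * u p.1 p.2)) (fun p => xpow x (-2 * u p.1 p.2))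
      (hs.imp fun {p q} hpq => by simp only [hexp]; exact hpq)
    rw [key]
    have h2 : (fun p q : Fin N × Fin m => ∑' k, expSeq (κ.contr x r s p.1 q.1) k *
        (xpow x (-2 * u p.1 p.2) * xpow x (2 * u q.1 q.2)) ^ k) = fun p q : Fin N × Fin m =>
          κ.contraction x r s p.1 q.1 (xpow x (2 * (u q.1 q.2 - u p.1 p.2))) := by
      funext p q; rw [hexp]; rfl
    have h3 : κ.normalElement x r s ν μ u =
        ∑' ab : (Fin N × Fin m → ℕ) × (Fin N × Fin m → ℕ),
          oscElement ν μ (((orderedPairs N m).map fun p => κ.creation x r s p.1 (ab.1 p)).prod *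
          ((orderedPairs N m).map fun p => κ.annihilation x r s p.1 (ab.2 p)).prod) *
          ((∏ p : Fin N × Fin m, xpow x (2 * u p.1 p.2) ^ ab.1 p) *
            ∏ p : Fin N × Fin m, xpow x (-2 * u p.1 p.2) ^ ab.2 p) := by
      unfold Screening.normalElement
      refine tsum_congr fun ab => ?_
      rw [← Finset.prod_mul_distrib]
      simp only [xpow_mul_sub_nat]
      rfl
    rw [h2, h3, Screening.scalarPart, pairProd_mul]
    ring
  · simp only [if_neg h, tsum_zero]

end

/-! ### The contractions and the theta functions -/

section

variable {N : ℕ} (κ : Screening) (x : ℝ) (r s ρ : ℂ)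

/-- The ratio of the arguments of two currents is small enough for all contractions to converge. -/
def Screening.SmallRatio (N : ℕ) (y : ℂ) : Prop :=
  ‖1 * y‖ < 1 ∧ ‖xpow x (2 * κ.nome r) * y‖ < 1 ∧ ‖xpow x (2 * κ.sign r) * y‖ < 1 ∧
  ‖xpow x (2 * κ.nome r) * xpow x (-2 * κ.sign r) * y‖ < 1 ∧
  ‖xpow x (2 * κ.innerExp N r s) * y‖ < 1 ∧
  ‖xpow x (2 * κ.nome r) * xpow x (2 * κ.outerExp N r s) * y‖ < 1 ∧
  ‖xpow x (-2 * κ.outerExp N r s) * y‖ < 1 ∧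
  ‖xpow x (2 * κ.nome r) * xpow x (-2 * κ.innerExp N r s) * y‖ < 1

theorem Screening.eventually_smallRatio (N : ℕ) :
    ∀ᶠ ε in 𝓝[>] (0 : ℝ), ∀ y : ℂ, ‖y‖ < ε → κ.SmallRatio x r s N y := by
  have key : ∀ c : ℂ, ∀ᶠ ε in 𝓝[>] (0 : ℝ), ∀ y : ℂ, ‖y‖ < ε → ‖c * y‖ < 1 := by
    intro c
    have hpos : 0 < (‖c‖ + 1)⁻¹ := by positivity
    filter_upwards [Ioo_mem_nhdsGT hpos] with ε hε y hy
    rw [norm_mul]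
    have h1 : ‖y‖ < (‖c‖ + 1)⁻¹ := hy.trans hε.2
    have h2 : ‖y‖ * (‖c‖ + 1) < 1 := by
      rw [← lt_div_iff₀ (by positivity), one_div]; exact h1
    nlinarith [norm_nonneg c, norm_nonneg y]
  filter_upwards [key 1, key (xpow x (2 * κ.nome r)), key (xpow x (2 * κ.sign r)),
    key (xpow x (2 * κ.nome r) * xpow x (-2 * κ.sign r)), key (xpow x (2 * κ.innerExp N r s)),
    key (xpow x (2 * κ.nome r) * xpow x (2 * κ.outerExp N r s)),
    key (xpow x (-2 * κ.outerExp N r s)),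
    key (xpow x (2 * κ.nome r) * xpow x (-2 * κ.innerExp N r s))] with ε h1 h2 h3 h4 h5 h6 h7 h8 y hy
  exact ⟨h1 y hy, h2 y hy, h3 y hy, h4 y hy, h5 y hy, h6 y hy, h7 y hy, h8 y hy⟩

/-- The exponent in the prefactor of `[u]_R`. -/
def thetaExp (R u : ℂ) : ℂ := u ^ 2 / R - u

/-- The two Pochhammer factors are treated separately below: one cancels against a contraction, the
other belongs to `poleFactor`. -/
theorem theta_mul {R : ℂ} (hx0 : 0 < x) (hx1 : x < 1) (hR : 0 < R.re) (u : ℂ) :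
    theta x R u * qPoch (xpow x (2 * R)) (xpow x (2 * R)) ^ 2 = xpow x (thetaExp R u) *
      (qPoch (xpow x (2 * u)) (xpow x (2 * R)) *
        qPoch (xpow x (2 * (R - u))) (xpow x (2 * R))) := by
  have hq := norm_nome_lt_one hx0 hx1 hR
  have hQ := qPoch_ne_zero hq hq
  have e : xpow x (2 * R) * (xpow x (2 * u))⁻¹ = xpow x (2 * (R - u)) := by
    rw [← xpow_sub]; congr 1; ring
  unfold theta bigTheta thetaExp
  rw [e]
  generalize qPoch (xpow x (2 * R)) (xpow x (2 * R)) = Q at *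
  field_simp

theorem qPoch_zero (q : ℂ) : qPoch 0 q = 1 := by simp [qPoch]

/-- The factor in the integrand from two currents of the same colour. -/
def Screening.selfFactor (a b : ℂ) : ℂ :=
  xpow x (4 * κ.zeroCoef ρ ^ 2 * a) * theta x (κ.nome r) (a - b) *
    xpow x (thetaExp (κ.nome r) (b - a - κ.sign r)) *
    ((1 - xpow x (2 * (b - a))) * (1 - xpow x (2 * (b - a - κ.sign r))) *
    qPoch (xpow x (2 * (b - a + κ.sign r))) (xpow x (2 * κ.nome r)) *
    qPoch (xpow x (2 * (κ.nome r - (b - a - κ.sign r)))) (xpow x (2 * κ.nome r))) *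
    (qPoch (xpow x (2 * κ.nome r)) (xpow x (2 * κ.nome r)) ^ 2)⁻¹

/-- The factor in the integrand from two currents of neighbouring colours. -/
def Screening.adjFactor (N : ℕ) (a b : ℂ) : ℂ :=
  xpow x (-2 * κ.zeroCoef ρ ^ 2 * a - thetaExp (κ.nome r) (a - b - κ.outerExp N r s)) *
    qPoch (xpow x (2 * κ.nome r)) (xpow x (2 * κ.nome r)) ^ 2

/-- The contraction has the denominator `(qy; q)_∞ (q x^{-2σ} y; q)_∞` with `y = x^{2(b-a)}`. The
first product divides its numerator, the second divides the theta function at `b - a - σ`; so the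
result is entire. -/
theorem Screening.contraction_self (hN : 3 ≤ N) (hx0 : 0 < x) (hx1 : x < 1)
    (hκ : (κ.level r).re ≠ 0) (hr : ∀ n : ℕ, 1 ≤ n → bracket x (r * n) ≠ 0) (hs : s.re ≠ 0)
    (j : Fin N) (a b : ℂ) (hy : κ.SmallRatio x r s N (xpow x (2 * (b - a)))) :
    (Summable fun k => ‖expSeq (κ.contr x r s j j) k * xpow x (2 * (b - a)) ^ k‖) ∧
    xpow x (4 * κ.zeroCoef ρ ^ 2 * a) * κ.contraction x r s j j (xpow x (2 * (b - a))) *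
      (theta x (κ.nome r) (a - b) * theta x (κ.nome r) (b - a - κ.sign r)) =
      κ.selfFactor x r ρ a b := by
  have hR := κ.nome_re hκ
  have hq := norm_nome_lt_one hx0 hx1 hR
  have hQ := qPoch_ne_zero hq hq
  obtain ⟨h1, h2, h3, h4, -⟩ := hy
  obtain ⟨hS, hE⟩ := tsum_expSeq_logCoeff hq h2 h4 h1 h3
    (κ.contr_self hN hx0 hx1 hκ hr hs j)
  refine ⟨hS, ?_⟩
  have hqy := qPoch_ne_zero hq h2
  have hth := theta_mul x hx0 hx1 hR (b - a - κ.sign r)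
  rw [one_mul, qPoch_eq_mul hq (xpow x (2 * (b - a)))] at hE
  have e1 : xpow x (2 * κ.nome r) * xpow x (-2 * κ.sign r) * xpow x (2 * (b - a)) =
      xpow x (2 * κ.nome r) * xpow x (2 * (b - a - κ.sign r)) := by
    rw [mul_assoc, ← xpow_add]; congr 2; ring
  have e2 : xpow x (2 * κ.sign r) * xpow x (2 * (b - a)) = xpow x (2 * (b - a + κ.sign r)) := by
    rw [← xpow_add]; congr 1; ring
  rw [e1, e2] at hE
  rw [qPoch_eq_mul hq (xpow x (2 * (b - a - κ.sign r)))] at hth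
  change κ.contraction x r s j j (xpow x (2 * (b - a))) * _ = _ at hE
  have hE2 : κ.contraction x r s j j (xpow x (2 * (b - a))) *
      qPoch (xpow x (2 * κ.nome r) * xpow x (2 * (b - a - κ.sign r))) (xpow x (2 * κ.nome r)) =
      (1 - xpow x (2 * (b - a))) * qPoch (xpow x (2 * (b - a + κ.sign r))) (xpow x (2 * κ.nome r)) := by
    refine mul_left_cancel₀ hqy ?_
    linear_combination hE
  have hth2 : theta x (κ.nome r) (b - a - κ.sign r) = xpow x (thetaExp (κ.nome r) (b - a - κ.sign r)) *
      ((1 - xpow x (2 * (b - a - κ.sign r))) *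
        qPoch (xpow x (2 * κ.nome r) * xpow x (2 * (b - a - κ.sign r))) (xpow x (2 * κ.nome r)) *
        qPoch (xpow x (2 * (κ.nome r - (b - a - κ.sign r)))) (xpow x (2 * κ.nome r))) *
        (qPoch (xpow x (2 * κ.nome r)) (xpow x (2 * κ.nome r)) ^ 2)⁻¹ := by
    rw [← hth]; field_simp
  rw [hth2]
  unfold selfFactor
  linear_combination (xpow x (4 * κ.zeroCoef ρ ^ 2 * a) * theta x (κ.nome r) (a - b) *
    xpow x (thetaExp (κ.nome r) (b - a - κ.sign r)) * (1 - xpow x (2 * (b - a - κ.sign r))) *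
    qPoch (xpow x (2 * (κ.nome r - (b - a - κ.sign r)))) (xpow x (2 * κ.nome r)) *
    (qPoch (xpow x (2 * κ.nome r)) (xpow x (2 * κ.nome r)) ^ 2)⁻¹) * hE2

/-- The denominator of the contraction is the first of the two pole products. Its numerator is one
half of the theta function, whose other half is the second pole product. -/
theorem Screening.contraction_adj (hN : 3 ≤ N) (hx0 : 0 < x) (hx1 : x < 1)
    (hκ : (κ.level r).re ≠ 0) (hr : ∀ n : ℕ, 1 ≤ n → bracket x (r * n) ≠ 0) (hs : s.re ≠ 0)
    {j : Fin N} (hj : (j : ℕ) + 1 < N) (a b : ℂ)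
    (hy : κ.SmallRatio x r s N (xpow x (2 * (b - a)))) :
    (Summable fun k => ‖expSeq (κ.contr x r s j (finRotate N j)) k * xpow x (2 * (b - a)) ^ k‖) ∧
    xpow x (-2 * κ.zeroCoef ρ ^ 2 * a) *
      κ.contraction x r s j (finRotate N j) (xpow x (2 * (b - a))) *
      (qPoch (xpow x (2 * (κ.innerExp N r s - a + b))) (xpow x (2 * κ.nome r)) *
        qPoch (xpow x (2 * (-κ.outerExp N r s + a - b))) (xpow x (2 * κ.nome r))) =
      theta x (κ.nome r) (a - b - κ.outerExp N r s) * κ.adjFactor x r s ρ N a b := by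
  have hR := κ.nome_re hκ
  have hq := norm_nome_lt_one hx0 hx1 hR
  have hQ := qPoch_ne_zero hq hq
  obtain ⟨-, -, -, -, h5, h6, -⟩ := hy
  have hz : ‖(0 : ℂ) * xpow x (2 * (b - a))‖ < 1 := by simp
  obtain ⟨hS, hE⟩ := tsum_expSeq_logCoeff hq h5 hz h6 hz (l := κ.contr x r s j (finRotate N j))
    fun n => by rw [κ.contr_adj hN hx0 hx1 hκ hr hs hj]; ring
  refine ⟨hS, ?_⟩
  rw [zero_mul, qPoch_zero, mul_one, mul_one] at hE
  have hth := theta_mul x hx0 hx1 hR (a - b - κ.outerExp N r s)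
  have e1 : xpow x (2 * κ.innerExp N r s) * xpow x (2 * (b - a)) =
      xpow x (2 * (κ.innerExp N r s - a + b)) := by rw [← xpow_add]; congr 1; ring
  have e2 : xpow x (2 * κ.nome r) * xpow x (2 * κ.outerExp N r s) * xpow x (2 * (b - a)) =
      xpow x (2 * (κ.nome r - (a - b - κ.outerExp N r s))) := by
    rw [← xpow_add, ← xpow_add]; congr 1; ring
  have e3 : -κ.outerExp N r s + a - b = a - b - κ.outerExp N r s := by ring
  rw [e1, e2] at hE
  change κ.contraction x r s j (finRotate N j) (xpow x (2 * (b - a))) * _ = _ at hE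
  unfold adjFactor
  rw [e3, xpow_sub]
  have hp := xpow_ne_zero x (thetaExp (κ.nome r) (a - b - κ.outerExp N r s))
  generalize xpow x (-2 * κ.zeroCoef ρ ^ 2 * a) = Z
  field_simp
  linear_combination Z * xpow x (thetaExp (κ.nome r) (a - b - κ.outerExp N r s)) *
    qPoch (xpow x (2 * (a - b - κ.outerExp N r s))) (xpow x (2 * κ.nome r)) * hE - Z * hth

/-- That is, `c² = 1 - σ/R` for both families and both regimes. -/
theorem Screening.sq_zeroCoef_mul_nome (hr0 : r ≠ 0) (hr1 : r ≠ 1) (hρ : ρ ^ 2 = (r - 1) / r) :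
    κ.zeroCoef ρ ^ 2 * κ.nome r = κ.nome r - κ.sign r := by
  have hr1' : r - 1 ≠ 0 := sub_ne_zero.mpr hr1
  have hn : κ.nome r = κ.sign r * κ.level r := by
    rw [← κ.sign_mul_nome, ← mul_assoc, ← sq, κ.sign_sq, one_mul]
  rw [hn]
  cases κ
  · simp only [zeroCoef, level, hρ]; field_simp
  · simp only [zeroCoef, level, neg_sq, inv_pow, hρ]; field_simp; ring

/-- The constant by which the factor of the last and the first colour differs from the one of
neighbouring colours. -/
def Screening.wrapConst (N : ℕ) : ℂ :=
  xpow x ((κ.outerExp N r s ^ 2 - κ.innerExp N r s ^ 2) / κ.nome r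
    + κ.innerExp N r s + κ.outerExp N r s)

/-- With `d = a - b` the quadratic terms in `d` agree, and the linear terms differ by `2d (c² - 1 +
(A - B)/R)`, which vanishes because `A - B = σ`. This makes the seam of the circle of colours
invisible. -/
theorem Screening.adjFactor_wrap (hκ : (κ.level r).re ≠ 0) (hr0 : r ≠ 0) (hr1 : r ≠ 1)
    (hρ : ρ ^ 2 = (r - 1) / r) (a b : ℂ) :
    xpow x (-2 * κ.zeroCoef ρ ^ 2 * b - thetaExp (κ.nome r) (b - a + κ.innerExp N r s)) =
      κ.wrapConst x r s N *
        xpow x (-2 * κ.zeroCoef ρ ^ 2 * a - thetaExp (κ.nome r) (a - b - κ.outerExp N r s)) := by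
  have hR : κ.nome r ≠ 0 := fun h => by have := κ.nome_re hκ; rw [h] at this; simp at this
  have h1 := κ.sq_zeroCoef_mul_nome r ρ hr0 hr1 hρ
  have hc : κ.zeroCoef ρ ^ 2 = 1 - κ.sign r / κ.nome r := by
    field_simp; linear_combination h1
  have h2 : κ.innerExp N r s = κ.outerExp N r s + κ.sign r := by
    unfold innerExp outerExp sign; ring
  unfold wrapConst thetaExp
  rw [← xpow_add, hc, h2]
  congr 1
  field_simp
  ring

/-- At the seam the second pole product comes from the contraction and the first one from the theta
function, the reverse of `Screening.contraction_adj`. -/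
theorem Screening.contraction_wrap (hN : 3 ≤ N) (hx0 : 0 < x) (hx1 : x < 1)
    (hκ : (κ.level r).re ≠ 0) (hr : ∀ n : ℕ, 1 ≤ n → bracket x (r * n) ≠ 0) (hr0 : r ≠ 0)
    (hr1 : r ≠ 1) (hρ : ρ ^ 2 = (r - 1) / r) (hs : s.re ≠ 0)
    {j : Fin N} (hj : ¬ (j : ℕ) + 1 < N) (a b : ℂ)
    (hy : κ.SmallRatio x r s N (xpow x (2 * (a - b)))) :
    (Summable fun k => ‖expSeq (κ.contr x r s (finRotate N j) j) k * xpow x (2 * (a - b)) ^ k‖) ∧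
    xpow x (-2 * κ.zeroCoef ρ ^ 2 * b) *
      κ.contraction x r s (finRotate N j) j (xpow x (2 * (a - b))) *
      (qPoch (xpow x (2 * (κ.innerExp N r s - a + b))) (xpow x (2 * κ.nome r)) *
        qPoch (xpow x (2 * (-κ.outerExp N r s + a - b))) (xpow x (2 * κ.nome r))) =
      theta x (κ.nome r) (b - a + κ.innerExp N r s) *
        (κ.wrapConst x r s N * κ.adjFactor x r s ρ N a b) := by
  have hR := κ.nome_re hκ
  have hq := norm_nome_lt_one hx0 hx1 hR
  have hQ := qPoch_ne_zero hq hq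
  obtain ⟨-, -, -, -, -, -, h5, h6⟩ := hy
  have hz : ‖(0 : ℂ) * xpow x (2 * (a - b))‖ < 1 := by simp
  obtain ⟨hS, hE⟩ := tsum_expSeq_logCoeff hq h5 hz h6 hz (l := κ.contr x r s (finRotate N j) j)
    fun n => by rw [κ.contr_wrap hN hx0 hx1 hκ hr hs hj]; ring
  refine ⟨hS, ?_⟩
  rw [zero_mul, qPoch_zero, mul_one, mul_one] at hE
  have hth := theta_mul x hx0 hx1 hR (b - a + κ.innerExp N r s)
  have e1 : xpow x (-2 * κ.outerExp N r s) * xpow x (2 * (a - b)) =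
      xpow x (2 * (-κ.outerExp N r s + a - b)) := by rw [← xpow_add]; congr 1; ring
  have e2 : xpow x (2 * κ.nome r) * xpow x (-2 * κ.innerExp N r s) * xpow x (2 * (a - b)) =
      xpow x (2 * (κ.nome r - (b - a + κ.innerExp N r s))) := by
    rw [← xpow_add, ← xpow_add]; congr 1; ring
  have e3 : κ.innerExp N r s - a + b = b - a + κ.innerExp N r s := by ring
  rw [e1, e2] at hE
  change κ.contraction x r s (finRotate N j) j (xpow x (2 * (a - b))) * _ = _ at hE
  unfold adjFactor
  rw [← mul_assoc (κ.wrapConst x r s N), ← κ.adjFactor_wrap x r s ρ hκ hr0 hr1 hρ, e3, xpow_sub]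
  have hp := xpow_ne_zero x (thetaExp (κ.nome r) (b - a + κ.innerExp N r s))
  generalize xpow x (-2 * κ.zeroCoef ρ ^ 2 * b) = Z
  field_simp
  linear_combination Z * xpow x (thetaExp (κ.nome r) (b - a + κ.innerExp N r s)) *
    qPoch (xpow x (2 * (b - a + κ.innerExp N r s))) (xpow x (2 * κ.nome r)) * hE - Z * hth

theorem Screening.contraction_far (hx0 : 0 < x) (hx1 : x < 1) (hs : s.re ≠ 0) {i j : Fin N}
    (hij : i < j) (h1 : (i : ℕ) + 1 ≠ j) (h2 : ¬ ((i : ℕ) = 0 ∧ (j : ℕ) + 1 = N)) (y : ℂ) :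
    (Summable fun k => ‖expSeq (κ.contr x r s i j) k * y ^ k‖) ∧ κ.contraction x r s i j y = 1 := by
  have h0 := κ.contr_far (r := r) hx0 hx1 hs hij h1 h2
  obtain ⟨hS, hE⟩ := hasSum_expSeq (l := κ.contr x r s i j) (y := y) (h0 0)
    (by simp only [h0, zero_mul, norm_zero]; exact summable_zero)
  refine ⟨hS, ?_⟩
  unfold contraction
  rw [hE]
  simp [h0]

end

/-! ### The integrand -/

section

variable {N m : ℕ} (κ : Screening) (x : ℝ) (r s ρ : ℂ)

/-- The constant factors of the integrand. -/
def Screening.scalarConst (N m : ℕ) (v : Sector N) : ℂ :=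
  (∏ p : Fin N × Fin m, κ.zeroConst x s ρ p.1 v) *
    pairProd (fun p q : Fin N × Fin m => xpow x (zeroShift N s p.1 *
      (κ.zeroCoef ρ ^ 2 * weightInner (zeroWeight p.1) (alpha q.1)))) (orderedPairs N m) *
    ∏ t : Fin N, ∏ _i : Fin m, ∏ _j : Fin m, if (t : ℕ) + 1 < N then 1 else κ.wrapConst x r s N

/-- The part of the integrand that does not involve the oscillators. -/
def Screening.scalarFactor (u : Fin N → Fin m → ℂ) (v : Sector N) : ℂ :=
  (∏ t, ∏ i, κ.zeroPower x ρ t (u t i) v) *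
    (∏ t, ∏ i, ∏ j ∈ Finset.Ioi i, κ.selfFactor x r ρ (u t i) (u t j)) *
    ∏ t : Fin N, ∏ i, ∏ j, κ.adjFactor x r s ρ N (u t i) (u (finRotate N t) j)

/-- The integrand times `poleFactor 0`, in the form in which it is entire. -/
def Screening.entireIntegrand (ϑ : (Fin N → ℂ) → Sector N → ℂ) (v : Sector N)
    (μ : OscIndex N →₀ ℕ) (v' : Sector N) (ν : OscIndex N →₀ ℕ) (u : Fin N → Fin m → ℂ) : ℂ :=
  if v = v' then κ.scalarConst x r s ρ N m v * (ϑ (fun t => ∑ i, u t i) v *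
    κ.scalarFactor x r s ρ u v * κ.normalElement x r s ν μ u) else 0

theorem weightInner_alpha_far (hN : 3 ≤ N) {i j : Fin N} (hij : i < j) (h1 : (i : ℕ) + 1 ≠ j)
    (h2 : ¬ ((i : ℕ) = 0 ∧ (j : ℕ) + 1 = N)) : weightInner (alpha i) (alpha j) = 0 := by
  have hj := j.isLt
  rw [weightInner_alpha hN]
  rw [Fin.lt_def] at hij
  have a1 : i ≠ j := by rw [Ne, Fin.ext_iff]; omega
  have a2 : i ≠ finRotate N j := by rw [Ne, Fin.ext_iff, val_finRotate]; split_ifs <;> omega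
  have a3 : finRotate N i ≠ j := by rw [Ne, Fin.ext_iff, val_finRotate]; split_ifs <;> omega
  simp only [if_neg a1, if_neg a2, if_neg a3]; ring

theorem weightInner_alpha_adj (hN : 3 ≤ N) (i : Fin N) :
    weightInner (alpha i) (alpha (finRotate N i)) = -1 ∧
      weightInner (alpha (finRotate N i)) (alpha i) = -1 ∧ weightInner (alpha i) (alpha i) = 2 := by
  have hi := i.isLt
  have a1 : i ≠ finRotate N i := by rw [Ne, Fin.ext_iff, val_finRotate]; split_ifs <;> omega
  have a2 : i ≠ finRotate N (finRotate N i) := by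
    rw [Ne, Fin.ext_iff, val_finRotate, val_finRotate]; split_ifs <;> omega
  simp only [weightInner_alpha hN]
  simp only [if_neg a1, if_neg a1.symm, if_neg a2, if_neg a2.symm, if_true]
  norm_num

variable {κ x r s ρ}

theorem summable_contraction (hN : 3 ≤ N) (hx0 : 0 < x) (hx1 : x < 1)
    (hκ : (κ.level r).re ≠ 0) (hr : ∀ n : ℕ, 1 ≤ n → bracket x (r * n) ≠ 0) (hr0 : r ≠ 0)
    (hr1 : r ≠ 1) (hρ : ρ ^ 2 = (r - 1) / r) (hs : s.re ≠ 0)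
    {u : Fin N → Fin m → ℂ} (hu : ∀ p q : Fin N × Fin m, Precedes p q →
      κ.SmallRatio x r s N (xpow x (2 * (u q.1 q.2 - u p.1 p.2)))) :
    (orderedPairs N m).Pairwise fun p q => Summable fun k =>
      ‖expSeq (κ.contr x r s p.1 q.1) k * xpow x (2 * (u q.1 q.2 - u p.1 p.2)) ^ k‖ := by
  refine pairwise_orderedPairs.imp fun {p q} h => ?_
  have hsm := hu p q h
  rcases h with h | ⟨h, -⟩
  · by_cases h1 : (p.1 : ℕ) + 1 = q.1
    · have hp : (p.1 : ℕ) + 1 < N := by have := q.1.isLt; omega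
      have e : q.1 = finRotate N p.1 := Fin.ext (by rw [finRotate_val_of_lt hp, h1])
      have := (κ.contraction_adj x r s ρ hN hx0 hx1 hκ hr hs hp _ _ hsm).1
      rwa [← e] at this
    · by_cases h2 : (p.1 : ℕ) = 0 ∧ (q.1 : ℕ) + 1 = N
      · have hq : ¬ (q.1 : ℕ) + 1 < N := by omega
        have e : p.1 = finRotate N q.1 := Fin.ext (by rw [finRotate_val_of_not_lt hq, h2.1])
        have := (κ.contraction_wrap x r s ρ hN hx0 hx1 hκ hr hr0 hr1 hρ hs hq _ _ hsm).1
        rwa [← e] at this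
      · exact (κ.contraction_far x r s hx0 hx1 hs h h1 h2 _).1
  · obtain ⟨t, i⟩ := p
    obtain ⟨t', j⟩ := q
    obtain rfl : t = t' := h
    exact (κ.contraction_self x r s ρ hN hx0 hx1 hκ hr hs t _ _ hsm).1

/-- All cancellations, pair by pair. The identity is multiplied out, so no theta function or pole
product has to be nonzero. -/
theorem scalarPart_mul (hN : 3 ≤ N) (hx0 : 0 < x) (hx1 : x < 1)
    (hκ : (κ.level r).re ≠ 0) (hr : ∀ n : ℕ, 1 ≤ n → bracket x (r * n) ≠ 0) (hr0 : r ≠ 0)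
    (hr1 : r ≠ 1) (hρ : ρ ^ 2 = (r - 1) / r) (hs : s.re ≠ 0)
    {u : Fin N → Fin m → ℂ} (hu : ∀ p q : Fin N × Fin m, Precedes p q →
      κ.SmallRatio x r s N (xpow x (2 * (u q.1 q.2 - u p.1 p.2)))) (v : Sector N) :
    κ.scalarPart x r s ρ u v * numerator κ x r u * poleFactor κ x r s 0 u =
      denominator κ x r s u * (κ.scalarConst x r s ρ N m v * κ.scalarFactor x r s ρ u v) := by
  set f : Fin N × Fin m → Fin N × Fin m → ℂ := fun p q =>
    xpow x (2 * u p.1 p.2 * (κ.zeroCoef ρ ^ 2 * weightInner (alpha p.1) (alpha q.1))) *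
      κ.contraction x r s p.1 q.1 (xpow x (2 * (u q.1 q.2 - u p.1 p.2))) with hf
  have h1 : pairProd (fun p q : Fin N × Fin m => κ.zeroChar x s ρ p.1 (u p.1 p.2) (alpha q.1) *
      κ.contraction x r s p.1 q.1 (xpow x (2 * (u q.1 q.2 - u p.1 p.2)))) (orderedPairs N m) =
      pairProd (fun p q : Fin N × Fin m => xpow x (zeroShift N s p.1 *
      (κ.zeroCoef ρ ^ 2 * weightInner (zeroWeight p.1) (alpha q.1)))) (orderedPairs N m) *
      pairProd f (orderedPairs N m) := by
    rw [← pairProd_mul]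
    congr 1
    funext p q
    rw [Screening.zeroChar, mul_assoc]
  have h2 := pairProd_orderedPairs hN f (fun p q h a b => by
    simp only [hf]
    rw [weightInner_alpha_far hN h a b, (κ.contraction_far x r s hx0 hx1 hs h a b _).2]
    simp)
  have h3 : (∏ t, ∏ i, ∏ j ∈ Finset.Ioi i, f (t, i) (t, j)) * numerator κ x r u =
      ∏ t, ∏ i, ∏ j ∈ Finset.Ioi i, κ.selfFactor x r ρ (u t i) (u t j) := by
    unfold numerator
    simp only [← Finset.prod_mul_distrib]
    refine Finset.prod_congr rfl fun t _ => Finset.prod_congr rfl fun i _ =>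
      Finset.prod_congr rfl fun j hj => ?_
    have hsm := hu (t, i) (t, j) (Or.inr ⟨rfl, Finset.mem_Ioi.mp hj⟩)
    rw [← (κ.contraction_self x r s ρ hN hx0 hx1 hκ hr hs t _ _ hsm).2]
    simp only [hf]
    rw [(weightInner_alpha_adj hN t).2.2]
    have e1 : u t j - u t i + 1 - 2 * κ.regime r = u t j - u t i - κ.sign r := by
      unfold Screening.sign; ring
    have e2 : 2 * u t i * (κ.zeroCoef ρ ^ 2 * 2) = 4 * κ.zeroCoef ρ ^ 2 * u t i := by ring
    rw [e1, e2]
  have h4 : (∏ t : Fin N, ∏ i, ∏ j, if (t : ℕ) + 1 < N then f (t, i) (finRotate N t, j)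
        else f (finRotate N t, i) (t, j)) * poleFactor κ x r s 0 u =
      denominator κ x r s u * ((∏ t : Fin N, ∏ _i : Fin m, ∏ _j : Fin m,
        if (t : ℕ) + 1 < N then 1 else κ.wrapConst x r s N) *
        ∏ t : Fin N, ∏ i, ∏ j, κ.adjFactor x r s ρ N (u t i) (u (finRotate N t) j)) := by
    unfold poleFactor denominator
    simp only [← Finset.prod_mul_distrib]
    refine Finset.prod_congr rfl fun t _ => ?_
    obtain ⟨w1, w2, -⟩ := weightInner_alpha_adj hN t
    by_cases ht : (t : ℕ) + 1 < N
    · simp only [if_pos ht]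
      refine Finset.prod_congr rfl fun i _ => Finset.prod_congr rfl fun j _ => ?_
      have hsm := hu (t, i) (finRotate N t, j)
        (Or.inl (by rw [Fin.lt_def, finRotate_val_of_lt ht]; exact Nat.lt_succ_self _))
      have key := (κ.contraction_adj x r s ρ hN hx0 hx1 hκ hr hs ht _ _ hsm).2
      rw [one_mul, ← key]
      simp only [hf]
      rw [w1]
      have e2 : 2 * u t i * (κ.zeroCoef ρ ^ 2 * -1) = -2 * κ.zeroCoef ρ ^ 2 * u t i := by ring
      rw [e2, add_zero, add_zero]
    · simp only [if_neg ht]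
      simp only [Finset.prod_mul_distrib]
      -- At the seam the outer index belongs to the first colour. Exchanging the indices matches the
      -- labelling in `poleFactor`, where the outer index belongs to colour `t`.
      rw [Finset.prod_comm (f := fun i j : Fin m => f (finRotate N t, i) (t, j)),
        Finset.prod_comm (f := fun i j : Fin m =>
          theta x (κ.nome r) (u (finRotate N t) i - u t j + κ.innerExp N r s))]
      simp only [← Finset.prod_mul_distrib]
      refine Finset.prod_congr rfl fun i _ => Finset.prod_congr rfl fun j _ => ?_
      have hsm := hu (finRotate N t, j) (t, i)
        (Or.inl (by rw [Fin.lt_def, finRotate_val_of_not_lt ht]; simp only; omega))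
      have key := (κ.contraction_wrap x r s ρ hN hx0 hx1 hκ hr hr0 hr1 hρ hs ht _ _ hsm).2
      simp only at key
      rw [← key]
      simp only [hf]
      rw [w2]
      have e2 : 2 * u (finRotate N t) j * (κ.zeroCoef ρ ^ 2 * -1) =
        -2 * κ.zeroCoef ρ ^ 2 * u (finRotate N t) j := by ring
      rw [e2, add_zero, add_zero]
  have h5 : (∏ p : Fin N × Fin m, κ.zeroFactor x s ρ p.1 (u p.1 p.2) v) =
      (∏ p : Fin N × Fin m, κ.zeroConst x s ρ p.1 v) * ∏ t, ∏ i, κ.zeroPower x ρ t (u t i) v := by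
    simp_rw [κ.zeroFactor_eq x s ρ hN]
    rw [Finset.prod_mul_distrib, Fintype.prod_prod_type (fun p : Fin N × Fin m =>
      κ.zeroPower x ρ p.1 (u p.1 p.2) v)]
  unfold Screening.scalarPart Screening.scalarConst Screening.scalarFactor
  rw [h1, h2, h5, ← h3]
  linear_combination ((∏ p : Fin N × Fin m, κ.zeroConst x s ρ p.1 v) *
    (∏ t, ∏ i, κ.zeroPower x ρ t (u t i) v) *
    pairProd (fun p q : Fin N × Fin m => xpow x (zeroShift N s p.1 *
      (κ.zeroCoef ρ ^ 2 * weightInner (zeroWeight p.1) (alpha q.1)))) (orderedPairs N m) *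
    (∏ t, ∏ i, ∏ j ∈ Finset.Ioi i, f (t, i) (t, j)) * numerator κ x r u) * h4

theorem productElement_mul (hN : 3 ≤ N) (hx0 : 0 < x) (hx1 : x < 1)
    (hκ : (κ.level r).re ≠ 0) (hr : ∀ n : ℕ, 1 ≤ n → bracket x (r * n) ≠ 0) (hr0 : r ≠ 0)
    (hr1 : r ≠ 1) (hρ : ρ ^ 2 = (r - 1) / r) (hs : s.re ≠ 0)
    {u : Fin N → Fin m → ℂ} (hu : ∀ p q : Fin N × Fin m, Precedes p q →
      κ.SmallRatio x r s N (xpow x (2 * (u q.1 q.2 - u p.1 p.2))))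
    (ϑ : (Fin N → ℂ) → Sector N → ℂ) (v v' : Sector N) (μ ν : OscIndex N →₀ ℕ) :
    productElement κ x r s ρ ϑ v μ v' ν u * numerator κ x r u * poleFactor κ x r s 0 u =
      denominator κ x r s u * κ.entireIntegrand x r s ρ ϑ v μ v' ν u := by
  rw [productElement_eq κ x r s ρ hN ϑ u v v' μ ν
    (summable_contraction hN hx0 hx1 hκ hr hr0 hr1 hρ hs hu), Screening.entireIntegrand]
  split_ifs
  · linear_combination (ϑ (fun t => ∑ i, u t i) v * κ.normalElement x r s ν μ u) *
      scalarPart_mul hN hx0 hx1 hκ hr hr0 hr1 hρ hs hu v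
  · ring

theorem smallRatio_of_mem_orderedDomain (κ : Screening) (r s : ℂ) :
    ∀ᶠ ε in 𝓝[>] (0 : ℝ), ∀ u ∈ orderedDomain N m x ε, ∀ p q : Fin N × Fin m, Precedes p q →
      κ.SmallRatio x r s N (xpow x (2 * (u q.1 q.2 - u p.1 p.2))) := by
  filter_upwards [κ.eventually_smallRatio x r s N] with ε hε u hu p q hpq
  refine hε _ ?_
  have h := hu p.1 p.2 q.1 q.2 hpq
  rw [mul_sub, xpow_sub, norm_mul, norm_inv, ← div_eq_mul_inv, div_lt_iff₀
    (norm_pos_iff.mpr (xpow_ne_zero _ _))]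
  exact h

/-! ### Analyticity -/

theorem analyticAt_coord (t : Fin N) (i : Fin m) (u : Fin N → Fin m → ℂ) :
    AnalyticAt ℂ (fun u : Fin N → Fin m → ℂ => u t i) u :=
  ((ContinuousLinearMap.proj (R := ℂ) (φ := fun _ : Fin m => ℂ) i).comp
    (ContinuousLinearMap.proj (R := ℂ) (φ := fun _ : Fin N => Fin m → ℂ) t)).analyticAt u

theorem analyticAt_comp_of_differentiable {E : Type*} [NormedAddCommGroup E] [NormedSpace ℂ E]
    {f : ℂ → ℂ} (hf : Differentiable ℂ f) {g : E → ℂ} {z : E} (hg : AnalyticAt ℂ g z) :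
    AnalyticAt ℂ (fun z => f (g z)) z :=
  (hf.analyticAt (g z)).fun_comp hg

theorem analyticAt_xpow {E : Type*} [NormedAddCommGroup E] [NormedSpace ℂ E] {g : E → ℂ} {z : E}
    (hg : AnalyticAt ℂ g z) : AnalyticAt ℂ (fun z => xpow x (g z)) z :=
  analyticAt_comp_of_differentiable (differentiable_xpow x) hg

theorem analyticAt_selfFactor (hx0 : 0 < x) (hx1 : x < 1) (hκ : (κ.level r).re ≠ 0)
    {E : Type*} [NormedAddCommGroup E] [NormedSpace ℂ E] {f g : E → ℂ} {z : E}
    (hf : AnalyticAt ℂ f z) (hg : AnalyticAt ℂ g z) :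
    AnalyticAt ℂ (fun z => κ.selfFactor x r ρ (f z) (g z)) z := by
  have hR := κ.nome_re hκ
  have hq := norm_nome_lt_one hx0 hx1 hR
  have hP := differentiable_qPoch hq
  have hba : AnalyticAt ℂ (fun z => g z - f z) z := hg.sub hf
  have hbs : AnalyticAt ℂ (fun z => g z - f z - κ.sign r) z := hba.sub analyticAt_const
  unfold Screening.selfFactor thetaExp
  refine AnalyticAt.mul (AnalyticAt.mul (AnalyticAt.mul (AnalyticAt.mul ?_ ?_) ?_)
    (AnalyticAt.mul (AnalyticAt.mul (AnalyticAt.mul ?_ ?_) ?_) ?_)) analyticAt_const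
  · exact analyticAt_xpow (analyticAt_const.mul hf)
  · exact analyticAt_comp_of_differentiable (differentiable_theta hx0 hx1 hR) (hf.sub hg)
  · refine analyticAt_xpow (((hbs.pow 2).fun_div analyticAt_const ?_).sub hbs)
    intro h; rw [h] at hR; simp at hR
  · exact analyticAt_const.sub (analyticAt_xpow (analyticAt_const.mul hba))
  · exact analyticAt_const.sub (analyticAt_xpow (analyticAt_const.mul hbs))
  · exact analyticAt_comp_of_differentiable hP
      (analyticAt_xpow (analyticAt_const.mul (hba.add analyticAt_const)))
  · exact analyticAt_comp_of_differentiable hP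
      (analyticAt_xpow (analyticAt_const.mul (analyticAt_const.sub hbs)))

theorem analyticAt_adjFactor (hκ : (κ.level r).re ≠ 0)
    {E : Type*} [NormedAddCommGroup E] [NormedSpace ℂ E] {f g : E → ℂ} {z : E}
    (hf : AnalyticAt ℂ f z) (hg : AnalyticAt ℂ g z) :
    AnalyticAt ℂ (fun z => κ.adjFactor x r s ρ N (f z) (g z)) z := by
  have hR := κ.nome_re hκ
  have hab : AnalyticAt ℂ (fun z => f z - g z - κ.outerExp N r s) z :=
    (hf.sub hg).sub analyticAt_const
  unfold Screening.adjFactor thetaExp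
  refine AnalyticAt.mul (analyticAt_xpow ((analyticAt_const.mul hf).sub
    (((hab.pow 2).fun_div analyticAt_const ?_).sub hab))) analyticAt_const
  intro h; rw [h] at hR; simp at hR

theorem analyticAt_normalElement (ν μ : OscIndex N →₀ ℕ) (u : Fin N → Fin m → ℂ) :
    AnalyticAt ℂ (κ.normalElement x r s ν μ) u := by
  have hfin := finite_normalProduct x r s κ (orderedPairs N m) mem_orderedPairs ν μ
  have : (κ.normalElement x r s ν μ : (Fin N → Fin m → ℂ) → ℂ) = fun u => ∑ ab ∈ hfin.toFinset,
      oscElement ν μ (κ.normalProduct x r s (orderedPairs N m) ab.1 ab.2) *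
      ∏ p : Fin N × Fin m, xpow x (2 * u p.1 p.2 * ((ab.1 p : ℂ) - (ab.2 p : ℂ))) := by
    funext u
    unfold Screening.normalElement
    refine tsum_eq_sum fun ab hab => ?_
    rw [Set.Finite.mem_toFinset] at hab
    rw [not_not.mp hab, zero_mul]
  rw [this]
  refine Finset.analyticAt_fun_sum _ fun ab _ => analyticAt_const.mul
    (Finset.analyticAt_fun_prod _ fun p _ => analyticAt_xpow ?_)
  exact (analyticAt_const.mul (analyticAt_coord p.1 p.2 u)).mul analyticAt_const

theorem analyticAt_entireIntegrand (hx0 : 0 < x) (hx1 : x < 1) (hκ : (κ.level r).re ≠ 0)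
    {ϑ : (Fin N → ℂ) → Sector N → ℂ} (hϑ : ∀ v, Differentiable ℂ fun u => ϑ u v)
    (v v' : Sector N) (μ ν : OscIndex N →₀ ℕ) (u : Fin N → Fin m → ℂ) :
    AnalyticAt ℂ (κ.entireIntegrand x r s ρ ϑ v μ v' ν) u := by
  unfold Screening.entireIntegrand
  split_ifs
  · refine analyticAt_const.mul ((AnalyticAt.mul ?_ ?_).mul (analyticAt_normalElement ν μ u))
    · refine AnalyticAt.fun_comp (g := fun w => ϑ w v)
        (f := fun u : Fin N → Fin m → ℂ => fun t => ∑ i, u t i)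
        (analyticAt_of_differentiable (hϑ v) _) ?_
      exact analyticAt_pi_iff.mpr fun t =>
        Finset.analyticAt_fun_sum _ fun i _ => analyticAt_coord t i u
    · unfold Screening.scalarFactor
      refine AnalyticAt.mul (AnalyticAt.mul ?_ ?_) ?_
      · refine Finset.analyticAt_fun_prod _ fun t _ => Finset.analyticAt_fun_prod _ fun i _ => ?_
        exact analyticAt_xpow ((analyticAt_const.mul (analyticAt_coord t i u)).mul analyticAt_const)
      · exact Finset.analyticAt_fun_prod _ fun t _ => Finset.analyticAt_fun_prod _ fun i _ =>
          Finset.analyticAt_fun_prod _ fun j _ => analyticAt_selfFactor hx0 hx1 hκ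
            (analyticAt_coord t i u) (analyticAt_coord t j u)
      · exact Finset.analyticAt_fun_prod _ fun t _ => Finset.analyticAt_fun_prod _ fun i _ =>
          Finset.analyticAt_fun_prod _ fun j _ => analyticAt_adjFactor hκ
            (analyticAt_coord t i u) (analyticAt_coord _ j u)
  · exact analyticAt_const

theorem analyticAt_poleFactor (hx0 : 0 < x) (hx1 : x < 1) (hκ : (κ.level r).re ≠ 0) (δ : ℂ)
    (u : Fin N → Fin m → ℂ) : AnalyticAt ℂ (poleFactor κ x r s δ) u := by
  have hP := differentiable_qPoch (norm_nome_lt_one hx0 hx1 (κ.nome_re hκ))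
  unfold poleFactor
  refine Finset.analyticAt_fun_prod _ fun t _ => Finset.analyticAt_fun_prod _ fun i _ =>
    Finset.analyticAt_fun_prod _ fun j _ => ?_
  have hi := analyticAt_coord t i u
  have hj := analyticAt_coord (finRotate N t) j u
  exact (analyticAt_comp_of_differentiable hP
      (analyticAt_xpow (analyticAt_const.mul ((analyticAt_const.sub hi).add hj)))).mul
    (analyticAt_comp_of_differentiable hP
      (analyticAt_xpow (analyticAt_const.mul ((analyticAt_const.add hi).sub hj))))

theorem analyticAt_denominator (hx0 : 0 < x) (hx1 : x < 1) (hκ : (κ.level r).re ≠ 0)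
    (u : Fin N → Fin m → ℂ) : AnalyticAt ℂ (denominator κ x r s) u := by
  have hT := differentiable_theta hx0 hx1 (κ.nome_re hκ)
  unfold denominator
  refine Finset.analyticAt_fun_prod _ fun t _ => Finset.analyticAt_fun_prod _ fun i _ =>
    Finset.analyticAt_fun_prod _ fun j _ => ?_
  split_ifs
  · exact analyticAt_comp_of_differentiable hT
      (((analyticAt_coord t i u).sub (analyticAt_coord _ j u)).sub analyticAt_const)
  · exact analyticAt_comp_of_differentiable hT
      (((analyticAt_coord _ i u).sub (analyticAt_coord t j u)).add analyticAt_const)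

theorem dense_denominator_ne_zero (hN : 3 ≤ N) (hx0 : 0 < x) (hx1 : x < 1)
    (hκ : (κ.level r).re ≠ 0) : Dense {u : Fin N → Fin m → ℂ | denominator κ x r s u ≠ 0} := by
  have hR := κ.nome_re hκ
  have hT := differentiable_theta hx0 hx1 hR
  have hne : ∀ t : Fin N, t ≠ finRotate N t := fun t => by
    have := t.isLt
    rw [Ne, Fin.ext_iff, val_finRotate]; split_ifs <;> omega
  have hth := theta_half_ne_zero hx0 hx1 hR
  refine dense_setOf_ne_zero (fun u _ => analyticAt_denominator hx0 hx1 hκ u) ?_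
  have han : ∀ (t : Fin N) (i j : Fin m), AnalyticOnNhd ℂ (fun u : Fin N → Fin m → ℂ =>
      if (t : ℕ) + 1 < N then theta x (κ.nome r) (u t i - u (finRotate N t) j - κ.outerExp N r s)
      else theta x (κ.nome r) (u (finRotate N t) i - u t j + κ.innerExp N r s)) Set.univ := by
    intro t i j u _
    split_ifs
    · exact analyticAt_comp_of_differentiable hT
        (((analyticAt_coord t i u).sub (analyticAt_coord _ j u)).sub analyticAt_const)
    · exact analyticAt_comp_of_differentiable hT
        (((analyticAt_coord _ i u).sub (analyticAt_coord t j u)).add analyticAt_const)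
  refine exists_prod_ne_zero _ (fun t _ u _ => Finset.analyticAt_fun_prod _ fun i _ =>
    Finset.analyticAt_fun_prod _ fun j _ => han t i j u trivial) fun t _ => ?_
  refine exists_prod_ne_zero _ (fun i _ u _ => Finset.analyticAt_fun_prod _ fun j _ =>
    han t i j u trivial) fun i _ => ?_
  refine exists_prod_ne_zero _ (fun j _ => han t i j) fun j _ => ?_
  split_ifs
  -- With all other colours at zero, this choice makes the argument of the theta function equal to
  -- `R / 2`.
  · refine ⟨Pi.single t fun _ => κ.outerExp N r s + κ.nome r / 2, ?_⟩
    rw [Pi.single_eq_same, Pi.single_eq_of_ne (hne t).symm, Pi.zero_apply, sub_zero,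
      add_sub_cancel_left]
    exact hth
  · refine ⟨Pi.single (finRotate N t) fun _ => κ.nome r / 2 - κ.innerExp N r s, ?_⟩
    rw [Pi.single_eq_same, Pi.single_eq_of_ne (hne t), Pi.zero_apply, sub_zero, sub_add_cancel]
    exact hth

theorem isOpen_orderedDomain (N m : ℕ) (x ε : ℝ) : IsOpen (orderedDomain N m x ε) := by
  have : orderedDomain N m x ε = ⋂ (t) (i) (t') (i') (_ : t < t' ∨ (t = t' ∧ i < i')),
      {u : Fin N → Fin m → ℂ | ‖xpow x (2 * u t' i')‖ < ε * ‖xpow x (2 * u t i)‖} := by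
    ext u; simp [orderedDomain]
  rw [this]
  have hc : ∀ t i, Continuous fun u : Fin N → Fin m → ℂ => ‖xpow x (2 * u t i)‖ := fun t i =>
    ((differentiable_xpow x).continuous.comp (continuous_const.mul
      ((continuous_apply i).comp (continuous_apply t)))).norm
  exact isOpen_iInter_of_finite fun t => isOpen_iInter_of_finite fun i =>
    isOpen_iInter_of_finite fun t' => isOpen_iInter_of_finite fun i' =>
    isOpen_iInter_of_finite fun _ => isOpen_lt (hc t' i') (continuous_const.mul (hc t i))

theorem orderedDomain_nonempty (hx0 : 0 < x) (hx1 : x < 1) {ε : ℝ} (hε : 0 < ε) :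
    (orderedDomain N m x ε).Nonempty := by
  have hlog := Real.log_neg hx0 hx1
  obtain ⟨K, hK⟩ := exists_nat_gt (Real.log ε / (2 * Real.log x))
  have hK2 : (2 * K) * Real.log x < Real.log ε := by
    rw [div_lt_iff_of_neg (by linarith)] at hK; linarith
  -- Successive variables in the lexicographic order are spaced by `K`, and `x^{2K} < ε`.
  refine ⟨fun t i => ((K * (t * m + i) : ℕ) : ℂ), fun t i t' i' h => ?_⟩
  have hlt : (t : ℕ) * m + i + 1 ≤ t' * m + i' := by
    rcases h with h | ⟨rfl, h⟩
    · have h2 : ((t : ℕ) + 1) * m ≤ t' * m := Nat.mul_le_mul_right m h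
      have := i.isLt
      nlinarith
    · have : (i : ℕ) < i' := h
      omega
  simp only [norm_xpow]
  rw [← Real.exp_log hε, ← Real.exp_add, Real.exp_lt_exp]
  have hlt' : ((t : ℕ) : ℝ) * m + (i : ℕ) + 1 ≤ (t' : ℕ) * m + (i' : ℕ) := by exact_mod_cast hlt
  have e : ∀ a : ℕ, ((2 : ℂ) * ((a : ℕ) : ℂ)).re = 2 * a := by
    intro a
    have : (2 : ℂ) * ((a : ℕ) : ℂ) = ((2 * a : ℝ) : ℂ) := by push_cast; ring
    rw [this, Complex.ofReal_re]
  rw [e, e]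
  push_cast
  have hKlog : (K : ℝ) * Real.log x ≤ 0 :=
    mul_nonpos_of_nonneg_of_nonpos (Nat.cast_nonneg _) hlog.le
  nlinarith

end

/-! ### Matrix elements of the integrals -/

section

variable {N m : ℕ} {κ : Screening} {x : ℝ} {r s ρ : ℂ}

theorem torusMean_congr {Φ Ψ : (Fin N → Fin m → ℂ) → ℂ}
    (h : ∀ u : Fin N → Fin m → ℂ, (∀ t i, (u t i).re = 0) → Φ u = Ψ u) :
    torusMean x Φ = torusMean x Ψ := by
  unfold torusMean
  congr 2
  funext θ
  refine h _ fun t i => ?_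
  have : Complex.I * (θ t i : ℂ) / (2 * (Real.log x : ℂ)) =
      ((θ t i / (2 * Real.log x) : ℝ) : ℂ) * Complex.I := by push_cast; ring
  rw [this, Complex.re_ofReal_mul, Complex.I_re, mul_zero]

/-- On the torus the contour condition says that every argument of a Pochhammer product has modulus
less than one. -/
theorem poleFactor_ne_zero (hx0 : 0 < x) (hx1 : x < 1) (hκ : (κ.level r).re ≠ 0) {δ : ℂ}
    (hs : (s, δ) ∈ κ.contourDomain N r) {u : Fin N → Fin m → ℂ} (hu : ∀ t i, (u t i).re = 0) :
    poleFactor κ x r s δ u ≠ 0 := by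
  have hq := norm_nome_lt_one hx0 hx1 (κ.nome_re hκ)
  obtain ⟨-, -, h1, h2⟩ := hs
  unfold poleFactor
  refine Finset.prod_ne_zero_iff.mpr fun t _ => Finset.prod_ne_zero_iff.mpr fun i _ =>
    Finset.prod_ne_zero_iff.mpr fun j _ => mul_ne_zero ?_ ?_
  · refine qPoch_ne_zero hq ((norm_xpow_lt_one hx0 hx1).mpr ?_)
    simp only [Complex.re_ofNat, Complex.mul_re, Complex.add_re, Complex.sub_re, Complex.im_ofNat,
      zero_mul, sub_zero, hu] at h1 ⊢
    linarith
  · refine qPoch_ne_zero hq ((norm_xpow_lt_one hx0 hx1).mpr ?_)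
    simp only [Complex.re_ofNat, Complex.mul_re, Complex.add_re, Complex.sub_re, Complex.im_ofNat,
      Complex.neg_re, zero_mul, sub_zero, hu] at h2 ⊢
    linarith

/-- Any admissible continuation agrees on the torus with the explicit quotient, and the quotient is
itself admissible. This gives existence and uniqueness at the same time. -/
theorem isMatrixElement_iff (hN : 3 ≤ N) (hx0 : 0 < x) (hx1 : x < 1)
    (hκ : (κ.level r).re ≠ 0) (hr : ∀ n : ℕ, 1 ≤ n → bracket x (r * n) ≠ 0) (hr0 : r ≠ 0)
    (hr1 : r ≠ 1) (hρ : ρ ^ 2 = (r - 1) / r) {δ : ℂ} (hs : (s, δ) ∈ κ.contourDomain N r)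
    {ϑ : (Fin N → ℂ) → Sector N → ℂ} (hϑ : ∀ v, Differentiable ℂ fun u => ϑ u v)
    (v v' : Sector N) (μ ν : OscIndex N →₀ ℕ) (c : ℂ) :
    IsMatrixElement κ x r ρ ϑ m s δ v μ v' ν c ↔ c = torusMean x fun u : Fin N → Fin m → ℂ =>
      κ.entireIntegrand x r s ρ ϑ v μ v' ν u / poleFactor κ x r s δ u := by
  have hs0 : s.re ≠ 0 := hs.1.ne'
  have hG := analyticAt_entireIntegrand (m := m) (s := s) (ρ := ρ) hx0 hx1 hκ hϑ v v' μ ν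
  have hP := analyticAt_poleFactor (N := N) (m := m) (s := s) hx0 hx1 hκ δ
  have hD := analyticAt_denominator (N := N) (m := m) (s := s) hx0 hx1 hκ
  have hsmall := smallRatio_of_mem_orderedDomain (N := N) (m := m) (x := x) κ r s
  have hdense := dense_denominator_ne_zero (N := N) (m := m) (s := s) hN hx0 hx1 hκ
  have hmul := fun (u : Fin N → Fin m → ℂ) hu =>
    productElement_mul hN hx0 hx1 hκ hr hr0 hr1 hρ hs0 (u := u) hu ϑ v v' μ ν
  constructor
  · rintro ⟨W, Φ, hWo, hWc, hWt, hΦ, hne, hev, rfl⟩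
    refine torusMean_congr fun u hu => ?_
    rw [eq_div_iff (poleFactor_ne_zero hx0 hx1 hκ hs hu)]
    obtain ⟨ε, ⟨h1, h2⟩, hε⟩ := ((hev.and hsmall).and self_mem_nhdsWithin).exists
    obtain ⟨u₀, hu₀W, hu₀⟩ := hne ε hε
    -- The identity theorem on `W` is applied to products with `denominator`, which are analytic
    -- everywhere on `W`.
    have heq : Set.EqOn (fun u => denominator κ x r s u * poleFactor κ x r s δ u * Φ u)
        (fun u => denominator κ x r s u * κ.entireIntegrand x r s ρ ϑ v μ v' ν u) W := by
      refine AnalyticOnNhd.eqOn_of_preconnected_of_eventuallyEq (𝕜 := ℂ) (z₀ := u₀)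
        (fun z hz => ((hD z).mul (hP z)).mul (hΦ z hz)) (fun z hz => (hD z).mul (hG z)) hWc hu₀W ?_
      filter_upwards [(hWo.inter (isOpen_orderedDomain N m x ε)).mem_nhds ⟨hu₀W, hu₀⟩] with z hz
      rw [h1 z hz, hmul z (h2 z hz.2)]
    by_contra hcon
    -- If the two sides differed at a point of the torus, they would differ on a neighbourhood,
    -- which contains a point with nonzero denominator; there `heq` gives a contradiction.
    have hcont : ContinuousAt (fun u => Φ u * poleFactor κ x r s δ u -
        κ.entireIntegrand x r s ρ ϑ v μ v' ν u) u :=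
      (((hΦ u (hWt hu)).continuousAt.mul (hP u).continuousAt).sub (hG u).continuousAt)
    have hev2 := (hcont.eventually_ne (sub_ne_zero.mpr hcon)).and (hWo.mem_nhds (hWt hu))
    obtain ⟨z, hz, hzD⟩ := hdense.inter_nhds_nonempty hev2
    have h3 := heq hzD.2
    simp only at h3
    refine hzD.1 (mul_left_cancel₀ hz ?_)
    linear_combination h3
  · rintro rfl
    -- The quotient is analytic off the zeros of the pole factor. That set is connected and dense,
    -- so it meets every ordered domain.
    refine ⟨{u | poleFactor κ x r s δ u ≠ 0}, _, ?_, ?_, ?_, ?_, ?_, ?_, rfl⟩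
    · exact isOpen_ne_fun (continuous_iff_continuousAt.mpr fun u => (hP u).continuousAt)
        continuous_const
    · exact isPreconnected_setOf_ne_zero fun u _ => hP u
    · exact fun u hu => poleFactor_ne_zero hx0 hx1 hκ hs hu
    · exact fun u hu => (hG u).fun_div (hP u) hu
    · intro ε hε
      have hd : Dense {u : Fin N → Fin m → ℂ | poleFactor κ x r s δ u ≠ 0} :=
        dense_setOf_ne_zero (fun u _ => hP u)
          ⟨0, poleFactor_ne_zero hx0 hx1 hκ hs fun t i => by simp⟩
      rw [Set.inter_comm]
      exact hd.inter_open_nonempty _ (isOpen_orderedDomain N m x ε)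
        (orderedDomain_nonempty hx0 hx1 hε)
    · filter_upwards [hsmall] with ε hε u hu
      rw [hmul u (hε u hu.2), mul_assoc]
      congr 1
      exact mul_div_cancel₀ _ hu.1

theorem screeningIntegral_apply (hN : 3 ≤ N) (hx0 : 0 < x) (hx1 : x < 1)
    (hκ : (κ.level r).re ≠ 0) (hr : ∀ n : ℕ, 1 ≤ n → bracket x (r * n) ≠ 0) (hr0 : r ≠ 0)
    (hr1 : r ≠ 1) (hρ : ρ ^ 2 = (r - 1) / r) {δ : ℂ} (hs : (s, δ) ∈ κ.contourDomain N r)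
    {ϑ : (Fin N → ℂ) → Sector N → ℂ} (hϑ : ∀ v, Differentiable ℂ fun u => ϑ u v)
    (v v' : Sector N) (μ ν : OscIndex N →₀ ℕ) :
    screeningIntegral κ x r ρ ϑ m s δ (ket v μ) v' ν = torusMean x fun u : Fin N → Fin m → ℂ =>
      κ.entireIntegrand x r s ρ ϑ v μ v' ν u / poleFactor κ x r s δ u := by
  have hiff := isMatrixElement_iff (m := m) hN hx0 hx1 hκ hr hr0 hr1 hρ hs hϑ v v' μ ν
  have hex : ∃ c, IsMatrixElement κ x r ρ ϑ m s δ v μ v' ν c := ⟨_, (hiff _).mpr rfl⟩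
  have e : screeningIntegral κ x r ρ ϑ m s δ (ket v μ) v' ν = hex.choose := by
    unfold screeningIntegral ket
    have hb : MvPolynomial.monomial μ 1 = MvPolynomial.basisMonomials (OscIndex N) ℂ μ := by simp
    rw [Finsupp.lsum_single, hb, Module.Basis.constr_basis]
    exact dif_pos hex
  rw [e]
  exact (hiff _).mp hex.choose_spec

end

section

open MeasureTheory

/-! ### Invariance of the matrix elements -/

section

variable {N m : ℕ} {κ : Screening} {x : ℝ} {r s ρ : ℂ}

theorem IsExpSeq.commute_right {𝓔 : Type*} [Ring 𝓔] [Algebra ℂ 𝓔] {A E : ℕ → 𝓔}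
    (h : IsExpSeq A E) {b : 𝓔} (hb : ∀ n, Commute b (A n)) (n : ℕ) : Commute b (E n) := by
  induction n using Nat.strong_induction_on with
  | _ n ih =>
    rcases Nat.eq_zero_or_pos n with rfl | hn
    · rw [h.1]; exact Commute.one_right b
    · have hn' : (n : ℂ) ≠ 0 := by exact_mod_cast hn.ne'
      have h1 : E n = (n : ℂ)⁻¹ • ((n : ℂ) • E n) := by
        rw [smul_smul, inv_mul_cancel₀ hn', one_smul]
      rw [h1, h.2]
      refine Commute.smul_right (Commute.sum_right _ _ _ fun p hp => ?_) _
      rw [Finset.HasAntidiagonal.mem_antidiagonal] at hp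
      rcases Nat.eq_zero_or_pos p.1 with h0 | h0
      · rw [h0, Nat.cast_zero, zero_smul]; exact Commute.zero_right b
      · exact ((hb p.1).mul_right (ih p.2 (by omega))).smul_right _

theorem Screening.commute_creation (i j : Fin N) (n k : ℕ) :
    Commute (κ.creation x r s i n) (κ.creation x r s j k) :=
  (κ.creation_isExpSeq x r s j).commute_right (fun k => ((κ.creation_isExpSeq x r s i).commute_right
    (fun n => κ.commute_creExp x r s j i k n) n).symm) k

theorem Screening.commute_annihilation (i j : Fin N) (n k : ℕ) :
    Commute (κ.annihilation x r s i n) (κ.annihilation x r s j k) :=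
  (κ.annihilation_isExpSeq x r s j).commute_right
    (fun k => ((κ.annihilation_isExpSeq x r s i).commute_right
    (fun n => κ.commute_annExp x r s j i k n) n).symm) k

/-- The action of the cyclic permutation of the colours on the pairs. -/
def rotatePair (N m : ℕ) : Fin N × Fin m ≃ Fin N × Fin m := (finRotate N).prodCongr (Equiv.refl _)

theorem orderedPairs_map_perm :
    ((orderedPairs N m).map (rotatePair N m)).Perm (orderedPairs N m) := by
  refine (List.perm_ext_iff_of_nodup (nodup_orderedPairs.map (rotatePair N m).injective)
    nodup_orderedPairs).mpr fun p => ?_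
  simp only [mem_orderedPairs, List.mem_map, true_and, iff_true]
  exact ⟨(rotatePair N m).symm p, (rotatePair N m).apply_symm_apply p⟩

theorem prod_orderedPairs_rotate {M : Type*} [Monoid M] (f : Fin N × Fin m → M)
    (hf : ∀ p q, Commute (f p) (f q)) :
    ((orderedPairs N m).map fun p => f (rotatePair N m p)).prod = ((orderedPairs N m).map f).prod := by
  have h := (orderedPairs_map_perm (N := N) (m := m)).map f
  rw [List.map_map] at h
  refine h.prod_eq' ?_
  rw [List.pairwise_map]
  exact List.pairwise_of_forall fun p q => hf _ _

/-- Rotating the colours disturbs the order of the factors, but the creation modes commute with each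
other and so do the annihilation modes. For the original ordered product this would fail. -/
theorem etaConj_normalProduct (hN : 3 ≤ N) (a b : Fin N × Fin m → ℕ) :
    etaConj N x s (κ.normalProduct x r s (orderedPairs N m) a b) =
      κ.normalProduct x r s (orderedPairs N m) (a ∘ (rotatePair N m).symm)
        (b ∘ (rotatePair N m).symm) := by
  unfold Screening.normalProduct
  rw [map_mul, map_list_prod, map_list_prod, List.map_map, List.map_map]
  have h1 := prod_orderedPairs_rotate (fun p : Fin N × Fin m =>
    κ.creation x r s p.1 ((a ∘ (rotatePair N m).symm) p))
    fun p q => κ.commute_creation _ _ _ _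
  have h2 := prod_orderedPairs_rotate (fun p : Fin N × Fin m =>
    κ.annihilation x r s p.1 ((b ∘ (rotatePair N m).symm) p))
    fun p q => κ.commute_annihilation _ _ _ _
  rw [← h1, ← h2]
  simp only [Function.comp_def, Equiv.symm_apply_apply, etaConj_creation x r s κ hN,
    etaConj_annihilation x r s κ hN]
  rfl

/-- The factor by which `η` acts on a monomial. -/
def etaMonomialCoef (x : ℝ) (s : ℂ) (μ : OscIndex N →₀ ℕ) : ℂ :=
  μ.prod fun p e => etaCoef x s p.1 (-(p.2 : ℤ)) ^ e

theorem etaMonomialCoef_ne_zero (x : ℝ) (s : ℂ) (μ : OscIndex N →₀ ℕ) :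
    etaMonomialCoef x s μ ≠ 0 :=
  Finset.prod_ne_zero_iff.mpr fun _ _ => pow_ne_zero _ (etaCoef_ne_zero _ _ _ _)

theorem etaOsc_monomial_one (μ : OscIndex N →₀ ℕ) : etaOsc N x s (MvPolynomial.monomial μ 1) =
    etaMonomialCoef x s μ • MvPolynomial.monomial (etaExp N μ) 1 := by
  rw [etaOsc_monomial, MvPolynomial.smul_monomial, smul_eq_mul]
  rfl

theorem coeff_etaOsc (ν : OscIndex N →₀ ℕ) (p : Osc N) :
    MvPolynomial.coeff (etaExp N ν) (etaOsc N x s p) =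
      etaMonomialCoef x s ν * MvPolynomial.coeff ν p := by
  induction p using MvPolynomial.induction_on' with
  | monomial μ c =>
    rw [etaOsc_monomial, MvPolynomial.coeff_monomial, MvPolynomial.coeff_monomial]
    simp only [(etaExp N).injective.eq_iff]
    split_ifs with h
    · subst h; rfl
    · rw [mul_zero]
  | add p q hp hq => rw [map_add, MvPolynomial.coeff_add, MvPolynomial.coeff_add, hp, hq, mul_add]

/-- On basis monomials `η` is a permutation up to scalars. The scalars are kept on both sides as
factors, so no division by them occurs. -/
theorem oscElement_etaConj (ν μ : OscIndex N →₀ ℕ) (T : Module.End ℂ (Osc N)) :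
    etaMonomialCoef x s μ * oscElement (etaExp N ν) (etaExp N μ) (etaConj N x s T) =
      etaMonomialCoef x s ν * oscElement ν μ T := by
  have h1 : etaMonomialCoef x s μ * oscElement (etaExp N ν) (etaExp N μ) (etaConj N x s T) =
      MvPolynomial.coeff (etaExp N ν) (etaConj N x s T
        (etaMonomialCoef x s μ • MvPolynomial.monomial (etaExp N μ) 1)) := by
    rw [map_smul, MvPolynomial.coeff_smul]; rfl
  rw [h1, ← etaOsc_monomial_one, etaConj_apply, AlgEquiv.symm_apply_apply, coeff_etaOsc]
  rfl

/-- The modes are summed over, so they can be relabelled along with the colours. -/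
theorem normalElement_rotate (hN : 3 ≤ N) (ν μ : OscIndex N →₀ ℕ) (u : Fin N → Fin m → ℂ) :
    etaMonomialCoef x s μ *
      κ.normalElement x r s (etaExp N ν) (etaExp N μ) (u ∘ (finRotate N).symm) =
      etaMonomialCoef x s ν * κ.normalElement x r s ν μ u := by
  unfold Screening.normalElement
  rw [← tsum_mul_left, ← tsum_mul_left,
    ← (((rotatePair N m).arrowCongr (Equiv.refl ℕ)).prodCongr
      ((rotatePair N m).arrowCongr (Equiv.refl ℕ))).tsum_eq]
  refine tsum_congr fun ab => ?_
  have h1 : (((rotatePair N m).arrowCongr (Equiv.refl ℕ)).prodCongr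
      ((rotatePair N m).arrowCongr (Equiv.refl ℕ))) ab =
      (ab.1 ∘ (rotatePair N m).symm, ab.2 ∘ (rotatePair N m).symm) := rfl
  rw [h1]
  simp only
  rw [← etaConj_normalProduct hN, ← mul_assoc, oscElement_etaConj, mul_assoc,
    ← Equiv.prod_comp (rotatePair N m)]
  simp only [Function.comp_apply, Equiv.symm_apply_apply]
  congr 2
  refine Finset.prod_congr rfl fun p _ => ?_
  have h2 : (rotatePair N m p).1 = finRotate N p.1 := rfl
  have h3 : (rotatePair N m p).2 = p.2 := rfl
  rw [h2, h3, Equiv.symm_apply_apply]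

theorem weightInner_eta (w w' : weightLattice N) :
    weightInner (etaWeight N w) (etaWeight N w') = weightInner w w' := by
  unfold weightInner
  congr 1
  exact comp_equiv_dotProduct_comp_equiv (w : Fin N → ℝ) (w' : Fin N → ℝ) (finRotate N).symm

theorem etaWeight_ebar (i : Fin N) : etaWeight N (ebar i) = ebar (finRotate N i) :=
  Subtype.ext (rotVec_ebarVec N i)

theorem momentum_eta (w : weightLattice N) (v : Sector N) :
    momentum ρ (etaWeight N w) (etaSector N v) = momentum ρ w v := by
  rw [momentum_eq, momentum_eq]
  change ρ⁻¹ * weightInner (etaWeight N w) (etaWeight N v.1) -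
    ρ * weightInner (etaWeight N w) (etaWeight N v.2) = _
  rw [weightInner_eta, weightInner_eta]

theorem zeroPower_rotate (t : Fin N) (u : ℂ) (v : Sector N) :
    κ.zeroPower x ρ (finRotate N t) u (etaSector N v) = κ.zeroPower x ρ t u v := by
  have h : alpha (finRotate N t) = etaWeight N (alpha t) := by
    unfold alpha; rw [map_sub, etaWeight_ebar, etaWeight_ebar]
  unfold Screening.zeroPower
  rw [h, momentum_eta]

/-- Only the product of the `zeroConst` refers to the Fock space, and for each `i : Fin m` its
product over the colours is the same everywhere. -/
theorem scalarConst_eta (hN : 3 ≤ N) (v v' : Sector N) :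
    κ.scalarConst x r s ρ N m v = κ.scalarConst x r s ρ N m v' := by
  unfold Screening.scalarConst
  congr 2
  rw [Fintype.prod_prod_type_right, Fintype.prod_prod_type_right]
  simp only
  rw [κ.prod_zeroConst x s ρ hN v v']

/-- Each of the three products runs over the whole circle of colours with a summand of the same form
for every colour; rotation just reindexes it. -/
theorem scalarFactor_rotate (u : Fin N → Fin m → ℂ) (v : Sector N) :
    κ.scalarFactor x r s ρ (u ∘ (finRotate N).symm) (etaSector N v) =
      κ.scalarFactor x r s ρ u v := by
  unfold Screening.scalarFactor
  congr 1
  · congr 1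
    · rw [← Equiv.prod_comp (finRotate N)]
      simp only [Function.comp_apply, Equiv.symm_apply_apply, zeroPower_rotate]
    · rw [← Equiv.prod_comp (finRotate N)]
      simp only [Function.comp_apply, Equiv.symm_apply_apply]
  · rw [← Equiv.prod_comp (finRotate N)]
    simp only [Function.comp_apply, Equiv.symm_apply_apply]

theorem poleFactor_rotate (δ : ℂ) (u : Fin N → Fin m → ℂ) :
    poleFactor κ x r s δ (u ∘ (finRotate N).symm) = poleFactor κ x r s δ u := by
  unfold poleFactor
  rw [← Equiv.prod_comp (finRotate N)]
  simp only [Function.comp_apply, Equiv.symm_apply_apply]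

theorem IsTheta.rotate {ω : ℂ} {ϑ : (Fin N → ℂ) → Sector N → ℂ} (hϑ : IsTheta κ x r ρ ω ϑ)
    (w : Fin N → ℂ) (v : Sector N) : ϑ (w ∘ (finRotate N).symm) (etaSector N v) = ϑ w v := by
  -- The covariance of `ϑ` is read off on a vacuum vector. The oscillators play no role there, so
  -- any value of `s` will do, and zero is taken.
  have h := LinearMap.congr_fun (hϑ.eta 0 w) (Finsupp.single (etaSector N v) 1)
  have h1 : (etaFock N x 0).symm (Finsupp.single (etaSector N v) 1) = Finsupp.single v 1 := by
    rw [LinearEquiv.symm_apply_eq]; simp [etaFock]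
  rw [LinearEquiv.conj_apply_apply, h1, zeroModeOp, zeroModeOp, sectorOp_single, sectorOp_single] at h
  have h2 := DFunLike.congr_fun h (etaSector N v)
  simp only [etaFock, id, LinearEquiv.trans_apply, Finsupp.domLCongr_single,
    Finsupp.mapRange.linearEquiv_apply, Finsupp.mapRange_single, Finsupp.single_eq_same,
    Module.End.one_apply, AlgEquiv.toLinearEquiv_apply, map_smul, map_one] at h2
  have h3 := congrArg (MvPolynomial.coeff 0) h2
  simp only [MvPolynomial.coeff_smul, MvPolynomial.coeff_zero_one, smul_eq_mul, mul_one] at h3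
  exact h3.symm

theorem entireIntegrand_rotate (hN : 3 ≤ N) {ω : ℂ} {ϑ : (Fin N → ℂ) → Sector N → ℂ}
    (hϑ : IsTheta κ x r ρ ω ϑ) (v v' : Sector N) (μ ν : OscIndex N →₀ ℕ)
    (u : Fin N → Fin m → ℂ) :
    etaMonomialCoef x s μ * κ.entireIntegrand x r s ρ ϑ (etaSector N v) (etaExp N μ)
      (etaSector N v') (etaExp N ν) (u ∘ (finRotate N).symm) =
    etaMonomialCoef x s ν * κ.entireIntegrand x r s ρ ϑ v μ v' ν u := by
  unfold Screening.entireIntegrand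
  simp only [(etaSector N).injective.eq_iff]
  split_ifs
  · rw [scalarFactor_rotate, scalarConst_eta hN (etaSector N v) v]
    have h1 : ϑ (fun t => ∑ i, (u ∘ (finRotate N).symm) t i) (etaSector N v) =
        ϑ (fun t => ∑ i, u t i) v := hϑ.rotate (fun t => ∑ i, u t i) v
    rw [h1]
    linear_combination (κ.scalarConst x r s ρ N m v * ϑ (fun t => ∑ i, u t i) v *
      κ.scalarFactor x r s ρ u v) * normalElement_rotate (κ := κ) (x := x) (r := r) (s := s) hN ν μ u
  · rw [mul_zero, mul_zero]

/-- Permuting coordinates preserves Lebesgue measure and the cube of integration. -/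
theorem torusMean_comp_rotate (Φ : (Fin N → Fin m → ℂ) → ℂ) :
    torusMean x (fun u => Φ (u ∘ (finRotate N).symm)) = torusMean x Φ := by
  unfold torusMean
  congr 1
  have h := (volume_measurePreserving_piCongrLeft (fun _ : Fin N => Fin m → ℝ)
    (finRotate N)).setIntegral_preimage_emb (MeasurableEquiv.measurableEmbedding _)
    (fun θ => Φ fun t i => Complex.I * (θ t i : ℂ) / (2 * (Real.log x : ℂ)))
    (Set.Icc (0 : Fin N → Fin m → ℝ) (fun _ _ => 2 * Real.pi))
  have h1 : ∀ θ : Fin N → Fin m → ℝ, MeasurableEquiv.piCongrLeft (fun _ : Fin N => Fin m → ℝ)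
      (finRotate N) θ = θ ∘ (finRotate N).symm := by
    intro θ
    funext t
    obtain ⟨t, rfl⟩ := (finRotate N).surjective t
    rw [MeasurableEquiv.coe_piCongrLeft, Equiv.piCongrLeft_apply_apply, Function.comp_apply,
      Equiv.symm_apply_apply]
  rw [← h]
  have h2 : (MeasurableEquiv.piCongrLeft (fun _ : Fin N => Fin m → ℝ) (finRotate N)) ⁻¹'
      (Set.Icc (0 : Fin N → Fin m → ℝ) (fun _ _ => 2 * Real.pi)) =
      Set.Icc (0 : Fin N → Fin m → ℝ) (fun _ _ => 2 * Real.pi) := by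
    ext θ
    rw [Set.mem_preimage, h1, Set.mem_Icc, Set.mem_Icc]
    constructor
    · rintro ⟨ha, hb⟩
      refine ⟨fun t => ?_, fun t => ?_⟩
      · have := ha (finRotate N t); rwa [Function.comp_apply, Equiv.symm_apply_apply] at this
      · have := hb (finRotate N t); rwa [Function.comp_apply, Equiv.symm_apply_apply] at this
    · rintro ⟨ha, hb⟩
      exact ⟨fun t => ha ((finRotate N).symm t), fun t => hb ((finRotate N).symm t)⟩
  rw [h2]
  simp only [h1]
  rfl

theorem screeningIntegral_rotate (hN : 3 ≤ N) (hx0 : 0 < x) (hx1 : x < 1)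
    (hκ : (κ.level r).re ≠ 0) (hr : ∀ n : ℕ, 1 ≤ n → bracket x (r * n) ≠ 0) (hr0 : r ≠ 0)
    (hr1 : r ≠ 1) (hρ : ρ ^ 2 = (r - 1) / r) {δ : ℂ} (hs : (s, δ) ∈ κ.contourDomain N r)
    {ω : ℂ} {ϑ : (Fin N → ℂ) → Sector N → ℂ} (hϑ : IsTheta κ x r ρ ω ϑ)
    (v v' : Sector N) (μ ν : OscIndex N →₀ ℕ) :
    etaMonomialCoef x s μ * screeningIntegral κ x r ρ ϑ m s δ
      (ket (etaSector N v) (etaExp N μ)) (etaSector N v') (etaExp N ν) =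
    etaMonomialCoef x s ν * screeningIntegral κ x r ρ ϑ m s δ (ket v μ) v' ν := by
  have happ := screeningIntegral_apply (m := m) hN hx0 hx1 hκ hr hr0 hr1 hρ hs hϑ.holomorphic
  have hmul : ∀ (c : ℂ) (Φ : (Fin N → Fin m → ℂ) → ℂ),
      c * torusMean x Φ = torusMean x fun u => c * Φ u := by
    intro c Φ
    unfold torusMean
    rw [integral_const_mul]; ring
  rw [happ, happ, ← torusMean_comp_rotate, hmul, hmul]
  refine torusMean_congr fun u _ => ?_
  rw [poleFactor_rotate, ← mul_div_assoc, ← mul_div_assoc, entireIntegrand_rotate hN hϑ]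

/-! ### Invariant operators -/

theorem etaOp_apply_ket (A : Op N) (v v' : Sector N) (μ ν : OscIndex N →₀ ℕ) :
    etaMonomialCoef x s μ * etaOp x s A (ket (etaSector N v) (etaExp N μ)) (etaSector N v')
      (etaExp N ν) = etaMonomialCoef x s ν * A (ket v μ) v' ν := by
  have h1 : (etaFock N x s).symm (etaMonomialCoef x s μ • ket (etaSector N v) (etaExp N μ)) =
      ket v μ := by
    rw [LinearEquiv.symm_apply_eq]
    simp only [ket, etaFock, LinearEquiv.trans_apply, Finsupp.domLCongr_single,
      Finsupp.mapRange.linearEquiv_apply, Finsupp.mapRange_single,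
      AlgEquiv.toLinearEquiv_apply, etaOsc_monomial_one, Finsupp.smul_single]
  have h2 : etaMonomialCoef x s μ * etaOp x s A (ket (etaSector N v) (etaExp N μ)) (etaSector N v')
      (etaExp N ν) = etaOp x s A (etaMonomialCoef x s μ • ket (etaSector N v) (etaExp N μ))
        (etaSector N v') (etaExp N ν) := by
    rw [map_smul]; rfl
  rw [h2]
  simp only [etaOp, LinearMap.comp_apply, LinearEquiv.coe_coe, h1]
  simp only [etaHat, LinearMap.coe_mk, AddHom.coe_mk, Equiv.symm_apply_apply,
    AddEquiv.symm_apply_apply]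
  rfl

theorem Op.ext_ket {A B : Op N} (h : ∀ v μ v' ν, A (ket v μ) v' ν = B (ket v μ) v' ν) : A = B := by
  refine Finsupp.lhom_ext' fun v => (MvPolynomial.basisMonomials (OscIndex N) ℂ).ext fun μ => ?_
  funext v' ν
  simpa [ket] using h v μ v' ν

/-- Invariance as a family of scalar identities. In this form it can be continued analytically,
although `η` itself depends on `s`. -/
theorem etaOp_eq_self {A : Op N} (h : ∀ v μ v' ν, etaMonomialCoef x s μ *
    A (ket (etaSector N v) (etaExp N μ)) (etaSector N v') (etaExp N ν) =
    etaMonomialCoef x s ν * A (ket v μ) v' ν) : etaOp x s A = A := by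
  refine Op.ext_ket fun v μ v' ν => ?_
  obtain ⟨v, rfl⟩ := (etaSector N).surjective v
  obtain ⟨v', rfl⟩ := (etaSector N).surjective v'
  obtain ⟨μ, rfl⟩ := (etaExp N).surjective μ
  obtain ⟨ν, rfl⟩ := (etaExp N).surjective ν
  refine mul_left_cancel₀ (etaMonomialCoef_ne_zero x s μ) ?_
  rw [etaOp_apply_ket, h]

theorem analyticAt_etaMonomialCoef {X : Type*} [NormedAddCommGroup X] [NormedSpace ℂ X]
    {σ : X → ℂ} {p : X} (hσ : AnalyticAt ℂ σ p) (μ : OscIndex N →₀ ℕ) :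
    AnalyticAt ℂ (fun p => etaMonomialCoef x (σ p) μ) p := by
  unfold etaMonomialCoef Finsupp.prod
  refine Finset.analyticAt_fun_prod _ fun i _ => AnalyticAt.fun_pow ?_ _
  unfold etaCoef
  have h2 : AnalyticAt ℂ (fun p => 2 * σ p / (N : ℂ)) p := by
    simp only [div_eq_mul_inv]
    exact (analyticAt_const.mul hσ).mul analyticAt_const
  split_ifs
  · exact analyticAt_xpow (h2.neg.mul analyticAt_const)
  · exact analyticAt_xpow ((h2.mul analyticAt_const).mul analyticAt_const)

/-- Invariance under `η` is preserved by analytic continuation. -/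
theorem IsContinuation.etaOp_eq {X : Type*} [NormedAddCommGroup X] [NormedSpace ℂ X]
    {Γ : X → Op N} {S : Set X} {p₀ : X} {A : Op N} (hA : IsContinuation Γ S p₀ A)
    {σ : X → ℂ} (hσ : ∀ p, AnalyticAt ℂ σ p)
    (hΓ : ∀ p ∈ S, ∀ v μ v' ν, etaMonomialCoef x (σ p) μ *
      Γ p (ket (etaSector N v) (etaExp N μ)) (etaSector N v') (etaExp N ν) =
      etaMonomialCoef x (σ p) ν * Γ p (ket v μ) v' ν) :
    etaOp x (σ p₀) A = A := by
  obtain ⟨D, V, g, -, hDc, hp₀, hg, hVo, ⟨p₁, hp₁⟩, hVD, hgΓ, rfl⟩ := hA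
  refine etaOp_eq_self fun v μ v' ν => ?_
  -- Both sides are analytic on `D`, the coefficients being products of exponentials in `s`, and
  -- they agree on the open set `V`; connectedness of `D` carries the identity to `p₀`.
  refine AnalyticOnNhd.eqOn_of_preconnected_of_eventuallyEq (𝕜 := ℂ) (z₀ := p₁)
    (f := fun p => etaMonomialCoef x (σ p) μ *
      g p (ket (etaSector N v) (etaExp N μ)) (etaSector N v') (etaExp N ν))
    (g := fun p => etaMonomialCoef x (σ p) ν * g p (ket v μ) v' ν)
    (fun p hp => (analyticAt_etaMonomialCoef (hσ p) μ).mul (hg _ _ _ _ p hp))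
    (fun p hp => (analyticAt_etaMonomialCoef (hσ p) ν).mul (hg _ _ _ _ p hp)) hDc (hVD hp₁).1 ?_ hp₀
  filter_upwards [hVo.mem_nhds hp₁] with p hp
  rw [hgΓ p hp]
  exact hΓ p (hVD hp).2 v μ v' ν

theorem Screening.mem_contourDomain (hN : 3 ≤ N) (h : 0 < (κ.level r).re) (h0 : 0 < s.re)
    (h1 : s.re < N) : (s, (0 : ℂ)) ∈ κ.contourDomain N r := by
  have hN0 : (0 : ℝ) < N := by exact_mod_cast (show 0 < N by omega)
  have e : (s / (N : ℂ)).re = s.re / N := by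
    rw [← Complex.ofReal_natCast, Complex.div_ofReal_re]
  refine ⟨h0, h1, ?_, ?_⟩
  · simp only [innerExp, regime, if_pos h, sub_self, sub_zero, add_zero, e]
    positivity
  · simp only [outerExp, regime, if_pos h, sub_zero, Complex.sub_re, Complex.one_re, e]
    rw [sub_neg, div_lt_one hN0]
    exact h1

end

end

end NonlocalIM

end

theorem mainTheorem8 (N m : ℕ) (hN : 3 ≤ N) (hm : 1 ≤ m)
    (x : ℝ) (hx0 : 0 < x) (hx1 : x < 1)
    (r ρ ω : ℂ) (hr : ∀ n : ℕ, 1 ≤ n → bracket x (r * n) ≠ 0) (hr1 : r ≠ 1)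
    (hρ : ρ ^ 2 = (r - 1) / r) (hω : ω ^ 2 = r * (r - 1))
    (κ : Screening) (hκ : (κ.level r).re ≠ 0)
    (ϑ : (Fin N → ℂ) → Sector N → ℂ) (hϑ : IsTheta κ x r ρ ω ϑ) :
    -- the integrals are well defined
    (∀ s δ : ℂ, (s, δ) ∈ κ.contourDomain N r → ∀ v μ v' ν,
      ∃! c, IsMatrixElement κ x r ρ ϑ m s δ v μ v' ν c) ∧
    -- `Re r > 0` for `G_m`, `Re r* < 0` for `G_m^*`, and `0 < Re s < N`
    (0 < (κ.level r).re → ∀ s : ℂ, 0 < s.re → s.re < N →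
      etaOp x s (screeningIntegral κ x r ρ ϑ m s 0) = screeningIntegral κ x r ρ ϑ m s 0) ∧
    -- the same regimes, generic `s`: analytic continuation in `s`
    (0 < (κ.level r).re → ∀ (s : ℂ) (A : Op N),
      IsContinuation (fun s' : ℂ => screeningIntegral κ x r ρ ϑ m s' 0)
        {s' : ℂ | 0 < s'.re ∧ s'.re < N} s A →
      etaOp x s A = A) ∧
    -- `Re r < 0` for `G_m`, `Re r* > 0` for `G_m^*`
    ((κ.level r).re < 0 → ∀ (s : ℂ) (A : Op N),
      IsContinuation (fun p : ℂ × ℂ => screeningIntegral κ x r ρ ϑ m p.1 p.2)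
        (κ.contourDomain N r) (s, 0) A →
      etaOp x s A = A) := by
  -- For `r = 0` the bracket `[r]` would vanish.
  have hr0 : r ≠ 0 := by
    rintro rfl
    exact hr 1 le_rfl (by simp [bracket])
  refine ⟨fun s δ hs v μ v' ν => ?_, fun h s h0 h1 => ?_, fun h s A hA => ?_, fun _ s A hA => ?_⟩
  · have hiff := isMatrixElement_iff (m := m) hN hx0 hx1 hκ hr hr0 hr1 hρ hs hϑ.holomorphic v v' μ ν
    exact ⟨_, (hiff _).mpr rfl, fun c hc => (hiff c).mp hc⟩
  · exact etaOp_eq_self fun v μ v' ν => screeningIntegral_rotate hN hx0 hx1 hκ hr hr0 hr1 hρ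
      (Screening.mem_contourDomain hN h h0 h1) hϑ v v' μ ν
  · exact hA.etaOp_eq (σ := id) (fun p => analyticAt_id) fun p hp v μ v' ν =>
      screeningIntegral_rotate hN hx0 hx1 hκ hr hr0 hr1 hρ
        (Screening.mem_contourDomain hN h hp.1 hp.2) hϑ v v' μ ν
  · exact hA.etaOp_eq (σ := Prod.fst) (fun p => analyticAt_fst) fun p hp v μ v' ν =>
      screeningIntegral_rotate hN hx0 hx1 hκ hr hr0 hr1 hρ hp hϑ v v' μ ν
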